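/- **Problem.** Let $R=[a,b]\times[c,d]$ and let $\Gamma$ be a simple closed $C^2$ curve in the interior of $R$, with arc-length parametrization $X(s)$ and unit normal $n$. Let $\Gamma=\{\varphi=0\}$ for a Lipschitz function $\varphi$ on $R$ that changes sign across $\Gamma$ in the direction of $n$ and satisfies $|\varphi(x)|\ge c_0\,\mathrm{dist}(x,\Gamma)$ for some $c_0>0$. Let $R^\pm=\{\pm\varphi>0\}$, and let $\kappa=\kappa^\pm>0$ be constant on each side. Consider $$\kappa\Delta u=f\ \text{ in } R\setminus\Gamma,\qquad [u]_\Gamma=w\in C^2,\quad [\kappa\,\partial_n u]_\Gamma=v\in C^1,$$ with $u=g_D$ on a nonempty set $D\subset\partial R$ and $\partial_n u+\sigma u=g$ on $\partial R\setminus D$ (Neumann or Robin; on each side of the rectangle $\sigma\ge0$ is continuous). Assume that some boundary segment of positive length consists of points that are in $D$ or have $\sigma>0$. Assume that the solution is piecewise smooth: $u=u^\pm$ on $R^\pm$ with $u^\pm\in C^6(\mathbb R^2)$. At points of $\Gamma$, values are taken from the side $R^-$. **Grid.** Let $h=(b-a)/M=(d-c)/N$, let $r\ge1$ be an integer, and let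 $\lambda>0$. A coarse grid point with $|\varphi|\le\lambda h$ is a parent. All coarse cells with a parent at a corner are refined with step $h/r$. The grid points are the coarse grid points and the fine points of the refined cells. A point is fine-interior if it is interior to the union of the refined cells. The other interior points are either coarse points or hanging nodes (non-coarse points on the boundary of the refined region). **Scheme.** At each grid point that is not a Dirichlet point the equation is $\sum_k\alpha_kU_k=\sum_k\beta_kf_k+C$, where: * at coarse points that are not fine-interior, it is the fourth-order compact nine-point scheme: $\alpha=\frac{\kappa}{6h^2}(-20;4;1)$, $\beta=\frac1{12}(8;1;0)$ (centre; edge neighbours; corners), $C=0$; * at fine-interior points whose five-point stencil lies on one side of $\Gamma$ (regular), it is the five-point scheme with step $h/r$; * at the other fine-interior points (irregular), it is an immersed interface scheme $\sum\alpha_kU_k=f+C$ on the nine-point stencil with step $h/r$. Let $X^*$ be a nearest point of $\Gamma$. For every pair of quadratic polynomials $q^\pm$ that satisfies at $X^*$ the jump relations ($[q]$ with its first two and $[\kappa\partial_nq]$ with its first tangential derivatives equal to those of $w$ and $v$, and $[\kappa\Delta q]=[f]$), one has $\sum\alpha_kq^{\pm}(x_k)=\kappa\Delta q^{\pm}+C$,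 the sign being that of the side of the respective grid point; * at a hanging node on a coarse edge with ends $p_0,p_1$ and unit normal $\nu$, it is a seven-point scheme on the node, $p_i$ and $p_i\pm h\nu$ ($i=0,1$), with $C=0$, $\sum\beta_k=1$, and $\sum\alpha_kp(x_k)=\sum\beta_k\kappa\Delta p(x_k)$ for all monomials $p=\tilde x^k\tilde y^l$, $k+l\le4$, centred at the node, other than $\tilde x^4$ and $\tilde y^4$; * at a boundary point not in $D$, it is a scheme on the coarse grid points at most two coarse steps away in each direction, with $\sum\beta_k=1$ and $C=\sum\gamma_kg_k$, where the data $g_k$ are taken at stencil points outside $D$ on the side(s) through the point and $|\gamma_k|\le K/h$, such that $\sum\alpha_kp(x_k)=\sum\beta_k\kappa\Delta p(x_k)+\sum\gamma_k(\partial_np+\sigma p)(x_k)$ for all polynomials $p$ of degree $\le3$. At the grid points in $D$, $U=g_D$. **Theorem.** Fix such a problem and solution, $\lambda>0$, and $K$. There are $C$ and $h_0>0$ such that for all grids with this $\lambda$, with $h\le h_0$, and such that no stencil at a coarse point that is not fine-interior, or at a hanging node, contains points on both sides of $\Gamma$, for all choices of the scheme such that at every non-Dirichlet grid point the diagonal coefficient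 is negative, the off-diagonal coefficients are nonnegative (sign property), $\|\alpha\|_\infty\le K/(\text{local step})^2$ (local step $h/r$ at fine-interior points, $h$ elsewhere) and $\|\beta\|_\infty\le K$, and for every finite difference solution $U$, $$\max_{\text{grid points}}|u(x_i,y_j)-U_{ij}|\le C\bigl(h^3+(h/r)^2\bigr).$$ The constant $C$ does not depend on $h$, $r$ or the choice of the scheme. -/

import Mathlib

open scoped NNReal Topology
open Laplacian

noncomputable section

namespace TwoGrid

/-- The Euclidean plane. -/
abbrev Plane := EuclideanSpace ℝ (Fin 2)

/-- The two sides of the interface. -/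
inductive Phase
  | minus
  | plus

/-- The four sides of the rectangle: `(i, false)` is the side on which the `i`-th coordinate is
smallest, `(i, true)` the one on which it is largest. -/
abbrev Side := Fin 2 × Bool

/-- Outward unit normal of a side of the rectangle. -/
def Side.normal (s : Side) : Plane :=
  EuclideanSpace.single s.1 (if s.2 then (1 : ℝ) else -1)

/-- Data of an elliptic interface problem on the rectangle `∏ [lo i, hi i]`:
`κ Δ u = f` away from the interface, `[u] = w` and `[κ ∂ₙu] = v` on the interface,
`u = gD` on the set `D` of Dirichlet points, and `∂ₙu + σ u = g` on the rest of the boundary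
(`σ = 0` is the Neumann condition).  The interface is the zero set of `φ`, parametrized by `X`. -/
structure InterfaceProblem where
  lo : Fin 2 → ℝ
  hi : Fin 2 → ℝ
  κ : Phase → ℝ
  f : Phase → Plane → ℝ
  φ : Plane → ℝ
  X : ℝ → Plane
  period : ℝ
  w : ℝ → ℝ
  v : ℝ → ℝ
  D : Set Plane
  gD : Plane → ℝ
  σ : Side → Plane → ℝ
  g : Side → Plane → ℝ

namespace InterfaceProblem

variable (P : InterfaceProblem)

/-- The closed rectangle. -/
def rect : Set Plane := {x | ∀ i, P.lo i ≤ x i ∧ x i ≤ P.hi i}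

/-- A closed side of the rectangle. -/
def side (s : Side) : Set Plane :=
  {x | x ∈ P.rect ∧ x s.1 = if s.2 then P.hi s.1 else P.lo s.1}

/-- Unit normal of the interface at `X t`. -/
def normal (t : ℝ) : Plane := !₂[deriv P.X t 1, -deriv P.X t 0]

open Classical in
/-- The side of the interface to which a point is attributed; points on the interface count as
`minus`. -/
def phase (x : Plane) : Phase := if P.φ x ≤ 0 then Phase.minus else Phase.plus

/-- The part of the rectangle on one side of the interface, the interface included. -/
def region : Phase → Set Plane
  | Phase.minus => {x | x ∈ P.rect ∧ P.φ x ≤ 0}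
  | Phase.plus => {x | x ∈ P.rect ∧ 0 ≤ P.φ x}

/-- Standing assumptions on the data. -/
structure Admissible : Prop where
  lo_lt_hi : ∀ i, P.lo i < P.hi i
  κ_pos : ∀ s, 0 < P.κ s
  /-- The interface is a simple closed `C²` curve in the open rectangle, in arc length. -/
  X_smooth : ContDiff ℝ 2 P.X
  period_pos : 0 < P.period
  X_periodic : Function.Periodic P.X P.period
  X_arclength : ∀ t, ‖deriv P.X t‖ = 1
  X_simple : Set.InjOn P.X (Set.Ico 0 P.period)
  X_interior : ∀ t i, P.lo i < P.X t i ∧ P.X t i < P.hi i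
  /-- `φ` is a Lipschitz level set function: it vanishes exactly on the interface, is negative on
  one side and positive on the other, and is comparable to the distance from the interface. -/
  φ_lipschitz : ∃ l : ℝ≥0, LipschitzOnWith l P.φ P.rect
  φ_zero : ∀ t, P.φ (P.X t) = 0
  φ_dist : ∃ c > 0, ∀ x ∈ P.rect, c * Metric.infDist x (Set.range P.X) ≤ |P.φ x|
  φ_sign : ∀ t, ∀ᶠ ε in 𝓝[>] (0 : ℝ),
    P.φ (P.X t - ε • P.normal t) < 0 ∧ 0 < P.φ (P.X t + ε • P.normal t)
  w_smooth : ContDiff ℝ 2 P.w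
  v_smooth : ContDiff ℝ 1 P.v
  /-- Boundary condition: `σ` is continuous and nonnegative on each closed side. -/
  σ_continuous : ∀ s, ContinuousOn (P.σ s) (P.side s)
  σ_nonneg : ∀ s, ∀ x ∈ P.side s, 0 ≤ P.σ s x
  D_boundary : ∀ x ∈ P.D, ∃ s, x ∈ P.side s
  D_nonempty : P.D.Nonempty
  /-- On some boundary segment of positive length the condition is not the pure Neumann one. -/
  not_pure_neumann : ∃ s, ∃ p ∈ P.side s, ∃ q ∈ P.side s, p ≠ q ∧
    ∀ x ∈ segment ℝ p q, x ∈ P.D ∨ 0 < P.σ s x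

/-- `u` is a piecewise smooth solution: on each side of the interface it agrees with a `C⁶`
function `u s`, so that it is `C⁶` up to the interface and up to the boundary. -/
structure IsSolution (u : Phase → Plane → ℝ) : Prop where
  smooth : ∀ s, ContDiff ℝ 6 (u s)
  pde : ∀ s, ∀ x ∈ P.region s, P.κ s * (Δ (u s)) x = P.f s x
  jump : ∀ t, u Phase.plus (P.X t) - u Phase.minus (P.X t) = P.w t
  flux_jump : ∀ t, P.κ Phase.plus * fderiv ℝ (u Phase.plus) (P.X t) (P.normal t)
    - P.κ Phase.minus * fderiv ℝ (u Phase.minus) (P.X t) (P.normal t) = P.v t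
  dirichlet : ∀ x ∈ P.D, u (P.phase x) x = P.gD x
  robin : ∀ s, ∀ x ∈ P.side s, x ∉ P.D →
    fderiv ℝ (u (P.phase x)) x s.normal + P.σ s x * u (P.phase x) x = P.g s x

end InterfaceProblem

/-- Grid points are addressed by integer multiples of the fine step. -/
abbrev Node := Fin 2 → ℤ

/-- Parameters of a two-grid: numbers of coarse cells in the two directions, coarse step `h`,
refinement ratio `r`, tube width `lam`. -/
structure Grid where
  n : Fin 2 → ℕ
  r : ℕ
  h : ℝ
  lam : ℝ

/-- The function on the plane given by a polynomial in two variables. -/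
def polyFun (p : MvPolynomial (Fin 2) ℝ) : Plane → ℝ := fun x => MvPolynomial.eval (fun i => x i) p

namespace Grid

variable (P : InterfaceProblem) (T : Grid)

/-- The grid parameters fit the rectangle. -/
structure Fits : Prop where
  h_pos : 0 < T.h
  r_pos : 1 ≤ T.r
  cells : ∀ i, P.hi i - P.lo i = T.n i * T.h

/-- Fine step `h / r`. -/
def fineStep : ℝ := T.h / T.r

/-- Position of a node. -/
def point (a : Node) : Plane := WithLp.toLp 2 (fun i => P.lo i + a i * T.fineStep)

/-- The node lies in the closed rectangle. -/
def InRange (a : Node) : Prop := ∀ i, 0 ≤ a i ∧ a i ≤ (T.r : ℤ) * (T.n i : ℤ)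

/-- The node lies in the open rectangle. -/
def Interior (a : Node) : Prop := ∀ i, 0 < a i ∧ a i < (T.r : ℤ) * (T.n i : ℤ)

/-- The node is a coarse grid position. -/
def IsVertex (a : Node) : Prop := ∀ i, (T.r : ℤ) ∣ a i

/-- Parent points: coarse grid points in the tube `|φ| ≤ lam h`. -/
def IsParent (a : Node) : Prop :=
  T.InRange a ∧ T.IsVertex a ∧ |P.φ (T.point P a)| ≤ T.lam * T.h

/-- Indices of coarse cells. -/
def IsCell (c : Node) : Prop := ∀ i, 0 ≤ c i ∧ c i < (T.n i : ℤ)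

/-- The node `a` lies in the closed coarse cell `c`. -/
def InCell (c a : Node) : Prop := ∀ i, (T.r : ℤ) * c i ≤ a i ∧ a i ≤ (T.r : ℤ) * (c i + 1)

/-- A coarse cell is refined if one of its corners is a parent point, that is, if it belongs to the
square of half-width `h` about a parent point. -/
def Refined (c : Node) : Prop := T.IsCell c ∧ ∃ a, T.IsParent P a ∧ T.InCell c a

/-- Grid points of the two-grid: coarse grid points and fine points of the refined cells. -/
def IsNode (a : Node) : Prop :=
  T.InRange a ∧ (T.IsVertex a ∨ ∃ c, T.Refined P c ∧ T.InCell c a)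

/-- Interior grid points of the fine mesh: all coarse cells around the point are refined. -/
def FineInterior (a : Node) : Prop :=
  T.Interior a ∧ ∀ c, T.IsCell c → T.InCell c a → T.Refined P c

/-- A point of the fine mesh is regular if the five-point stencil stays on one side of the
interface, and irregular otherwise. -/
def Regular (a : Node) : Prop :=
  ∀ i : Fin 2, ∀ e : ℤ, e = 1 ∨ e = -1 →
    P.phase (T.point P (a + Pi.single i e)) = P.phase (T.point P a)

/-- Hanging nodes: interior grid points that are not coarse grid points and lie on the boundary of
the refined region. -/
def Hanging (a : Node) : Prop :=
  T.IsNode P a ∧ T.Interior a ∧ ¬ T.FineInterior P a ∧ ¬ T.IsVertex a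

/-- The offsets of a nine-point stencil. -/
def offsets : Finset Node := Fintype.piFinset fun _ => ({-1, 0, 1} : Finset ℤ)

/-- Nine-point stencil with spacing `k` (in units of the fine step). -/
def nine (a : Node) (k : ℤ) : Finset Node := offsets.image fun o => a + k • o

/-- Seven-point stencil at a hanging node: the node itself, the two ends of the coarse edge on which
it lies, and the translates of these ends by `± h` perpendicular to the edge. -/
def seven (a : Node) : Finset Node :=
  insert a (Fintype.piFinset fun i =>
    if (T.r : ℤ) ∣ a i then {a i - T.r, a i, a i + T.r}
    else {(T.r : ℤ) * (a i / (T.r : ℤ)), (T.r : ℤ) * (a i / (T.r : ℤ)) + T.r})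

open Classical in
/-- Stencil at a boundary point: the coarse grid points at most two coarse steps away. -/
def boundaryStencil (a : Node) : Finset Node :=
  (Fintype.piFinset fun i =>
    ({a i - 2 * T.r, a i - T.r, a i, a i + T.r, a i + 2 * T.r} : Finset ℤ)).filter T.InRange

open Classical in
/-- The stencil of the difference equation at a grid point. -/
def stencil (a : Node) : Finset Node :=
  if T.Interior a then
    if T.FineInterior P a then nine a 1
    else if T.IsVertex a then nine a T.r
    else T.seven a
  else T.boundaryStencil a

/-- The interface stays inside the fine mesh: the stencils of the coarse scheme and of the
hanging-node scheme do not reach across it.  (When `φ` is the signed distance, or just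
`1`-Lipschitz, `lam ≥ √2` suffices.) -/
def Resolves : Prop :=
  ∀ a, T.IsNode P a → T.Interior a → ¬ T.FineInterior P a → ∀ b ∈ T.stencil P a,
    P.phase (T.point P b) = P.phase (T.point P a)

/-- The mesh size that governs the difference equation at a grid point. -/
def localStep [∀ a, Decidable (T.FineInterior P a)] (a : Node) : ℝ :=
  if T.FineInterior P a then T.fineStep else T.h

end Grid

/-- Weights of the fourth-order compact nine-point Laplacian, times `h²`. -/
def compactLap (o : Node) : ℝ :=
  if o = 0 then -20 / 6 else if o 0 = 0 ∨ o 1 = 0 then 4 / 6 else 1 / 6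

/-- Weights of the averaging operator of the fourth-order compact scheme. -/
def compactAvg (o : Node) : ℝ :=
  if o = 0 then 8 / 12 else if o 0 = 0 ∨ o 1 = 0 then 1 / 12 else 0

/-- Weights of the five-point Laplacian, times the square of the step. -/
def fivePoint (o : Node) : ℝ :=
  if o = 0 then -4 else if o 0 = 0 ∨ o 1 = 0 then 1 else 0

/-- A pair of functions satisfies at `X t` the interface relations up to second order: the jump in
value together with its first two derivatives along the interface, the jump in flux together with
its first derivative along the interface, and the jump in the differential equation. -/
structure JumpCompatible (P : InterfaceProblem) (t : ℝ) (q : Phase → Plane → ℝ) : Prop where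
  value : ∀ k ≤ 2, iteratedDeriv k
      (fun s => q Phase.plus (P.X s) - q Phase.minus (P.X s)) t = iteratedDeriv k P.w t
  flux : ∀ k ≤ 1, iteratedDeriv k
      (fun s => P.κ Phase.plus * fderiv ℝ (q Phase.plus) (P.X s) (P.normal s)
        - P.κ Phase.minus * fderiv ℝ (q Phase.minus) (P.X s) (P.normal s)) t
      = iteratedDeriv k P.v t
  source : P.κ Phase.plus * (Δ (q Phase.plus)) (P.X t)
      - P.κ Phase.minus * (Δ (q Phase.minus)) (P.X t)
      = P.f Phase.plus (P.X t) - P.f Phase.minus (P.X t)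

/-- A system of difference equations
`∑ b, α a b * U b = ∑ b, β a b * f b + corr a`, one for each grid point `a`. -/
structure Scheme where
  α : Node → Node → ℝ
  β : Node → Node → ℝ
  corr : Node → ℝ

namespace Scheme

open Grid

variable (P : InterfaceProblem) (T : Grid) (S : Scheme)

/-- Fourth-order compact scheme on the coarse grid. -/
def CoarseRow (a : Node) : Prop :=
  (∀ o ∈ offsets,
    S.α a (a + (T.r : ℤ) • o) = P.κ (P.phase (T.point P a)) * compactLap o / T.h ^ 2 ∧
    S.β a (a + (T.r : ℤ) • o) = compactAvg o) ∧ S.corr a = 0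

/-- Standard second-order five-point scheme on the fine grid. -/
def FineRow (a : Node) : Prop :=
  (∀ o ∈ offsets,
    S.α a (a + o) = P.κ (P.phase (T.point P a)) * fivePoint o / T.fineStep ^ 2 ∧
    S.β a (a + o) = if o = 0 then 1 else 0) ∧ S.corr a = 0

/-- Immersed interface scheme at an irregular point, `∑ α U = f + corr` on the nine-point stencil:
with respect to a projection `X t` of the grid point onto the interface, the equation is exact for
all pairs of quadratic polynomials that satisfy the interface relations at `X t`. -/
def ImmersedRow (a : Node) : Prop :=
  (∀ b, S.β a b = if b = a then 1 else 0) ∧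
  ∃ t, dist (T.point P a) (P.X t) = Metric.infDist (T.point P a) (Set.range P.X) ∧
    ∀ p : Phase → MvPolynomial (Fin 2) ℝ, (∀ s, (p s).totalDegree ≤ 2) →
      JumpCompatible P t (fun s => polyFun (p s)) →
      ∑ b ∈ nine a 1, S.α a b * polyFun (p (P.phase (T.point P b))) (T.point P b)
        = P.κ (P.phase (T.point P a)) *
            (Δ (polyFun (p (P.phase (T.point P a))))) (T.point P a) + S.corr a

/-- Seven-point scheme at a hanging node: the `β`'s add up to one, and the equation is exact for all
monomials of degree at most four about the hanging node, except the two pure fourth powers. -/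
def HangingRow (a : Node) : Prop :=
  S.corr a = 0 ∧ ∑ b ∈ T.seven a, S.β a b = 1 ∧
  ∀ m : Fin 2 → ℕ, m 0 + m 1 ≤ 4 → m 0 ≠ 4 → m 1 ≠ 4 →
    ∀ p : Plane → ℝ, (p = fun x => ∏ i, (x i - T.point P a i) ^ m i) →
      ∑ b ∈ T.seven a, S.α a b * p (T.point P b)
        = ∑ b ∈ T.seven a, S.β a b * (P.κ (P.phase (T.point P a)) * (Δ p) (T.point P b))

open Classical in
/-- The boundary data that may enter the equation at a boundary point `a`: pairs `(s, b)` of a side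
through `a` and a stencil point on that side at which no Dirichlet condition is given. -/
def dataPoints (a : Node) : Finset (Side × Node) :=
  (Finset.univ ×ˢ T.boundaryStencil a).filter fun x =>
    T.point P a ∈ P.side x.1 ∧ T.point P x.2 ∈ P.side x.1 ∧ T.point P x.2 ∉ P.D

/-- Difference equation at a Neumann or Robin boundary point,
`∑ α U = ∑ β f + ∑ γ g` with weights `γ` of size at most `K / h` for the boundary data: the `β`'s add
up to one and the equation is exact for all polynomials of degree at most three. -/
def BoundaryRow (K : ℝ) (a : Node) : Prop :=
  ∑ b ∈ T.boundaryStencil a, S.β a b = 1 ∧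
  ∃ γ : Side × Node → ℝ, (∀ x, |γ x| ≤ K / T.h) ∧
    S.corr a = ∑ x ∈ dataPoints P T a, γ x * P.g x.1 (T.point P x.2) ∧
    ∀ p : MvPolynomial (Fin 2) ℝ, p.totalDegree ≤ 3 →
      ∑ b ∈ T.boundaryStencil a, S.α a b * polyFun p (T.point P b)
        = ∑ b ∈ T.boundaryStencil a, S.β a b *
            (P.κ (P.phase (T.point P a)) * (Δ (polyFun p)) (T.point P b))
          + ∑ x ∈ dataPoints P T a, γ x *
            (fderiv ℝ (polyFun p) (T.point P x.2) x.1.normal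
              + P.σ x.1 (T.point P x.2) * polyFun p (T.point P x.2))

/-- Grid points that carry a difference equation: all interior grid points, and the coarse boundary
points without a Dirichlet condition.  (For small `h` the refined cells do not meet the boundary, so
that all boundary grid points are coarse.) -/
def HasRow (a : Node) : Prop :=
  T.IsNode P a ∧ T.point P a ∉ P.D ∧ (T.Interior a ∨ T.IsVertex a)

/-- The two-grid method. -/
structure IsTwoGrid (K : ℝ) : Prop where
  coarse : ∀ a, T.IsNode P a → T.Interior a → ¬ T.FineInterior P a → T.IsVertex a →
    S.CoarseRow P T a
  fine : ∀ a, T.FineInterior P a → T.Regular P a → S.FineRow P T a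
  immersed : ∀ a, T.FineInterior P a → ¬ T.Regular P a → S.ImmersedRow P T a
  hanging : ∀ a, T.Hanging P a → S.HangingRow P T a
  boundary : ∀ a, HasRow P T a → ¬ T.Interior a → S.BoundaryRow P T K a

/-- Sign property: negative diagonal, nonnegative off-diagonal coefficients. -/
def SignProperty : Prop :=
  ∀ a, HasRow P T a → S.α a a < 0 ∧ ∀ b ∈ T.stencil P a, b ≠ a → 0 ≤ S.α a b

open Classical in
/-- `‖α‖∞ ≤ K / (step size)²` and `‖β‖∞ ≤ K`. -/
def CoeffBound (K : ℝ) : Prop :=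
  ∀ a, HasRow P T a → ∀ b ∈ T.stencil P a,
    |S.α a b| ≤ K / (T.localStep P a) ^ 2 ∧ |S.β a b| ≤ K

/-- `U` is a finite difference solution. -/
structure Solves (U : Node → ℝ) : Prop where
  dirichlet : ∀ a, T.IsNode P a → T.point P a ∈ P.D → U a = P.gD (T.point P a)
  equation : ∀ a, HasRow P T a →
    ∑ b ∈ T.stencil P a, S.α a b * U b
      = ∑ b ∈ T.stencil P a, S.β a b * P.f (P.phase (T.point P b)) (T.point P b) + S.corr a

end Scheme

end TwoGrid

end

/-!
The error estimate is consistency plus stability, with the truncation error measured against a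
weight. With `k = h / r`, put `weight = 1` at regular fine points and at coarse points, `1 / k` at
irregular points, and `1 / h` at hanging nodes and at boundary points.

*Consistency* (`exists_residual_le`). Every row is exact on polynomials up to some degree: five for
the compact scheme, three for the five-point, the hanging-node and the boundary scheme, two for the
immersed interface scheme. Taylor's theorem then bounds the truncation error by
`C * (h ^ 3 + k ^ 2) * weight`. At an irregular point the second-order Taylor polynomials of the two
branches at `X t` are a pair of quadratics to which the exactness condition applies
(`jumpCompatible_taylor`).

*Stability* (`exists_stability`). It is to be shown that a grid function that vanishes at the
Dirichlet points is bounded by a constant times its weighted residual. This rests on a quantitative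
strong maximum principle for *subsolutions* (`IsSubsolution`): grid functions `e ≤ 1` with `e ≤ 0`
at the Dirichlet points and `∑ α e ≥ -δ * weight` in each row. A point `x` is *good* (`Good`) if for
small `δ` all subsolutions stay below `1 - δ` near `x`. The set of good points is open, and if all
points of the closed rectangle are good, compactness yields a uniform `δ` (`exists_uniform_good`). A
grid function with a residual much smaller than its maximum contradicts that, after normalization.

That all points are good is the discrete version of the strong maximum principle and of the Hopf
lemma, with the good set in place of the set where a solution is less than its maximum. All the
local arguments are instances of one principle, `good_of_test`: `x` is good if there is a test
function `Λ` that vanishes at `x`, has `∑ α Λ` bounded below by a multiple of the weight in the rows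
near `x`, and is negative, away from known good points, on a ring around `x`. The test functions
are:

* off the interface and on the boundary, `F + N F²` with a paraboloid
  `F z = ⟪w, z - x⟫ - ‖z - x‖²` (`good_of_quadratic`). Rows near such points are compact or boundary
  rows. That a boundary row acts on `F` like a negative multiple, of order `1 / h`, of the outward
  derivative is a consequence of its exactness on quadratics and of the sign property, because the
  stencil lies on one side of the boundary line (`exists_boundaryEstimate`);
* on the interface, `interfaceTest`, built from the height `ζ` over the interface as
  `(B ζ + …) / κ + N ζ² - ξ²`. Division by `κ` makes the linear term compatible with the flux
  condition, so that the immersed rows, which are exact for the corrected linear pair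
  (`homogeneousJump_lin`), see a bounded quantity only, while the terms `…`, convex functions of `ζ`
  with second derivative `2 / k` and `2 / h` near `0`, give the contributions of order `1 / k` at
  irregular points and `1 / h` at hanging nodes that the weight requires (`good_of_side`).

Consequently a bad point in the open rectangle has only bad points in a neighbourhood, also across
the interface; as the open rectangle is connected, one good point suffices
(`good_of_mem_openRect`). The Dirichlet or Robin segment supplies it (`exists_good`), and the Hopf
argument carries goodness to the sides and the corners (`good_of_mem_rect`).
-/

noncomputable section

namespace TwoGrid

/-! ### Partial derivatives and Taylor polynomials in the plane -/

/-- The `i`-th partial derivative. -/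
def pd (i : Fin 2) (f : Plane → ℝ) : Plane → ℝ :=
  fun x => fderiv ℝ f x (EuclideanSpace.single i (1 : ℝ))

theorem contDiff_pd {n : ℕ} {f : Plane → ℝ} (i : Fin 2) (hf : ContDiff ℝ (n + 1) f) :
    ContDiff ℝ n (pd i f) :=
  (hf.fderiv_right (m := n) le_rfl).clm_apply contDiff_const

theorem plane_eq_sum (v : Plane) : v = ∑ i, v i • EuclideanSpace.single i (1 : ℝ) := by
  ext j
  fin_cases j <;> simp

theorem fderiv_apply_eq_sum_pd (f : Plane → ℝ) (x v : Plane) :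
    fderiv ℝ f x v = ∑ i, v i * pd i f x := by
  conv_lhs => rw [plane_eq_sum v]
  simp [pd]

theorem abs_coord_le (v : Plane) (i : Fin 2) : |v i| ≤ ‖v‖ := by
  simpa using EuclideanSpace.norm_eq v ▸ PiLp.norm_apply_le v i

theorem norm_le_abs_add_abs (v : Plane) : ‖v‖ ≤ |v 0| + |v 1| := by
  rw [EuclideanSpace.norm_eq, Fin.sum_univ_two]
  apply Real.sqrt_le_iff.mpr
  constructor
  · positivity
  · simp only [Real.norm_eq_abs, sq_abs]
    nlinarith [abs_nonneg (v 0), abs_nonneg (v 1), sq_abs (v 0), sq_abs (v 1)]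

theorem norm_sq_eq (v : Plane) : ‖v‖ ^ 2 = v 0 ^ 2 + v 1 ^ 2 := by
  rw [EuclideanSpace.norm_sq_eq, Fin.sum_univ_two]; simp

theorem norm_fderiv_le (f : Plane → ℝ) (x : Plane) :
    ‖fderiv ℝ f x‖ ≤ |pd 0 f x| + |pd 1 f x| := by
  refine ContinuousLinearMap.opNorm_le_bound _ (by positivity) fun v => ?_
  rw [fderiv_apply_eq_sum_pd, Fin.sum_univ_two, Real.norm_eq_abs]
  calc |v 0 * pd 0 f x + v 1 * pd 1 f x| ≤ |v 0| * |pd 0 f x| + |v 1| * |pd 1 f x| := by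
        rw [← abs_mul, ← abs_mul]; exact abs_add_le _ _
    _ ≤ ‖v‖ * |pd 0 f x| + ‖v‖ * |pd 1 f x| := by
        gcongr <;> exact abs_coord_le _ _
    _ = _ := by ring

theorem laplacian_eq_pd {f : Plane → ℝ} (hf : ContDiff ℝ 2 f) (x : Plane) :
    (Δ f) x = ∑ i, pd i (pd i f) x := by
  rw [InnerProductSpace.laplacian_eq_iteratedFDeriv_orthonormalBasis f
    (EuclideanSpace.basisFun (Fin 2) ℝ)]
  refine Finset.sum_congr rfl fun i _ => ?_
  rw [iteratedFDeriv_two_apply]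
  simp only [EuclideanSpace.basisFun_apply, Matrix.cons_val_zero, Matrix.cons_val_one]
  have hd : DifferentiableAt ℝ (fderiv ℝ f) x :=
    (hf.fderiv_right (m := 1) (by norm_num)).differentiable (by norm_num) x
  have : HasFDerivAt (pd i f) ((ContinuousLinearMap.apply ℝ ℝ
      (EuclideanSpace.single i (1 : ℝ))).comp (fderiv ℝ (fderiv ℝ f) x)) x :=
    (ContinuousLinearMap.apply ℝ ℝ (EuclideanSpace.single i (1 : ℝ))).hasFDerivAt.comp x
      hd.hasFDerivAt
  conv_rhs => rw [pd, this.fderiv]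
  simp

theorem pd_comm {f : Plane → ℝ} (hf : ContDiff ℝ 2 f) (i j : Fin 2) :
    pd i (pd j f) = pd j (pd i f) := by
  ext x
  have hd : DifferentiableAt ℝ (fderiv ℝ f) x :=
    (hf.fderiv_right (m := 1) (by norm_num)).differentiable (by norm_num) x
  have key : ∀ i j : Fin 2, pd i (pd j f) x
      = fderiv ℝ (fderiv ℝ f) x (EuclideanSpace.single i (1 : ℝ))
        (EuclideanSpace.single j (1 : ℝ)) := by
    intro i j
    have : HasFDerivAt (pd j f) ((ContinuousLinearMap.apply ℝ ℝ
        (EuclideanSpace.single j (1 : ℝ))).comp (fderiv ℝ (fderiv ℝ f) x)) x :=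
      (ContinuousLinearMap.apply ℝ ℝ (EuclideanSpace.single j (1 : ℝ))).hasFDerivAt.comp x
        hd.hasFDerivAt
    conv_lhs => rw [pd, this.fderiv]
    simp
  rw [key, key]
  exact (hf.contDiffAt.isSymmSndFDerivAt (by simp)) _ _

theorem iterate_pd_comm (l : ℕ) {f : Plane → ℝ} (hf : ContDiff ℝ (l + 1 : ℕ) f) (i j : Fin 2) :
    (pd i)^[l] (pd j f) = pd j ((pd i)^[l] f) := by
  induction l generalizing f with
  | zero => rfl
  | succ l ih =>
    rw [Function.iterate_succ_apply, Function.iterate_succ_apply,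
      pd_comm (hf.of_le (by exact_mod_cast (by omega : 2 ≤ l + 1 + 1)))]
    exact ih (contDiff_pd i (by exact_mod_cast hf))

/-! ### Polynomial functions -/

theorem polyFun_add (p q : MvPolynomial (Fin 2) ℝ) (x : Plane) :
    polyFun (p + q) x = polyFun p x + polyFun q x := by simp [polyFun]

theorem polyFun_mul (p q : MvPolynomial (Fin 2) ℝ) (x : Plane) :
    polyFun (p * q) x = polyFun p x * polyFun q x := by simp [polyFun]

theorem polyFun_C (c : ℝ) (x : Plane) : polyFun (MvPolynomial.C c) x = c := by simp [polyFun]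

theorem polyFun_pow (p : MvPolynomial (Fin 2) ℝ) (n : ℕ) (x : Plane) :
    polyFun (p ^ n) x = polyFun p x ^ n := by simp [polyFun]

theorem polyFun_sum {ι : Type*} (s : Finset ι) (p : ι → MvPolynomial (Fin 2) ℝ) (x : Plane) :
    polyFun (∑ i ∈ s, p i) x = ∑ i ∈ s, polyFun (p i) x := by simp [polyFun, map_sum]

theorem hasFDerivAt_polyFun (p : MvPolynomial (Fin 2) ℝ) (x : Plane) :
    HasFDerivAt (polyFun p) (∑ i, polyFun (MvPolynomial.pderiv i p) x •
      (EuclideanSpace.proj i : Plane →L[ℝ] ℝ)) x := by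
  induction p using MvPolynomial.induction_on with
  | C c =>
    have : polyFun (MvPolynomial.C c) = fun _ => c := by ext; simp [polyFun]
    rw [this]
    simpa [polyFun] using hasFDerivAt_const c x
  | add p q hp hq =>
    have : polyFun (p + q) = fun y => polyFun p y + polyFun q y := by ext; simp [polyFun]
    rw [this]
    refine (hp.add hq).congr_fderiv ?_
    simp only [map_add, polyFun_add, add_smul, Finset.sum_add_distrib]
  | mul_X p j hp =>
    have : polyFun (p * MvPolynomial.X j) = fun y => polyFun p y * y j := by ext; simp [polyFun]
    rw [this]
    refine (hp.mul (EuclideanSpace.proj j : Plane →L[ℝ] ℝ).hasFDerivAt).congr_fderiv ?_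
    ext v
    fin_cases j <;>
      simp [polyFun, MvPolynomial.pderiv_X] <;> ring

theorem pd_polyFun (i : Fin 2) (p : MvPolynomial (Fin 2) ℝ) :
    pd i (polyFun p) = polyFun (MvPolynomial.pderiv i p) := by
  ext x
  rw [pd, (hasFDerivAt_polyFun p x).fderiv]
  fin_cases i <;> simp

theorem contDiff_polyFun {n : WithTop ℕ∞} (p : MvPolynomial (Fin 2) ℝ) :
    ContDiff ℝ n (polyFun p) := by
  induction p using MvPolynomial.induction_on with
  | C c =>
    have : polyFun (MvPolynomial.C c) = fun _ => c := by ext; simp [polyFun]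
    exact this ▸ contDiff_const
  | add p q hp hq =>
    have : polyFun (p + q) = fun y => polyFun p y + polyFun q y := by ext; simp [polyFun]
    exact this ▸ hp.add hq
  | mul_X p j hp =>
    have : polyFun (p * MvPolynomial.X j) = fun y => polyFun p y * y j := by ext; simp [polyFun]
    exact this ▸ hp.mul (EuclideanSpace.proj j : Plane →L[ℝ] ℝ).contDiff

/-- The Laplacian of a polynomial. -/
def polyLap (p : MvPolynomial (Fin 2) ℝ) : MvPolynomial (Fin 2) ℝ :=
  ∑ i, MvPolynomial.pderiv i (MvPolynomial.pderiv i p)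

theorem laplacian_polyFun (p : MvPolynomial (Fin 2) ℝ) (x : Plane) :
    (Δ (polyFun p)) x = polyFun (polyLap p) x := by
  rw [laplacian_eq_pd (contDiff_polyFun p)]
  simp only [pd_polyFun, polyLap, polyFun_sum]

/-! ### Taylor polynomials -/

/-- The monomial `(x₀ - a₀) ^ k * (x₁ - a₁) ^ l`. -/
def shiftMonomial (a : Plane) (k l : ℕ) : MvPolynomial (Fin 2) ℝ :=
  (MvPolynomial.X 0 - MvPolynomial.C (a 0)) ^ k * (MvPolynomial.X 1 - MvPolynomial.C (a 1)) ^ l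

theorem polyFun_shiftMonomial (a : Plane) (k l : ℕ) (x : Plane) :
    polyFun (shiftMonomial a k l) x = (x 0 - a 0) ^ k * (x 1 - a 1) ^ l := by
  simp [shiftMonomial, polyFun]

theorem totalDegree_shiftMonomial_le (a : Plane) (k l : ℕ) :
    (shiftMonomial a k l).totalDegree ≤ k + l := by
  have h : ∀ i : Fin 2, (MvPolynomial.X i - MvPolynomial.C (a i) :
      MvPolynomial (Fin 2) ℝ).totalDegree ≤ 1 := fun i =>
    (MvPolynomial.totalDegree_sub _ _).trans (by simp)
  refine (MvPolynomial.totalDegree_mul _ _).trans (add_le_add ?_ ?_) <;>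
  · refine (MvPolynomial.totalDegree_pow _ _).trans ?_
    calc _ ≤ _ * 1 := Nat.mul_le_mul_left _ (h _)
      _ = _ := mul_one _

theorem pderiv_zero_shiftMonomial (a : Plane) (k l : ℕ) :
    MvPolynomial.pderiv 0 (shiftMonomial a k l) = (k : ℝ) • shiftMonomial a (k - 1) l := by
  simp [shiftMonomial, Derivation.leibniz_pow, MvPolynomial.pderiv_X,
    MvPolynomial.smul_eq_C_mul]
  ring

theorem pderiv_one_shiftMonomial (a : Plane) (k l : ℕ) :
    MvPolynomial.pderiv 1 (shiftMonomial a k l) = (l : ℝ) • shiftMonomial a k (l - 1) := by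
  simp [shiftMonomial, Derivation.leibniz_pow, MvPolynomial.pderiv_X,
    MvPolynomial.smul_eq_C_mul]
  ring

/-- Taylor coefficient of `f` at `a`. -/
def taylorCoeff (f : Plane → ℝ) (a : Plane) (k l : ℕ) : ℝ :=
  (pd 0)^[k] ((pd 1)^[l] f) a / (k.factorial * l.factorial)

/-- The part of degree less than `n` of the Taylor expansion of `f` at `a`. -/
def taylorPoly (n : ℕ) (f : Plane → ℝ) (a : Plane) : MvPolynomial (Fin 2) ℝ :=
  ∑ m ∈ Finset.range n, ∑ j ∈ Finset.HasAntidiagonal.antidiagonal m,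
    taylorCoeff f a j.1 j.2 • shiftMonomial a j.1 j.2

theorem totalDegree_taylorPoly_le (n : ℕ) (f : Plane → ℝ) (a : Plane) :
    (taylorPoly n f a).totalDegree ≤ n - 1 := by
  refine MvPolynomial.totalDegree_finsetSum_le fun m hm => ?_
  refine MvPolynomial.totalDegree_finsetSum_le fun j hj => ?_
  refine (MvPolynomial.totalDegree_smul_le _ _).trans
    ((totalDegree_shiftMonomial_le _ _ _).trans ?_)
  rw [Finset.HasAntidiagonal.mem_antidiagonal] at hj
  rw [Finset.mem_range] at hm
  omega

theorem taylorCoeff_succ_left (f : Plane → ℝ) (a : Plane) (k l : ℕ)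
    (hf : ContDiff ℝ (l + 1 : ℕ) f) :
    ((k : ℝ) + 1) * taylorCoeff f a (k + 1) l = taylorCoeff (pd 0 f) a k l := by
  simp only [taylorCoeff, Function.iterate_succ_apply, Nat.factorial_succ,
    iterate_pd_comm l hf 1 0]
  push_cast
  have : (k.factorial : ℝ) ≠ 0 := by positivity
  have : (l.factorial : ℝ) ≠ 0 := by positivity
  field_simp

theorem taylorCoeff_succ_right (f : Plane → ℝ) (a : Plane) (k l : ℕ) :
    ((l : ℝ) + 1) * taylorCoeff f a k (l + 1) = taylorCoeff (pd 1 f) a k l := by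
  simp only [taylorCoeff, Function.iterate_succ_apply, Nat.factorial_succ]
  push_cast
  have : (k.factorial : ℝ) ≠ 0 := by positivity
  have : (l.factorial : ℝ) ≠ 0 := by positivity
  field_simp

theorem pderiv_taylorPoly (n : ℕ) (f : Plane → ℝ) (a : Plane) (hf : ContDiff ℝ (n + 1 : ℕ) f)
    (i : Fin 2) :
    MvPolynomial.pderiv i (taylorPoly (n + 1) f a) = taylorPoly n (pd i f) a := by
  simp only [taylorPoly, map_sum, Derivation.map_smul]
  rw [Finset.sum_range_succ']
  have h0 : ∑ j ∈ Finset.HasAntidiagonal.antidiagonal 0, taylorCoeff f a j.1 j.2 •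
      MvPolynomial.pderiv i (shiftMonomial a j.1 j.2) = 0 := by
    simp [shiftMonomial]
  rw [h0, add_zero]
  refine Finset.sum_congr rfl fun m hm => ?_
  rw [Finset.mem_range] at hm
  fin_cases i
  · simp only [Fin.zero_eta, pderiv_zero_shiftMonomial]
    rw [Finset.Nat.sum_antidiagonal_succ]
    simp only [Nat.cast_zero, zero_smul, smul_zero, zero_add]
    refine Finset.sum_congr rfl fun j hj => ?_
    rw [Finset.HasAntidiagonal.mem_antidiagonal] at hj
    rw [← taylorCoeff_succ_left f a j.1 j.2 (hf.of_le (by exact_mod_cast (by omega))), smul_smul,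
      mul_comm]
    simp
  · simp only [Fin.mk_one, pderiv_one_shiftMonomial]
    rw [Finset.Nat.sum_antidiagonal_succ']
    simp only [Nat.cast_zero, zero_smul, smul_zero, zero_add]
    refine Finset.sum_congr rfl fun j hj => ?_
    rw [← taylorCoeff_succ_right f a j.1 j.2, smul_smul, mul_comm]
    simp

theorem polyFun_taylorPoly_self (n : ℕ) (f : Plane → ℝ) (a : Plane) :
    polyFun (taylorPoly (n + 1) f a) a = f a := by
  rw [taylorPoly, Finset.sum_range_succ', polyFun_add, polyFun_sum]
  have : ∑ m ∈ Finset.range n, polyFun (∑ j ∈ Finset.HasAntidiagonal.antidiagonal (m + 1),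
      taylorCoeff f a j.1 j.2 • shiftMonomial a j.1 j.2) a = 0 := by
    refine Finset.sum_eq_zero fun m _ => ?_
    rw [polyFun_sum]
    refine Finset.sum_eq_zero fun j hj => ?_
    rw [Finset.HasAntidiagonal.mem_antidiagonal] at hj
    rw [MvPolynomial.smul_eq_C_mul, polyFun_mul, polyFun_shiftMonomial]
    rcases Nat.eq_zero_or_pos j.1 with h | h
    · have : j.2 ≠ 0 := by omega
      simp [this]
    · have : j.1 ≠ 0 := by omega
      simp [this]
  rw [this]
  simp [polyFun, taylorCoeff, shiftMonomial]

/-- Taylor's theorem, uniform on a compact convex set. -/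
theorem exists_taylor_bound {s : Set Plane} (hs : IsCompact s) (hc : Convex ℝ s) (n : ℕ)
    (f : Plane → ℝ) (hf : ContDiff ℝ n f) :
    ∃ C, 0 ≤ C ∧ ∀ a ∈ s, ∀ x ∈ s, |f x - polyFun (taylorPoly n f a) x| ≤ C * ‖x - a‖ ^ n := by
  induction n generalizing f with
  | zero =>
    obtain ⟨C, hC⟩ := hs.exists_bound_of_continuousOn hf.continuous.continuousOn
    refine ⟨max C 0, le_max_right _ _, fun a _ x hx => ?_⟩
    simpa [taylorPoly, polyFun] using Or.inl (hC x hx)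
  | succ n ih =>
    obtain ⟨C₀, h0, hC₀⟩ := ih (pd 0 f) (contDiff_pd 0 (by exact_mod_cast hf))
    obtain ⟨C₁, h1, hC₁⟩ := ih (pd 1 f) (contDiff_pd 1 (by exact_mod_cast hf))
    refine ⟨C₀ + C₁, by positivity, fun a ha x hx => ?_⟩
    set p := taylorPoly (n + 1) f a with hp
    let R : Plane → ℝ := fun y => f y - polyFun p y
    have hfd : Differentiable ℝ f := hf.differentiable (by norm_cast)
    have hpd : Differentiable ℝ (polyFun p) :=
      (contDiff_polyFun (n := 1) p).differentiable (by norm_num)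
    have hR : Differentiable ℝ R := hfd.sub hpd
    have hRpd : ∀ i y, pd i R y = pd i f y - polyFun (taylorPoly n (pd i f) a) y := by
      intro i y
      rw [← pderiv_taylorPoly n f a hf, ← pd_polyFun]
      have : fderiv ℝ R y = fderiv ℝ f y - fderiv ℝ (polyFun p) y := fderiv_sub (hfd y) (hpd y)
      simp [pd, this, hp]
    have hbound : ∀ y ∈ s ∩ Metric.closedBall a ‖x - a‖,
        ‖fderiv ℝ R y‖ ≤ (C₀ + C₁) * ‖x - a‖ ^ n := by
      rintro y ⟨hy, hya⟩
      rw [mem_closedBall_iff_norm] at hya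
      refine (norm_fderiv_le R y).trans ?_
      rw [hRpd, hRpd, add_mul]
      refine add_le_add ((hC₀ a ha y hy).trans ?_) ((hC₁ a ha y hy).trans ?_) <;> gcongr
    have := (hc.inter (convex_closedBall a ‖x - a‖)).norm_image_sub_le_of_norm_fderiv_le
      (fun y _ => hR y) hbound (x := a) (y := x) ⟨ha, by simp⟩ ⟨hx, by simp [dist_eq_norm]⟩
    have hRa : R a = 0 := by simp [R, hp, polyFun_taylorPoly_self]
    rw [hRa, sub_zero] at this
    calc |f x - polyFun p x| = ‖R x‖ := rfl
      _ ≤ _ := this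
      _ = _ := by ring

/-- Taylor remainders of a function, of its first derivatives and of its Laplacian. -/
theorem exists_taylor_bounds {s : Set Plane} (hs : IsCompact s) (hc : Convex ℝ s) (n : ℕ)
    (f : Plane → ℝ) (hf : ContDiff ℝ (n + 2 : ℕ) f) :
    ∃ C, 0 ≤ C ∧ ∀ a ∈ s, ∀ x ∈ s,
      |f x - polyFun (taylorPoly (n + 2) f a) x| ≤ C * ‖x - a‖ ^ (n + 2) ∧
      (∀ i, |pd i f x - pd i (polyFun (taylorPoly (n + 2) f a)) x| ≤ C * ‖x - a‖ ^ (n + 1)) ∧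
      |(Δ f) x - (Δ (polyFun (taylorPoly (n + 2) f a))) x| ≤ C * ‖x - a‖ ^ n := by
  have h1 : ∀ i, ContDiff ℝ (n + 1 : ℕ) (pd i f) := fun i =>
    contDiff_pd i (by exact_mod_cast hf)
  have h2 : ∀ i, ContDiff ℝ n (pd i (pd i f)) := fun i =>
    contDiff_pd i (by exact_mod_cast h1 i)
  obtain ⟨C, hC0, hC⟩ := exists_taylor_bound hs hc (n + 2) f hf
  choose A hA0 hA using fun i => exists_taylor_bound hs hc (n + 1) (pd i f) (h1 i)
  choose B hB0 hB using fun i => exists_taylor_bound hs hc n (pd i (pd i f)) (h2 i)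
  have hsum : 0 ≤ C + (A 0 + A 1) + (B 0 + B 1) := by
    have := hA0 0; have := hA0 1; have := hB0 0; have := hB0 1; positivity
  refine ⟨C + (A 0 + A 1) + (B 0 + B 1), hsum, fun a ha x hx => ⟨?_, ?_, ?_⟩⟩
  · refine (hC a ha x hx).trans ?_
    gcongr
    linarith [hA0 0, hA0 1, hB0 0, hB0 1]
  · intro i
    rw [pd_polyFun, pderiv_taylorPoly (n + 1) f a hf]
    refine (hA i a ha x hx).trans ?_
    gcongr
    fin_cases i <;> simp <;> linarith [hA0 0, hA0 1, hB0 0, hB0 1]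
  · rw [laplacian_polyFun, laplacian_eq_pd (hf.of_le (by exact_mod_cast (by omega))), polyLap]
    simp only [pderiv_taylorPoly (n + 1) f a hf, pderiv_taylorPoly n _ a (h1 _)]
    rw [polyFun_sum, ← Finset.sum_sub_distrib, Fin.sum_univ_two]
    refine (abs_add_le _ _).trans ((add_le_add (hB 0 a ha x hx) (hB 1 a ha x hx)).trans ?_)
    rw [← add_mul]
    refine mul_le_mul_of_nonneg_right ?_ (by positivity)
    linarith [hA0 0, hA0 1, hB0 0, hB0 1]

end TwoGrid

end

noncomputable section

namespace TwoGrid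

/-! ### The rectangle and the interface -/

namespace InterfaceProblem

variable (P : InterfaceProblem)

/-- The open rectangle. -/
def openRect : Set Plane := {x | ∀ i, P.lo i < x i ∧ x i < P.hi i}

/-- The interface. -/
def interface : Set Plane := Set.range P.X

theorem isOpen_openRect : IsOpen P.openRect := by
  have : P.openRect = ⋂ i, {x : Plane | P.lo i < x i} ∩ {x : Plane | x i < P.hi i} := by
    ext x; simp [openRect]
  rw [this]
  refine isOpen_iInter_of_finite fun i => ?_
  have hc : Continuous fun x : Plane => x i := (EuclideanSpace.proj i : Plane →L[ℝ] ℝ).continuous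
  exact (isOpen_lt continuous_const hc).inter (isOpen_lt hc continuous_const)

theorem isClosed_rect : IsClosed P.rect := by
  have : P.rect = ⋂ i, {x : Plane | P.lo i ≤ x i} ∩ {x : Plane | x i ≤ P.hi i} := by
    ext x; simp [rect]
  rw [this]
  refine isClosed_iInter fun i => ?_
  have hc : Continuous fun x : Plane => x i := (EuclideanSpace.proj i : Plane →L[ℝ] ℝ).continuous
  exact (isClosed_le continuous_const hc).inter (isClosed_le hc continuous_const)

theorem isCompact_rect : IsCompact P.rect := by
  refine Metric.isCompact_of_isClosed_isBounded P.isClosed_rect ?_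
  refine (Metric.isBounded_closedBall (x := (0 : Plane))
    (r := ∑ i, (|P.lo i| + |P.hi i|))).subset fun x hx => ?_
  rw [mem_closedBall_zero_iff]
  refine (norm_le_abs_add_abs x).trans ?_
  rw [Fin.sum_univ_two]
  have h : ∀ i, |x i| ≤ |P.lo i| + |P.hi i| := fun i => by
    have := hx i
    rw [abs_le]
    constructor
    · linarith [neg_abs_le (P.lo i), abs_nonneg (P.hi i)]
    · linarith [le_abs_self (P.hi i), abs_nonneg (P.lo i)]
  exact add_le_add (h 0) (h 1)

theorem convex_rect : Convex ℝ P.rect := by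
  intro x hx y hy a b ha hb hab i
  have h1 := hx i
  have h2 := hy i
  simp only [PiLp.add_apply, PiLp.smul_apply, smul_eq_mul]
  obtain rfl : b = 1 - a := by linarith
  constructor <;> nlinarith

theorem convex_openRect : Convex ℝ P.openRect := by
  intro x hx y hy a b ha hb hab i
  have h1 := hx i
  have h2 := hy i
  simp only [PiLp.add_apply, PiLp.smul_apply, smul_eq_mul]
  obtain rfl : b = 1 - a := by linarith
  rcases ha.eq_or_lt with rfl | ha
  · constructor <;> linarith
  · constructor <;> nlinarith

theorem openRect_subset_rect : P.openRect ⊆ P.rect := fun _ hx i =>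
  ⟨(hx i).1.le, (hx i).2.le⟩

theorem exists_mem_side {x : Plane} (hx : x ∈ P.rect) (hx' : x ∉ P.openRect) :
    ∃ s, x ∈ P.side s := by
  simp only [openRect, Set.mem_ofPred_eq, not_forall] at hx'
  obtain ⟨i, hi⟩ := hx'
  have h := hx i
  rcases h.1.eq_or_lt with h1 | h1
  · exact ⟨(i, false), hx, by simpa using h1.symm⟩
  · rcases h.2.eq_or_lt with h2 | h2
    · exact ⟨(i, true), hx, by simpa using h2⟩
    · exact absurd ⟨h1, h2⟩ hi

theorem notMem_side {x : Plane} (hx : x ∈ P.openRect) (s : Side) : x ∉ P.side s := by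
  rintro ⟨-, h⟩
  have := hx s.1
  split_ifs at h <;> linarith

theorem isClosed_side (s : Side) : IsClosed (P.side s) := by
  have hc : Continuous fun x : Plane => x s.1 :=
    (EuclideanSpace.proj s.1 : Plane →L[ℝ] ℝ).continuous
  exact P.isClosed_rect.inter (isClosed_eq hc continuous_const)

theorem isCompact_side (s : Side) : IsCompact (P.side s) :=
  P.isCompact_rect.of_isClosed_subset (P.isClosed_side s) fun _ h => h.1

theorem interface_nonempty : P.interface.Nonempty := Set.range_nonempty _

variable {P}

namespace Admissible

variable (hP : P.Admissible)
include hP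

theorem isCompact_interface : IsCompact P.interface := by
  have : P.interface = P.X '' Set.Icc 0 (0 + P.period) :=
    (hP.X_periodic.image_Icc hP.period_pos 0).symm
  rw [this]
  exact isCompact_Icc.image hP.X_smooth.continuous

theorem interface_subset : P.interface ⊆ P.openRect := by
  rintro _ ⟨t, rfl⟩ i
  exact hP.X_interior t i

theorem φ_eq_zero_iff {x : Plane} (hx : x ∈ P.rect) : P.φ x = 0 ↔ x ∈ P.interface := by
  constructor
  · intro h
    obtain ⟨c, hc, hd⟩ := hP.φ_dist
    have h1 := hd x hx
    rw [h, abs_zero] at h1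
    have h2 : Metric.infDist x P.interface = 0 :=
      le_antisymm (nonpos_of_mul_nonpos_right h1 hc) Metric.infDist_nonneg
    exact (hP.isCompact_interface.isClosed.mem_iff_infDist_zero P.interface_nonempty).mpr h2
  · rintro ⟨t, rfl⟩
    exact hP.φ_zero t

theorem continuousOn_φ : ContinuousOn P.φ P.rect := by
  obtain ⟨l, hl⟩ := hP.φ_lipschitz
  exact hl.continuousOn

/-- On a preconnected set that misses the interface, `φ` has a constant sign. -/
theorem φ_sign_of_isPreconnected {s : Set Plane} (hs : IsPreconnected s) (hsR : s ⊆ P.rect)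
    (hsΓ : ∀ x ∈ s, x ∉ P.interface) {x y : Plane} (hx : x ∈ s) (hy : y ∈ s)
    (h : 0 < P.φ x) : 0 < P.φ y := by
  by_contra hn
  have hi := hs.image P.φ (hP.continuousOn_φ.mono hsR)
  have : (0 : ℝ) ∈ P.φ '' s :=
    hi.ordConnected.out ⟨y, hy, rfl⟩ ⟨x, hx, rfl⟩ ⟨not_lt.mp hn, h.le⟩
  obtain ⟨z, hz, hz0⟩ := this
  exact hsΓ z hz ((hP.φ_eq_zero_iff (hsR hz)).mp hz0)

/-- Two points of the rectangle that are closer to each other than to the interface lie on the same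
side of it. -/
theorem phase_eq_of_dist_lt {x y : Plane} (hx : x ∈ P.rect) (hy : y ∈ P.rect)
    (h : dist x y < Metric.infDist x P.interface) : P.phase x = P.phase y := by
  have hs : IsPreconnected (segment ℝ x y) := (convex_segment x y).isPreconnected
  have hsub : segment ℝ x y ⊆ P.rect := P.convex_rect.segment_subset hx hy
  have hΓ : ∀ z ∈ segment ℝ x y, z ∉ P.interface := by
    intro z hz hzΓ
    have h1 := Metric.infDist_le_dist_of_mem (x := x) hzΓ
    have h2 : dist x z ≤ dist x y := by
      have := dist_add_dist_of_mem_segment hz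
      linarith [dist_nonneg (x := z) (y := y)]
    linarith
  have hl := left_mem_segment ℝ x y
  have hr := right_mem_segment ℝ x y
  have h1 := hP.φ_sign_of_isPreconnected hs hsub hΓ hl hr
  have h2 := hP.φ_sign_of_isPreconnected hs hsub hΓ hr hl
  simp only [phase, ← not_lt]
  by_cases h0 : 0 < P.φ x
  · simp [h0, h1 h0]
  · have : ¬ 0 < P.φ y := fun h => h0 (h2 h)
    simp [h0, this]

theorem exists_margin : ∃ d, 0 < d ∧ ∀ x, Metric.infDist x P.interface < d → x ∈ P.openRect := by
  obtain ⟨d, hd, h⟩ := hP.isCompact_interface.exists_thickening_subset_open P.isOpen_openRect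
    hP.interface_subset
  refine ⟨d, hd, fun x hx => h ?_⟩
  rw [Metric.mem_thickening_iff_infDist_lt P.interface_nonempty]
  exact hx

theorem infDist_pos {x : Plane} (hx : x ∉ P.interface) : 0 < Metric.infDist x P.interface :=
  (hP.isCompact_interface.isClosed.notMem_iff_infDist_pos P.interface_nonempty).mp hx

end Admissible

theorem mem_region_phase {x : Plane} (hx : x ∈ P.rect) : x ∈ P.region (P.phase x) := by
  unfold phase
  split_ifs with h
  · exact ⟨hx, h⟩
  · exact ⟨hx, (not_le.mp h).le⟩

end InterfaceProblem

/-! ### Geometry of the two-grid -/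

namespace Grid

open InterfaceProblem

variable {P : InterfaceProblem} {T : Grid}

theorem point_apply (a : Node) (i : Fin 2) : T.point P a i = P.lo i + a i * T.fineStep := rfl

theorem point_sub_apply (a b : Node) (i : Fin 2) :
    (T.point P b - T.point P a) i = ((b i - a i : ℤ) : ℝ) * T.fineStep := by
  rw [PiLp.sub_apply, point_apply, point_apply]; push_cast; ring

namespace Fits

variable (hT : T.Fits P)
include hT

theorem r_pos' : (0 : ℝ) < T.r := by exact_mod_cast hT.r_pos

theorem r_posZ : (0 : ℤ) < T.r := by exact_mod_cast hT.r_pos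

theorem fineStep_pos : 0 < T.fineStep := div_pos hT.h_pos hT.r_pos'

theorem r_mul_fineStep : (T.r : ℝ) * T.fineStep = T.h := mul_div_cancel₀ _ hT.r_pos'.ne'

theorem fineStep_le : T.fineStep ≤ T.h :=
  div_le_self hT.h_pos.le (by exact_mod_cast hT.r_pos)

theorem hi_eq (i : Fin 2) : P.hi i = P.lo i + ((T.r * T.n i : ℤ) : ℝ) * T.fineStep := by
  have h1 := hT.cells i
  have h2 := hT.r_mul_fineStep
  push_cast
  rw [mul_right_comm, h2]
  linarith

theorem point_mem_rect_iff (a : Node) : T.point P a ∈ P.rect ↔ T.InRange a := by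
  refine forall_congr' fun i => and_congr ?_ ?_
  · rw [point_apply, le_add_iff_nonneg_right, mul_nonneg_iff_of_pos_right hT.fineStep_pos]
    exact_mod_cast Iff.rfl
  · rw [point_apply, hT.hi_eq i, add_le_add_iff_left, mul_le_mul_iff_left₀ hT.fineStep_pos]
    exact_mod_cast Iff.rfl

theorem point_mem_openRect_iff (a : Node) : T.point P a ∈ P.openRect ↔ T.Interior a := by
  refine forall_congr' fun i => and_congr ?_ ?_
  · rw [point_apply, lt_add_iff_pos_right, mul_pos_iff_of_pos_right hT.fineStep_pos]
    exact_mod_cast Iff.rfl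
  · rw [point_apply, hT.hi_eq i, add_lt_add_iff_left, mul_lt_mul_iff_left₀ hT.fineStep_pos]
    exact_mod_cast Iff.rfl

end Fits

theorem finite_inRange : {a : Node | T.InRange a}.Finite := by
  refine (Set.Finite.pi' fun i => Set.finite_Icc (0 : ℤ) ((T.r : ℤ) * (T.n i : ℤ))).subset ?_
  intro a ha i
  exact ha i

theorem norm_point_sub_le {a b : Node} {m : ℤ} (hf : 0 < T.fineStep) (h : ∀ i, |b i - a i| ≤ m) :
    ‖T.point P b - T.point P a‖ ≤ 2 * (m * T.fineStep) := by
  refine (norm_le_abs_add_abs _).trans ?_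
  have : ∀ i, |(T.point P b - T.point P a) i| ≤ m * T.fineStep := fun i => by
    rw [point_sub_apply, abs_mul, abs_of_pos hf]
    refine mul_le_mul_of_nonneg_right ?_ hf.le
    rw [← Int.cast_abs]
    exact Int.cast_le.mpr (h i)
  linarith [this 0, this 1]

theorem mem_nine {a b : Node} {k : ℤ} : b ∈ nine a k ↔ ∃ o ∈ offsets, a + k • o = b := by
  simp [nine]

theorem mem_offsets {o : Node} : o ∈ offsets ↔ ∀ i, o i = -1 ∨ o i = 0 ∨ o i = 1 := by
  simp [offsets]

theorem self_mem_nine (a : Node) (k : ℤ) : a ∈ nine a k :=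
  mem_nine.mpr ⟨0, mem_offsets.mpr fun i => by simp, by simp⟩

theorem abs_le_of_mem_nine {a b : Node} {k : ℤ} (hk : 0 ≤ k) (h : b ∈ nine a k) (i : Fin 2) :
    |b i - a i| ≤ k := by
  obtain ⟨o, ho, rfl⟩ := mem_nine.mp h
  rcases mem_offsets.mp ho i with h | h | h <;> simp [h, abs_of_nonneg hk, hk]

theorem abs_le_of_mem_seven {a b : Node} (hr : (0 : ℤ) < T.r) (h : b ∈ T.seven a) (i : Fin 2) :
    |b i - a i| ≤ T.r := by
  rw [seven, Finset.mem_insert, Fintype.mem_piFinset] at h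
  rcases h with rfl | h
  · simp
  · have h := h i
    rw [abs_le]
    split_ifs at h with hd
    · simp only [Finset.mem_insert, Finset.mem_singleton] at h
      omega
    · simp only [Finset.mem_insert, Finset.mem_singleton] at h
      have h1 := Int.mul_ediv_self_le (x := a i) hr.ne'
      have h2 := Int.lt_mul_ediv_self_add (x := a i) hr
      omega

theorem abs_le_of_mem_boundaryStencil {a b : Node} (h : b ∈ T.boundaryStencil a)
    (i : Fin 2) : |b i - a i| ≤ 2 * T.r := by
  classical
  rw [boundaryStencil, Finset.mem_filter, Fintype.mem_piFinset] at h
  have h := h.1 i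
  simp only [Finset.mem_insert, Finset.mem_singleton] at h
  rw [abs_le]
  omega

theorem self_mem_boundaryStencil {a : Node} (h : T.InRange a) : a ∈ T.boundaryStencil a := by
  classical
  rw [boundaryStencil, Finset.mem_filter, Fintype.mem_piFinset]
  exact ⟨fun i => by simp, h⟩

theorem stencil_of_fineInterior {a : Node} (h : T.FineInterior P a) :
    T.stencil P a = nine a 1 := by
  classical
  simp [stencil, h, h.1]

theorem stencil_of_vertex {a : Node} (h : T.Interior a) (h' : ¬ T.FineInterior P a)
    (hv : T.IsVertex a) : T.stencil P a = nine a T.r := by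
  classical
  simp [stencil, h, h', hv]

theorem stencil_of_not_vertex {a : Node} (h : T.Interior a) (h' : ¬ T.FineInterior P a)
    (hv : ¬ T.IsVertex a) : T.stencil P a = T.seven a := by
  classical
  simp [stencil, h, h', hv]

theorem stencil_of_not_interior {a : Node} (h : ¬ T.Interior a) :
    T.stencil P a = T.boundaryStencil a := by
  classical
  simp [stencil, h]

theorem self_mem_stencil {a : Node} (h : T.IsNode P a) : a ∈ T.stencil P a := by
  by_cases hi : T.Interior a
  · by_cases hf : T.FineInterior P a
    · rw [stencil_of_fineInterior hf]; exact self_mem_nine _ _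
    · by_cases hv : T.IsVertex a
      · rw [stencil_of_vertex hi hf hv]; exact self_mem_nine _ _
      · rw [stencil_of_not_vertex hi hf hv]; exact Finset.mem_insert_self _ _
  · rw [stencil_of_not_interior hi]; exact self_mem_boundaryStencil h.1

theorem norm_le_of_mem_stencil (hT : T.Fits P) {a b : Node} (hb : b ∈ T.stencil P a) :
    ‖T.point P b - T.point P a‖ ≤ 4 * T.h := by
  have hf := hT.fineStep_pos
  have hr := hT.r_posZ
  have e : ∀ b : Node, (∀ i, |b i - a i| ≤ 2 * (T.r : ℤ)) →
      ‖T.point P b - T.point P a‖ ≤ 4 * T.h := fun b h => by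
    refine (norm_point_sub_le hf h).trans ?_
    push_cast
    rw [mul_assoc 2 (T.r : ℝ), hT.r_mul_fineStep]
    linarith
  refine e b fun i => ?_
  by_cases hi : T.Interior a
  · by_cases hfi : T.FineInterior P a
    · rw [stencil_of_fineInterior hfi] at hb
      have := abs_le_of_mem_nine zero_le_one hb i
      omega
    · by_cases hv : T.IsVertex a
      · rw [stencil_of_vertex hi hfi hv] at hb
        have := abs_le_of_mem_nine hr.le hb i
        omega
      · rw [stencil_of_not_vertex hi hfi hv] at hb
        have := abs_le_of_mem_seven hr hb i
        omega
  · rw [stencil_of_not_interior hi] at hb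
    exact abs_le_of_mem_boundaryStencil hb i

theorem norm_le_of_mem_nine_one (hT : T.Fits P) {a b : Node} (hb : b ∈ nine a 1) :
    ‖T.point P b - T.point P a‖ ≤ 2 * T.fineStep := by
  have := norm_point_sub_le (P := P) hT.fineStep_pos
    (fun i => abs_le_of_mem_nine zero_le_one hb i)
  simpa using this

theorem exists_cell {a : Node} (hT : T.Fits P) (ha : T.Interior a) (o : Node)
    (ho : o ∈ offsets) : ∃ c, T.IsCell c ∧ T.InCell c a ∧ T.InCell c (a + o) := by
  have hr := hT.r_posZ
  refine ⟨fun i => min (a i) (a i + o i) / T.r, fun i => ?_, fun i => ?_, fun i => ?_⟩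
  all_goals
    have h := ha i
    have ho' := mem_offsets.mp ho i
  · constructor
    · exact Int.ediv_nonneg (by omega) hr.le
    · refine Int.ediv_lt_of_lt_mul hr ?_
      rw [mul_comm (T.n i : ℤ)]
      omega
  all_goals
    have h1 := Int.mul_ediv_self_le (x := min (a i) (a i + o i)) hr.ne'
    have h2 := Int.lt_mul_ediv_self_add (x := min (a i) (a i + o i)) hr
    simp only [mul_add, mul_one, Pi.add_apply]
    omega

theorem FineInterior.isNode (hT : T.Fits P) {a : Node} (ha : T.FineInterior P a) {b : Node}
    (hb : b ∈ nine a 1) : T.IsNode P b := by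
  obtain ⟨o, ho, rfl⟩ := mem_nine.mp hb
  rw [one_smul]
  obtain ⟨c, hc, hca, hco⟩ := exists_cell hT ha.1 o ho
  refine ⟨fun i => ?_, Or.inr ⟨c, ha.2 c hc hca, hco⟩⟩
  have h := ha.1 i
  have ho' := mem_offsets.mp ho i
  simp only [Pi.add_apply]
  omega

theorem FineInterior.isNode_self (hT : T.Fits P) {a : Node} (ha : T.FineInterior P a) :
    T.IsNode P a := ha.isNode hT (self_mem_nine a 1)

/-- The stencil of a difference equation consists of grid points. -/
theorem isNode_of_mem_stencil (hT : T.Fits P) {a b : Node} (ha : T.IsNode P a)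
    (hv : T.Interior a ∨ T.IsVertex a) (hb : b ∈ T.stencil P a) : T.IsNode P b := by
  have hr := hT.r_posZ
  by_cases hi : T.Interior a
  · by_cases hfi : T.FineInterior P a
    · rw [stencil_of_fineInterior hfi] at hb
      exact hfi.isNode hT hb
    · have key : ∀ b : Node, (∀ i, (T.r : ℤ) ∣ b i ∧ |b i - a i| ≤ T.r) → T.IsNode P b := by
        intro b hb
        refine ⟨fun i => ?_, Or.inl fun i => (hb i).1⟩
        obtain ⟨q, hq⟩ := (hb i).1
        have h1 := hi i
        have h2 := (hb i).2
        rw [abs_le] at h2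
        have hlt : (-1 : ℤ) < q := by
          by_contra hc
          have : (T.r : ℤ) * q ≤ T.r * (-1) := mul_le_mul_of_nonneg_left (by omega) hr.le
          omega
        have hlt' : q < T.n i + 1 := by
          by_contra hc
          have : (T.r : ℤ) * (T.n i + 1) ≤ T.r * q := mul_le_mul_of_nonneg_left (by omega) hr.le
          rw [mul_add] at this
          omega
        rw [hq]
        exact ⟨mul_nonneg hr.le (by omega), mul_le_mul_of_nonneg_left (by omega) hr.le⟩
      by_cases hv : T.IsVertex a
      · rw [stencil_of_vertex hi hfi hv] at hb
        refine key b fun i => ⟨?_, abs_le_of_mem_nine hr.le hb i⟩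
        obtain ⟨o, ho, rfl⟩ := mem_nine.mp hb
        exact dvd_add (hv i) (Dvd.intro _ rfl)
      · rw [stencil_of_not_vertex hi hfi hv] at hb
        have hd := fun i => abs_le_of_mem_seven hr hb i
        rw [seven, Finset.mem_insert] at hb
        rcases hb with rfl | hb
        · exact ha
        · refine key b fun i => ⟨?_, hd i⟩
          rw [Fintype.mem_piFinset] at hb
          have h := hb i
          split_ifs at h with hdv
          · simp only [Finset.mem_insert, Finset.mem_singleton] at h
            rcases h with h | h | h <;> rw [h]
            · exact dvd_sub hdv dvd_rfl
            · exact hdv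
            · exact dvd_add hdv dvd_rfl
          · simp only [Finset.mem_insert, Finset.mem_singleton] at h
            rcases h with h | h <;> rw [h]
            · exact Dvd.intro _ rfl
            · exact dvd_add (Dvd.intro _ rfl) dvd_rfl
  · classical
    rw [stencil_of_not_interior hi, boundaryStencil, Finset.mem_filter,
      Fintype.mem_piFinset] at hb
    refine ⟨hb.2, Or.inl fun i => ?_⟩
    have hvi := (hv.resolve_left hi) i
    have h := hb.1 i
    simp only [Finset.mem_insert, Finset.mem_singleton] at h
    have h2 : (T.r : ℤ) ∣ 2 * T.r := dvd_mul_left _ _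
    rcases h with h | h | h | h | h <;> rw [h]
    · exact dvd_sub hvi h2
    · exact dvd_sub hvi dvd_rfl
    · exact hvi
    · exact dvd_add hvi dvd_rfl
    · exact dvd_add hvi h2

theorem infDist_le_of_refined {c : ℝ} (hc : 0 < c)
    (hd : ∀ x ∈ P.rect, c * Metric.infDist x (Set.range P.X) ≤ |P.φ x|) (hT : T.Fits P)
    {q a : Node} (hq : T.Refined P q) (ha : T.InCell q a) :
    Metric.infDist (T.point P a) P.interface ≤ (T.lam / c + 2) * T.h := by
  obtain ⟨-, b, hb, hqb⟩ := hq
  have hbr : T.point P b ∈ P.rect := (hT.point_mem_rect_iff b).mpr hb.1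
  have h1 : Metric.infDist (T.point P b) P.interface ≤ T.lam * T.h / c := by
    rw [le_div_iff₀ hc, mul_comm]
    exact (hd _ hbr).trans hb.2.2
  have h2 : dist (T.point P a) (T.point P b) ≤ 2 * T.h := by
    rw [dist_eq_norm]
    refine (norm_point_sub_le (m := T.r) hT.fineStep_pos fun i => ?_).trans
      (by rw [Int.cast_natCast, hT.r_mul_fineStep])
    have := ha i
    have := hqb i
    rw [mul_add, mul_one] at *
    rw [abs_le]
    omega
  calc Metric.infDist (T.point P a) P.interface
      ≤ Metric.infDist (T.point P b) P.interface + dist (T.point P a) (T.point P b) :=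
        Metric.infDist_le_infDist_add_dist
    _ ≤ T.lam * T.h / c + 2 * T.h := add_le_add h1 h2
    _ = _ := by ring

/-- Grid points off the coarse grid and fine-interior points are within `O(h)` of the interface. -/
theorem exists_infDist_le (hP : P.Admissible) {lam : ℝ} (hlam : 0 < lam) :
    ∃ C, 0 < C ∧ ∀ T : Grid, T.Fits P → T.lam = lam → ∀ a, T.IsNode P a →
      (¬ T.IsVertex a ∨ T.FineInterior P a) →
      Metric.infDist (T.point P a) P.interface ≤ C * T.h := by
  obtain ⟨c, hc, hd⟩ := hP.φ_dist
  refine ⟨lam / c + 2, by positivity, fun T hT hl a ha h => ?_⟩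
  have : ∃ q, T.Refined P q ∧ T.InCell q a := by
    rcases h with h | h
    · exact ha.2.resolve_left h
    · obtain ⟨q, hq, hqa, -⟩ := exists_cell hT h.1 0 (mem_offsets.mpr fun i => by simp)
      exact ⟨q, h.2 q hq hqa, hqa⟩
  obtain ⟨q, hq, hqa⟩ := this
  rw [← hl]
  exact infDist_le_of_refined hc hd hT hq hqa

/-- For small mesh sizes every grid point that is not a Dirichlet point carries an equation. -/
theorem exists_hasRow (hP : P.Admissible) {lam : ℝ} (hlam : 0 < lam) :
    ∃ h₀, 0 < h₀ ∧ ∀ T : Grid, T.Fits P → T.lam = lam → T.h ≤ h₀ → ∀ a, T.IsNode P a →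
      T.point P a ∉ P.D → Scheme.HasRow P T a := by
  obtain ⟨C, hC, h⟩ := exists_infDist_le hP hlam
  obtain ⟨d, hd, hm⟩ := hP.exists_margin
  refine ⟨d / (2 * C), by positivity, fun T hT hl hh a ha haD => ⟨ha, haD, ?_⟩⟩
  by_cases hv : T.IsVertex a
  · exact Or.inr hv
  · left
    rw [← hT.point_mem_openRect_iff]
    refine hm _ ((h T hT hl a ha (Or.inl hv)).trans_lt ?_)
    rw [le_div_iff₀ (by positivity)] at hh
    nlinarith [hT.h_pos]

/-- An irregular point is within one fine step of the interface. -/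
theorem infDist_le_of_not_regular (hP : P.Admissible) (hT : T.Fits P) {a : Node}
    (ha : T.FineInterior P a) (h : ¬ T.Regular P a) :
    Metric.infDist (T.point P a) P.interface ≤ T.fineStep := by
  simp only [Regular, not_forall] at h
  obtain ⟨i, e, he, hne⟩ := h
  have hmem : a + Pi.single i e ∈ nine a 1 := by
    refine mem_nine.mpr ⟨Pi.single i e, mem_offsets.mpr fun j => ?_, by simp⟩
    by_cases hj : j = i
    · subst hj; simp; omega
    · simp [hj]
  have hb := ha.isNode hT hmem
  by_contra hlt
  push Not at hlt
  refine hne (hP.phase_eq_of_dist_lt ((hT.point_mem_rect_iff a).mpr (ha.isNode_self hT).1)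
    ((hT.point_mem_rect_iff _).mpr hb.1) (lt_of_le_of_lt ?_ hlt)).symm
  have hs : T.point P (a + Pi.single i e) - T.point P a
      = EuclideanSpace.single i ((e : ℝ) * T.fineStep) := by
    ext j
    rw [point_sub_apply]
    by_cases hj : j = i
    · subst hj; simp
    · simp [hj]
  rw [dist_comm, dist_eq_norm, hs, PiLp.norm_single, Real.norm_eq_abs, abs_mul,
    abs_of_pos hT.fineStep_pos]
  rcases he with rfl | rfl <;> simp

end Grid

end TwoGrid

end

noncomputable section

namespace TwoGrid

/-! ### Exact rows: coarse, fine and hanging nodes -/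

theorem polyFun_polyLap_shiftMonomial (a : Plane) (k l : ℕ) (x : Plane) :
    polyFun (polyLap (shiftMonomial a k l)) x
      = k * (k - 1 : ℕ) * ((x 0 - a 0) ^ (k - 1 - 1) * (x 1 - a 1) ^ l)
        + l * (l - 1 : ℕ) * ((x 0 - a 0) ^ k * (x 1 - a 1) ^ (l - 1 - 1)) := by
  simp only [polyLap, Fin.sum_univ_two, pderiv_zero_shiftMonomial, pderiv_one_shiftMonomial,
    Derivation.map_smul]
  simp only [MvPolynomial.smul_eq_C_mul, polyFun_add, polyFun_mul, polyFun_C,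
    polyFun_shiftMonomial]
  ring

theorem sum_offsets {M : Type*} [AddCommMonoid M] (F : Node → M) :
    ∑ o ∈ Grid.offsets, F o
      = F ![-1, -1] + F ![-1, 0] + F ![-1, 1] + F ![0, -1] + F 0 + F ![0, 1]
        + F ![1, -1] + F ![1, 0] + F ![1, 1] := by
  have : Grid.offsets = {![-1, -1], ![-1, 0], ![-1, 1], ![0, -1], 0, ![0, 1],
      ![1, -1], ![1, 0], ![1, 1]} := by decide
  rw [this]
  repeat rw [Finset.sum_insert (by decide)]
  rw [Finset.sum_singleton]
  simp only [add_assoc]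

theorem card_offsets : Grid.offsets.card = 9 := by decide

theorem sum_nine {M : Type*} [AddCommMonoid M] (a : Node) {k : ℤ} (hk : k ≠ 0) (F : Node → M) :
    ∑ b ∈ Grid.nine a k, F b = ∑ o ∈ Grid.offsets, F (a + k • o) := by
  refine Finset.sum_image fun o _ o' _ h => ?_
  have := add_left_cancel h
  exact smul_right_injective _ hk this

/-- The compact scheme is exact for polynomials of degree at most five. -/
theorem compact_exact {h : ℝ} (hh : h ≠ 0) (κ : ℝ) {k l : ℕ} (hkl : k + l < 6) :
    ∑ o ∈ Grid.offsets, κ * compactLap o / h ^ 2 * ((o 0 * h) ^ k * (o 1 * h) ^ l)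
      = ∑ o ∈ Grid.offsets, compactAvg o * (κ *
        (k * (k - 1 : ℕ) * ((o 0 * h) ^ (k - 1 - 1) * (o 1 * h) ^ l)
        + l * (l - 1 : ℕ) * ((o 0 * h) ^ k * (o 1 * h) ^ (l - 1 - 1)))) := by
  rw [sum_offsets, sum_offsets]
  have hk : k < 6 := by omega
  have hl : l < 6 := by omega
  simp only [compactAvg, compactLap, Matrix.cons_val_zero, Matrix.cons_val_one, Pi.zero_apply]
  norm_num
  interval_cases k <;> interval_cases l <;> first
    | (exfalso; omega)
    | (norm_num; try (field_simp; ring))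

/-- The five-point scheme is exact for polynomials of degree at most three. -/
theorem fivePoint_exact {h : ℝ} (hh : h ≠ 0) (κ : ℝ) {k l : ℕ} (hkl : k + l < 4) :
    ∑ o ∈ Grid.offsets, κ * fivePoint o / h ^ 2 * ((o 0 * h) ^ k * (o 1 * h) ^ l)
      = ∑ o ∈ Grid.offsets, (if o = 0 then 1 else 0) * (κ *
        (k * (k - 1 : ℕ) * ((o 0 * h) ^ (k - 1 - 1) * (o 1 * h) ^ l)
        + l * (l - 1 : ℕ) * ((o 0 * h) ^ k * (o 1 * h) ^ (l - 1 - 1)))) := by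
  rw [sum_offsets, sum_offsets]
  have hk : k < 4 := by omega
  have hl : l < 4 := by omega
  simp only [fivePoint, Matrix.cons_val_zero, Matrix.cons_val_one, Pi.zero_apply]
  norm_num
  interval_cases k <;> interval_cases l <;> first
    | (exfalso; omega)
    | (norm_num; try (field_simp; ring))

namespace Scheme

open Grid InterfaceProblem

variable {P : InterfaceProblem} {T : Grid} {S : Scheme}

/-- The difference equation at `a` involves one side of the interface only, has no correction term
and is exact for polynomials of degree less than `n`. -/
structure ExactRow (P : InterfaceProblem) (T : Grid) (S : Scheme) (n : ℕ) (a : Node) : Prop where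
  corr : S.corr a = 0
  sum_β : ∑ b ∈ T.stencil P a, S.β a b = 1
  phase_eq : ∀ b ∈ T.stencil P a, S.α a b ≠ 0 ∨ S.β a b ≠ 0 →
    P.phase (T.point P b) = P.phase (T.point P a)
  exact : ∀ k l, k + l < n →
    ∑ b ∈ T.stencil P a, S.α a b * polyFun (shiftMonomial (T.point P a) k l) (T.point P b)
      = ∑ b ∈ T.stencil P a, S.β a b * (P.κ (P.phase (T.point P a)) *
          polyFun (polyLap (shiftMonomial (T.point P a) k l)) (T.point P b))

theorem point_add_smul_sub (a o : Node) (k : ℤ) (i : Fin 2) :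
    T.point P (a + k • o) i - T.point P a i = o i * (k * T.fineStep) := by
  rw [point_apply, point_apply]
  simp
  ring

theorem exactRow_coarse (hT : T.Fits P) {a : Node} (hn : T.IsNode P a) (hi : T.Interior a)
    (hf : ¬ T.FineInterior P a) (hv : T.IsVertex a) (hres : T.Resolves P)
    (h : S.CoarseRow P T a) : ExactRow P T S 6 a := by
  have hr : (T.r : ℤ) ≠ 0 := hT.r_posZ.ne'
  have hh := hT.h_pos.ne'
  have hrf : ((T.r : ℤ) : ℝ) * T.fineStep = T.h := by
    rw [Int.cast_natCast]; exact hT.r_mul_fineStep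
  refine ⟨h.2, ?_, fun b hb _ => hres a hn hi hf b hb, fun k l hkl => ?_⟩
  · rw [stencil_of_vertex hi hf hv, sum_nine a hr, Finset.sum_congr rfl fun o ho => (h.1 o ho).2,
      sum_offsets]
    simp [compactAvg]
    norm_num
  · rw [stencil_of_vertex hi hf hv, sum_nine a hr, sum_nine a hr]
    simp only [polyFun_shiftMonomial, polyFun_polyLap_shiftMonomial, point_add_smul_sub, hrf]
    refine Eq.trans (Finset.sum_congr rfl fun o ho => ?_)
      ((compact_exact hh (P.κ (P.phase (T.point P a))) hkl).trans
        (Finset.sum_congr rfl fun o ho => ?_))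
    · rw [(h.1 o ho).1]
    · rw [(h.1 o ho).2]

theorem exactRow_fine (hT : T.Fits P) {a : Node} (hf : T.FineInterior P a)
    (hreg : T.Regular P a) (h : S.FineRow P T a) : ExactRow P T S 4 a := by
  have hh := hT.fineStep_pos.ne'
  refine ⟨h.2, ?_, fun b hb hab => ?_, fun k l hkl => ?_⟩
  · rw [stencil_of_fineInterior hf, sum_nine a one_ne_zero]
    simp only [one_smul]
    rw [Finset.sum_congr rfl fun o ho => (h.1 o ho).2, sum_offsets]
    simp
  · rw [stencil_of_fineInterior hf] at hb
    obtain ⟨o, ho, rfl⟩ := mem_nine.mp hb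
    rw [one_smul] at hab ⊢
    rw [(h.1 o ho).1, (h.1 o ho).2] at hab
    by_cases ho0 : o = 0
    · rw [ho0, add_zero]
    · have h01 : o 0 = 0 ∨ o 1 = 0 := by
        by_contra hc
        simp [fivePoint, ho0, hc] at hab
      have key : ∀ i j : Fin 2, i ≠ j → o j = 0 → P.phase (T.point P (a + o))
          = P.phase (T.point P a) := by
        intro i j hij hj
        have hoi : o = Pi.single i (o i) := by
          ext m
          by_cases hm : m = i
          · subst hm; simp
          · have : m = j := by
              fin_cases i <;> fin_cases j <;> fin_cases m <;> simp_all
            rw [this, hj, Pi.single_eq_of_ne hij.symm]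
        have hne : o i ≠ 0 := fun h0 => ho0 (by rw [hoi, h0]; simp)
        have := mem_offsets.mp ho i
        have := hreg i (o i) (by omega)
        rwa [← hoi] at this
      rcases h01 with h0 | h1
      · exact key 1 0 (by decide) h0
      · exact key 0 1 (by decide) h1
  · rw [stencil_of_fineInterior hf, sum_nine a one_ne_zero, sum_nine a one_ne_zero]
    simp only [polyFun_shiftMonomial, polyFun_polyLap_shiftMonomial, point_add_smul_sub,
      Int.cast_one, one_mul]
    simp only [one_smul]
    refine Eq.trans (Finset.sum_congr rfl fun o ho => ?_)
      ((fivePoint_exact hh (P.κ (P.phase (T.point P a))) hkl).trans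
        (Finset.sum_congr rfl fun o ho => ?_))
    · rw [(h.1 o ho).1]
    · rw [(h.1 o ho).2]

theorem exactRow_hanging (hres : T.Resolves P) {a : Node}
    (ha : T.Hanging P a) (h : S.HangingRow P T a) : ExactRow P T S 4 a := by
  obtain ⟨hn, hi, hf, hv⟩ := ha
  refine ⟨h.1, ?_, fun b hb _ => hres a hn hi hf b hb, fun k l hkl => ?_⟩
  · rw [stencil_of_not_vertex hi hf hv]
    exact h.2.1
  · rw [stencil_of_not_vertex hi hf hv]
    have := h.2.2 ![k, l] (by simp; omega) (by simp; omega) (by simp; omega)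
      (polyFun (shiftMonomial (T.point P a) k l))
      (by ext x; simp [polyFun_shiftMonomial, Fin.prod_univ_two])
    simpa only [laplacian_polyFun] using this

namespace ExactRow

variable {n : ℕ} {a : Node}

theorem sum_zero (h : ExactRow P T S n a) (hn : 2 < n) : ∑ b ∈ T.stencil P a, S.α a b = 0 := by
  have := h.exact 0 0 (by omega)
  simpa [polyFun_shiftMonomial, polyFun_polyLap_shiftMonomial] using this

theorem sum_one (h : ExactRow P T S n a) (hn : 2 < n) (i : Fin 2) :
    ∑ b ∈ T.stencil P a, S.α a b * (T.point P b - T.point P a) i = 0 := by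
  have h0 := h.exact 1 0 (by omega)
  have h1 := h.exact 0 1 (by omega)
  fin_cases i
  · simpa [polyFun_shiftMonomial, polyFun_polyLap_shiftMonomial] using h0
  · simpa [polyFun_shiftMonomial, polyFun_polyLap_shiftMonomial] using h1

theorem sum_two (h : ExactRow P T S n a) (hn : 2 < n) (g : Plane) :
    ∑ b ∈ T.stencil P a, S.α a b * (inner ℝ g (T.point P b - T.point P a)) ^ 2
      = 2 * P.κ (P.phase (T.point P a)) * ‖g‖ ^ 2 := by
  have h0 := h.exact 2 0 (by omega)
  have h1 := h.exact 0 2 (by omega)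
  have h2 := h.exact 1 1 (by omega)
  simp only [polyFun_shiftMonomial, polyFun_polyLap_shiftMonomial] at h0 h1 h2
  norm_num [← Finset.sum_mul, h.sum_β] at h0 h1 h2
  rw [norm_sq_eq]
  have e : ∀ b, S.α a b * (inner ℝ g (T.point P b - T.point P a)) ^ 2
      = g 0 ^ 2 * (S.α a b * (T.point P b 0 - T.point P a 0) ^ 2)
        + g 1 ^ 2 * (S.α a b * (T.point P b 1 - T.point P a 1) ^ 2)
        + 2 * g 0 * g 1 * (S.α a b * ((T.point P b 0 - T.point P a 0)
          * (T.point P b 1 - T.point P a 1))) := by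
    intro b
    simp only [PiLp.inner_apply, Fin.sum_univ_two, PiLp.sub_apply, RCLike.inner_apply, conj_trivial]
    ring
  simp only [e, Finset.sum_add_distrib, ← Finset.mul_sum, h0, h1, h2]
  ring

theorem sum_inner (h : ExactRow P T S n a) (hn : 2 < n) (g : Plane) :
    ∑ b ∈ T.stencil P a, S.α a b * inner ℝ g (T.point P b - T.point P a) = 0 := by
  have h0 := h.sum_one hn 0
  have h1 := h.sum_one hn 1
  have e : ∀ b, S.α a b * inner ℝ g (T.point P b - T.point P a)
      = g 0 * (S.α a b * (T.point P b - T.point P a) 0)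
        + g 1 * (S.α a b * (T.point P b - T.point P a) 1) := by
    intro b
    simp only [PiLp.inner_apply, Fin.sum_univ_two, RCLike.inner_apply, conj_trivial]
    ring
  simp only [e, Finset.sum_add_distrib, ← Finset.mul_sum, h0, h1]
  ring

theorem sum_norm_sq (h : ExactRow P T S n a) (hn : 2 < n) :
    ∑ b ∈ T.stencil P a, S.α a b * ‖T.point P b - T.point P a‖ ^ 2
      = 4 * P.κ (P.phase (T.point P a)) := by
  have h0 := h.sum_two hn (EuclideanSpace.single 0 1)
  have h1 := h.sum_two hn (EuclideanSpace.single 1 1)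
  simp only [EuclideanSpace.inner_single_left, PiLp.norm_single] at h0 h1
  simp only [norm_sq_eq, mul_add, Finset.sum_add_distrib]
  simp only [map_one, one_mul, norm_one, one_pow, mul_one] at h0 h1
  rw [h0, h1]
  ring

end ExactRow

/-! ### Rows of the immersed interface scheme -/

/-- The interface relations at `X t` with homogeneous data. -/
structure HomogeneousJump (P : InterfaceProblem) (t : ℝ) (q : Phase → Plane → ℝ) : Prop where
  value : ∀ k ≤ 2, iteratedDeriv k
      (fun s => q Phase.plus (P.X s) - q Phase.minus (P.X s)) t = 0
  flux : ∀ k ≤ 1, iteratedDeriv k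
      (fun s => P.κ Phase.plus * fderiv ℝ (q Phase.plus) (P.X s) (P.normal s)
        - P.κ Phase.minus * fderiv ℝ (q Phase.minus) (P.X s) (P.normal s)) t = 0
  source : P.κ Phase.plus * (Δ (q Phase.plus)) (P.X t)
      - P.κ Phase.minus * (Δ (q Phase.minus)) (P.X t) = 0

theorem hasDerivAt_zero_of_sq_bound {ψ : ℝ → ℝ} {t C : ℝ} (h : ∀ s, |ψ s| ≤ C * |s - t| ^ 2) :
    HasDerivAt ψ 0 t := by
  have h0 : ψ t = 0 := by simpa using h t
  rw [hasDerivAt_iff_isLittleO]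
  simp only [h0, sub_zero, smul_zero]
  have h1 : ψ =O[𝓝 t] fun s => (s - t) ^ 2 :=
    Asymptotics.IsBigO.of_bound C (Filter.Eventually.of_forall fun s => by
      simpa using h s)
  refine h1.trans_isLittleO ?_
  have := (Asymptotics.isLittleO_pow_id (𝕜 := ℝ) one_lt_two)
  exact this.comp_tendsto (tendsto_sub_nhds_zero_iff.mpr Filter.tendsto_id)

theorem iteratedDeriv_eq_zero {f f' : ℝ → ℝ} {t : ℝ} (h0 : f t = 0) (hf : ∀ s, HasDerivAt f (f' s) s)
    (h1 : f' t = 0) (h2 : HasDerivAt f' 0 t) : ∀ k ≤ 2, iteratedDeriv k f t = 0 := by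
  have e : deriv f = f' := funext fun s => (hf s).deriv
  intro k hk
  interval_cases k
  · simpa using h0
  · rw [iteratedDeriv_one, e, h1]
  · rw [iteratedDeriv_succ, iteratedDeriv_one, e, h2.deriv]

theorem iteratedDeriv_eq_zero' {f : ℝ → ℝ} {t : ℝ} (h0 : f t = 0) (h1 : HasDerivAt f 0 t) :
    ∀ k ≤ 1, iteratedDeriv k f t = 0 := by
  intro k hk
  interval_cases k
  · simpa using h0
  · rw [iteratedDeriv_one, h1.deriv]

theorem dist_X_le (hP : P.Admissible) (s t : ℝ) : ‖P.X s - P.X t‖ ≤ |s - t| := by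
  have := Convex.norm_image_sub_le_of_norm_deriv_le (𝕜 := ℝ) (f := P.X) (C := 1) (s := Set.univ)
    (x := t) (y := s) (fun x _ => hP.X_smooth.differentiable (by norm_num) x)
    (fun x _ => (hP.X_arclength x).le) convex_univ trivial trivial
  simpa using this

theorem norm_normal (hP : P.Admissible) (t : ℝ) : ‖P.normal t‖ = 1 := by
  have h1 := hP.X_arclength t
  have h2 : ‖P.normal t‖ ^ 2 = 1 := by
    have h3 : ‖deriv P.X t‖ ^ 2 = 1 := by rw [h1]; norm_num
    rw [norm_sq_eq] at h3 ⊢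
    simp [normal]
    linarith
  nlinarith [norm_nonneg (P.normal t)]

theorem contDiff_normal (hP : P.Admissible) : ContDiff ℝ 1 P.normal := by
  have h : ContDiff ℝ 1 (deriv P.X) := by
    have := hP.X_smooth
    rw [show (2 : WithTop ℕ∞) = 1 + 1 by norm_num, contDiff_succ_iff_deriv] at this
    exact this.2.2
  rw [contDiff_euclidean] at h ⊢
  intro i
  fin_cases i
  · simpa [normal] using h 1
  · simpa [normal] using (h 0).neg

/-- The second order Taylor polynomials of the two branches of the solution satisfy the interface
relations. -/
theorem jumpCompatible_taylor (hP : P.Admissible) {u : Phase → Plane → ℝ} (hu : P.IsSolution u)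
    (t : ℝ) : JumpCompatible P t (fun s => polyFun (taylorPoly 3 (u s) (P.X t))) := by
  have hu3 : ∀ s, ContDiff ℝ (1 + 2 : ℕ) (u s) := fun s =>
    (hu.smooth s).of_le (by norm_cast)
  choose C hC0 hC using fun s => exists_taylor_bounds P.isCompact_rect P.convex_rect 1 (u s) (hu3 s)
  have hXr : ∀ s, P.X s ∈ P.rect := fun s =>
    P.openRect_subset_rect (hP.interface_subset ⟨s, rfl⟩)
  set p : Phase → MvPolynomial (Fin 2) ℝ := fun s => taylorPoly 3 (u s) (P.X t) with hp
  have hC := fun s x => hC s (P.X t) (hXr t) (P.X x) (hXr x)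
  let R : Phase → Plane → ℝ := fun s x => u s x - polyFun (p s) x
  have hud : ∀ s, Differentiable ℝ (u s) := fun s => (hu.smooth s).differentiable (by norm_num)
  have hpd : ∀ s, Differentiable ℝ (polyFun (p s)) := fun s =>
    (contDiff_polyFun (n := 1) (p s)).differentiable (by norm_num)
  have hRd : ∀ s, Differentiable ℝ (R s) := fun s => (hud s).sub (hpd s)
  have hRf : ∀ s x, fderiv ℝ (R s) x = fderiv ℝ (u s) x - fderiv ℝ (polyFun (p s)) x :=
    fun s x => fderiv_sub (hud s x) (hpd s x)
  have hpow : ∀ (s : ℝ) (n : ℕ), ‖P.X s - P.X t‖ ^ n ≤ |s - t| ^ n := fun s n =>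
    pow_le_pow_left₀ (norm_nonneg _) (dist_X_le hP s t) n
  have hRn : ∀ s x, ‖fderiv ℝ (R s) (P.X x)‖ ≤ 2 * C s * |x - t| ^ 2 := by
    intro s x
    have hb : ∀ i, |pd i (R s) (P.X x)| ≤ C s * |x - t| ^ 2 := fun i => by
      have := (hC s x).2.1 i
      rw [pd, hRf]
      exact this.trans (mul_le_mul_of_nonneg_left (hpow x 2) (hC0 s))
    exact (norm_fderiv_le _ _).trans (by linarith [hb 0, hb 1])
  have hXd : ∀ s, HasDerivAt P.X (deriv P.X s) s := fun s =>
    (hP.X_smooth.differentiable (by norm_num) s).hasDerivAt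
  -- the jump of the remainders and its derivative
  let ψ : ℝ → ℝ := fun s => R Phase.plus (P.X s) - R Phase.minus (P.X s)
  let ψ' : ℝ → ℝ := fun s => fderiv ℝ (R Phase.plus) (P.X s) (deriv P.X s)
    - fderiv ℝ (R Phase.minus) (P.X s) (deriv P.X s)
  have hψ : ∀ s, HasDerivAt ψ (ψ' s) s := fun s =>
    ((hRd Phase.plus _).hasFDerivAt.comp_hasDerivAt s (hXd s)).sub
      ((hRd Phase.minus _).hasFDerivAt.comp_hasDerivAt s (hXd s))
  have hop : ∀ (L : Plane →L[ℝ] ℝ) (v : Plane), ‖v‖ = 1 → |L v| ≤ ‖L‖ := fun L v hv => by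
    simpa [hv] using L.le_opNorm v
  have hψ'b : ∀ s, |ψ' s| ≤ (2 * C Phase.plus + 2 * C Phase.minus) * |s - t| ^ 2 := fun s => by
    rw [add_mul]
    refine (abs_sub _ _).trans (add_le_add ?_ ?_)
    · exact (hop _ _ (hP.X_arclength s)).trans (hRn _ _)
    · exact (hop _ _ (hP.X_arclength s)).trans (hRn _ _)
  have hψ0 : ψ t = 0 := by
    have h := fun s => (hC s t).1
    simp only [sub_self, norm_zero] at h
    have : ∀ s, R s (P.X t) = 0 := fun s => by simpa using h s
    simp [ψ, this]
  have hψ't : ψ' t = 0 := by simpa using hψ'b t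
  let χ : ℝ → ℝ := fun s => P.κ Phase.plus * fderiv ℝ (R Phase.plus) (P.X s) (P.normal s)
    - P.κ Phase.minus * fderiv ℝ (R Phase.minus) (P.X s) (P.normal s)
  have hχb : ∀ s, |χ s| ≤ (P.κ Phase.plus * (2 * C Phase.plus)
      + P.κ Phase.minus * (2 * C Phase.minus)) * |s - t| ^ 2 := fun s => by
    have hs : ∀ s', |P.κ s' * fderiv ℝ (R s') (P.X s) (P.normal s)|
        ≤ P.κ s' * (2 * C s') * |s - t| ^ 2 := fun s' => by
      rw [abs_mul, abs_of_pos (hP.κ_pos s'), mul_assoc]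
      exact mul_le_mul_of_nonneg_left ((hop _ _ (norm_normal hP s)).trans (hRn _ _))
        (hP.κ_pos s').le
    rw [add_mul]
    exact (abs_sub _ _).trans (add_le_add (hs _) (hs _))
  have hχt : χ t = 0 := by simpa using hχb t
  refine ⟨?_, ?_, ?_⟩
  · have e : (fun s => polyFun (p Phase.plus) (P.X s) - polyFun (p Phase.minus) (P.X s))
        = fun s => P.w s - ψ s := by
      ext s
      have := hu.jump s
      simp only [ψ, R]
      linarith
    have hw1 : ∀ s, HasDerivAt P.w (deriv P.w s) s := fun s =>
      (hP.w_smooth.differentiable (by norm_num) s).hasDerivAt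
    have hw2 : HasDerivAt (deriv P.w) (deriv (deriv P.w) t) t := by
      have := hP.w_smooth
      rw [show (2 : WithTop ℕ∞) = 1 + 1 by norm_num, contDiff_succ_iff_deriv] at this
      exact (this.2.2.differentiable (by norm_num) t).hasDerivAt
    have hd : deriv (fun s => P.w s - ψ s) = fun s => deriv P.w s - ψ' s :=
      funext fun s => ((hw1 s).sub (hψ s)).deriv
    intro k hk
    rw [e]
    interval_cases k
    · simp [hψ0]
    · rw [iteratedDeriv_one, iteratedDeriv_one, hd]
      exact (congrArg _ hψ't).trans (sub_zero _)
    · rw [iteratedDeriv_succ, iteratedDeriv_one, iteratedDeriv_succ, iteratedDeriv_one, hd]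
      exact (hw2.sub (hasDerivAt_zero_of_sq_bound hψ'b)).deriv.trans (sub_zero _)
  · have e : (fun s => P.κ Phase.plus * fderiv ℝ (polyFun (p Phase.plus)) (P.X s) (P.normal s)
        - P.κ Phase.minus * fderiv ℝ (polyFun (p Phase.minus)) (P.X s) (P.normal s))
        = fun s => P.v s - χ s := by
      ext s
      have := hu.flux_jump s
      simp only [χ, hRf, sub_apply]
      linarith
    intro k hk
    rw [e]
    interval_cases k
    · simp [hχt]
    · rw [iteratedDeriv_one, iteratedDeriv_one]
      exact (((hP.v_smooth.differentiable (by norm_num) t).hasDerivAt).sub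
        (hasDerivAt_zero_of_sq_bound hχb)).deriv.trans (sub_zero _)
  · have hr : ∀ s, P.X t ∈ P.region s := fun s => by
      cases s
      · exact ⟨hXr t, (hP.φ_zero t).le⟩
      · exact ⟨hXr t, (hP.φ_zero t).ge⟩
    have h := fun s => (hC s t).2.2
    simp only [sub_self, norm_zero, pow_one, mul_zero] at h
    have h' : ∀ s, (Δ (polyFun (p s))) (P.X t) = (Δ (u s)) (P.X t) := fun s => by
      have := abs_eq_zero.mp (le_antisymm (h s) (abs_nonneg _))
      simp only [hp]
      linarith
    change P.κ Phase.plus * (Δ (polyFun (p Phase.plus))) (P.X t)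
      - P.κ Phase.minus * (Δ (polyFun (p Phase.minus))) (P.X t) = _
    rw [h', h', hu.pde _ _ (hr _), hu.pde _ _ (hr _)]

/-- Exactness of the immersed interface scheme for homogeneous interface relations: the difference
of two compatible pairs. -/
theorem immersed_exact (hP : P.Admissible) {u : Phase → Plane → ℝ} (hu : P.IsSolution u)
    {t : ℝ} {a : Node}
    (h : ∀ p : Phase → MvPolynomial (Fin 2) ℝ, (∀ s, (p s).totalDegree ≤ 2) →
      JumpCompatible P t (fun s => polyFun (p s)) →
      ∑ b ∈ nine a 1, S.α a b * polyFun (p (P.phase (T.point P b))) (T.point P b)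
        = P.κ (P.phase (T.point P a)) *
            (Δ (polyFun (p (P.phase (T.point P a))))) (T.point P a) + S.corr a)
    (q : Phase → MvPolynomial (Fin 2) ℝ) (hq : ∀ s, (q s).totalDegree ≤ 2)
    (hj : HomogeneousJump P t (fun s => polyFun (q s))) :
    ∑ b ∈ nine a 1, S.α a b * polyFun (q (P.phase (T.point P b))) (T.point P b)
      = P.κ (P.phase (T.point P a)) *
          polyFun (polyLap (q (P.phase (T.point P a)))) (T.point P a) := by
  set p : Phase → MvPolynomial (Fin 2) ℝ := fun s => taylorPoly 3 (u s) (P.X t) with hp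
  have hdeg : ∀ s, (p s).totalDegree ≤ 2 := fun s => totalDegree_taylorPoly_le 3 _ _
  have hc : JumpCompatible P t (fun s => polyFun (p s)) := jumpCompatible_taylor hP hu t
  have hX : ContDiff ℝ 2 P.X := hP.X_smooth
  have hn := contDiff_normal hP
  have cv : ∀ p : Phase → MvPolynomial (Fin 2) ℝ, ContDiff ℝ 2
      (fun s => polyFun (p Phase.plus) (P.X s) - polyFun (p Phase.minus) (P.X s)) := fun p =>
    ((contDiff_polyFun _).comp hX).sub ((contDiff_polyFun _).comp hX)
  have cf : ∀ p : Phase → MvPolynomial (Fin 2) ℝ, ContDiff ℝ 1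
      (fun s => P.κ Phase.plus * fderiv ℝ (polyFun (p Phase.plus)) (P.X s) (P.normal s)
        - P.κ Phase.minus * fderiv ℝ (polyFun (p Phase.minus)) (P.X s) (P.normal s)) := fun p => by
    have : ∀ r : MvPolynomial (Fin 2) ℝ, ContDiff ℝ 1
        (fun s => fderiv ℝ (polyFun r) (P.X s) (P.normal s)) := fun r =>
      ((((contDiff_polyFun (n := 2) r).fderiv_right (m := 1) (by norm_num)).comp
        (hX.of_le (by norm_num)))).clm_apply hn
    exact (contDiff_const.mul (this _)).sub (contDiff_const.mul (this _))
  have hfd : ∀ (r r' : MvPolynomial (Fin 2) ℝ) (x v : Plane), fderiv ℝ (polyFun (r + r')) x v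
      = fderiv ℝ (polyFun r) x v + fderiv ℝ (polyFun r') x v := fun r r' x v => by
    simp only [fderiv_apply_eq_sum_pd, pd_polyFun, map_add, polyFun_add, mul_add,
      Finset.sum_add_distrib]
  have hlap : ∀ (r r' : MvPolynomial (Fin 2) ℝ), polyLap (r + r') = polyLap r + polyLap r' :=
    fun r r' => by simp only [polyLap, map_add, Finset.sum_add_distrib]
  have hpq : JumpCompatible P t (fun s => polyFun (p s + q s)) := by
    refine ⟨fun k hk => ?_, fun k hk => ?_, ?_⟩
    · have e : (fun s => polyFun (p Phase.plus + q Phase.plus) (P.X s)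
          - polyFun (p Phase.minus + q Phase.minus) (P.X s))
          = (fun s => polyFun (p Phase.plus) (P.X s) - polyFun (p Phase.minus) (P.X s))
            + fun s => polyFun (q Phase.plus) (P.X s) - polyFun (q Phase.minus) (P.X s) := by
        ext s
        simp only [polyFun_add, Pi.add_apply]
        ring
      have hk' : (k : WithTop ℕ∞) ≤ 2 := by exact_mod_cast hk
      rw [e, iteratedDeriv_add ((cv p).contDiffAt.of_le hk') ((cv q).contDiffAt.of_le hk'),
        hc.value k hk, hj.value k hk, add_zero]
    · have e : (fun s => P.κ Phase.plus *
            fderiv ℝ (polyFun (p Phase.plus + q Phase.plus)) (P.X s) (P.normal s)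
          - P.κ Phase.minus *
            fderiv ℝ (polyFun (p Phase.minus + q Phase.minus)) (P.X s) (P.normal s))
          = (fun s => P.κ Phase.plus * fderiv ℝ (polyFun (p Phase.plus)) (P.X s) (P.normal s)
              - P.κ Phase.minus * fderiv ℝ (polyFun (p Phase.minus)) (P.X s) (P.normal s))
            + fun s => P.κ Phase.plus * fderiv ℝ (polyFun (q Phase.plus)) (P.X s) (P.normal s)
              - P.κ Phase.minus * fderiv ℝ (polyFun (q Phase.minus)) (P.X s) (P.normal s) := by
        ext s
        simp only [hfd, Pi.add_apply]
        ring
      have hk' : (k : WithTop ℕ∞) ≤ 1 := by exact_mod_cast hk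
      rw [e, iteratedDeriv_add ((cf p).contDiffAt.of_le hk') ((cf q).contDiffAt.of_le hk'),
        hc.flux k hk, hj.flux k hk, add_zero]
    · have h1 := hc.source
      have h2 := hj.source
      simp only [laplacian_polyFun, hlap, polyFun_add] at h1 h2 ⊢
      linarith
  have h1 := h p hdeg hc
  have h2 := h (fun s => p s + q s)
    (fun s => (MvPolynomial.totalDegree_add _ _).trans (max_le (hdeg s) (hq s))) hpq
  simp only [laplacian_polyFun, hlap, polyFun_add, mul_add, Finset.sum_add_distrib] at h1 h2
  linarith

end Scheme

end TwoGrid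

end

noncomputable section

namespace TwoGrid

/-! ### Quadratic polynomials and moments of the immersed interface scheme -/

/-- The polynomial `⟪g, x - c⟫`. -/
def linPoly (g c : Plane) : MvPolynomial (Fin 2) ℝ :=
  MvPolynomial.C (g 0) * (MvPolynomial.X 0 - MvPolynomial.C (c 0))
    + MvPolynomial.C (g 1) * (MvPolynomial.X 1 - MvPolynomial.C (c 1))

theorem inner_plane (g v : Plane) : inner ℝ g v = g 0 * v 0 + g 1 * v 1 := by
  simp [PiLp.inner_apply, Fin.sum_univ_two, mul_comm]

theorem polyFun_linPoly (g c x : Plane) : polyFun (linPoly g c) x = inner ℝ g (x - c) := by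
  simp [linPoly, inner_plane, polyFun]

theorem pderiv_linPoly (g c : Plane) (i : Fin 2) :
    MvPolynomial.pderiv i (linPoly g c) = MvPolynomial.C (g i) := by
  fin_cases i <;> simp [linPoly, MvPolynomial.pderiv_X]

theorem totalDegree_linPoly_le (g c : Plane) : (linPoly g c).totalDegree ≤ 1 := by
  have h : ∀ i : Fin 2, (MvPolynomial.C (g i) * (MvPolynomial.X i - MvPolynomial.C (c i)) :
      MvPolynomial (Fin 2) ℝ).totalDegree ≤ 1 := fun i => by
    refine (MvPolynomial.totalDegree_mul _ _).trans ?_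
    rw [MvPolynomial.totalDegree_C, zero_add]
    exact (MvPolynomial.totalDegree_sub _ _).trans (by simp)
  exact (MvPolynomial.totalDegree_add _ _).trans (max_le (h 0) (h 1))

/-- The quadratic polynomial `m + ⟪l, x - c⟫ + A ⟪g, x - c⟫ ^ 2 + B ⟪g', x - c⟫ ^ 2`. -/
def quadPoly (c : Plane) (m : ℝ) (l : Plane) (A : ℝ) (g : Plane) (B : ℝ) (g' : Plane) :
    MvPolynomial (Fin 2) ℝ :=
  MvPolynomial.C m + linPoly l c + MvPolynomial.C A * linPoly g c ^ 2
    + MvPolynomial.C B * linPoly g' c ^ 2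

section quadPoly

variable (c : Plane) (m : ℝ) (l : Plane) (A : ℝ) (g : Plane) (B : ℝ) (g' : Plane)

theorem polyFun_quadPoly (x : Plane) : polyFun (quadPoly c m l A g B g') x
    = m + inner ℝ l (x - c) + A * inner ℝ g (x - c) ^ 2 + B * inner ℝ g' (x - c) ^ 2 := by
  simp only [quadPoly, polyFun_add, polyFun_mul, polyFun_C, polyFun_pow, polyFun_linPoly]

theorem totalDegree_quadPoly_le : (quadPoly c m l A g B g').totalDegree ≤ 2 := by
  have h : ∀ (A : ℝ) (g : Plane), (MvPolynomial.C A * linPoly g c ^ 2).totalDegree ≤ 2 := by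
    intro A g
    refine (MvPolynomial.totalDegree_mul _ _).trans ?_
    rw [MvPolynomial.totalDegree_C, zero_add]
    refine (MvPolynomial.totalDegree_pow _ _).trans ?_
    have := totalDegree_linPoly_le g c
    omega
  have h1 := totalDegree_linPoly_le l c
  refine (MvPolynomial.totalDegree_add _ _).trans (max_le ?_ (h B g'))
  refine (MvPolynomial.totalDegree_add _ _).trans (max_le ?_ (h A g))
  refine (MvPolynomial.totalDegree_add _ _).trans (max_le (by simp) (by omega))

theorem fderiv_quadPoly (x v : Plane) : fderiv ℝ (polyFun (quadPoly c m l A g B g')) x v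
    = inner ℝ l v + 2 * A * inner ℝ g (x - c) * inner ℝ g v
      + 2 * B * inner ℝ g' (x - c) * inner ℝ g' v := by
  simp only [fderiv_apply_eq_sum_pd, pd_polyFun, quadPoly, map_add, Derivation.leibniz,
    Derivation.leibniz_pow, pderiv_linPoly, MvPolynomial.pderiv_C, Fin.sum_univ_two, smul_zero,
    add_zero, zero_add, smul_eq_mul, nsmul_eq_mul, Nat.cast_ofNat]
  have h0 : ∀ x, polyFun 0 x = 0 := fun x => by simp [polyFun]
  have h2 : (2 : MvPolynomial (Fin 2) ℝ) = MvPolynomial.C 2 := (map_ofNat _ 2).symm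
  simp only [h2, polyFun_add, polyFun_mul, polyFun_C, polyFun_pow, polyFun_linPoly, h0]
  rw [inner_plane l v, inner_plane g v, inner_plane g' v]
  ring

theorem polyLap_quadPoly (x : Plane) : polyFun (polyLap (quadPoly c m l A g B g')) x
    = 2 * A * ‖g‖ ^ 2 + 2 * B * ‖g'‖ ^ 2 := by
  have h0 : ∀ x, polyFun 0 x = 0 := fun x => by simp [polyFun]
  have h2 : (2 : MvPolynomial (Fin 2) ℝ) = MvPolynomial.C 2 := (map_ofNat _ 2).symm
  simp only [polyLap, quadPoly, map_add, Derivation.leibniz,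
    Derivation.leibniz_pow, pderiv_linPoly, MvPolynomial.pderiv_C, Fin.sum_univ_two, smul_zero,
    add_zero, zero_add, smul_eq_mul, nsmul_eq_mul, Nat.cast_ofNat, h2, polyFun_add, polyFun_mul,
    polyFun_C, polyFun_pow, polyFun_linPoly, norm_sq_eq, pow_one, Nat.add_one_sub_one,
    Derivation.map_natCast, map_zero, h0]
  ring

end quadPoly

namespace Scheme

open Grid InterfaceProblem

variable {P : InterfaceProblem} {T : Grid} {S : Scheme}

theorem inner_normal_deriv (t : ℝ) : inner ℝ (P.normal t) (deriv P.X t) = 0 := by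
  rw [inner_plane]; simp [normal]; ring

theorem hasDerivAt_inner_X (hP : P.Admissible) (g c : Plane) (s : ℝ) :
    HasDerivAt (fun s => inner ℝ g (P.X s - c)) (inner ℝ g (deriv P.X s)) s := by
  have h := (hP.X_smooth.differentiable (by norm_num) s).hasDerivAt
  exact (innerSL ℝ g).hasFDerivAt.comp_hasDerivAt s (h.sub_const c)

theorem hasDerivAt_inner_deriv_X (hP : P.Admissible) (g : Plane) (s : ℝ) :
    HasDerivAt (fun s => inner ℝ g (deriv P.X s)) (inner ℝ g (deriv (deriv P.X) s)) s := by
  have := hP.X_smooth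
  rw [show (2 : WithTop ℕ∞) = 1 + 1 by norm_num, contDiff_succ_iff_deriv] at this
  exact (innerSL ℝ g).hasFDerivAt.comp_hasDerivAt s
    (this.2.2.differentiable (by norm_num) s).hasDerivAt

theorem hasDerivAt_inner_normal (hP : P.Admissible) (g : Plane) (s : ℝ) :
    HasDerivAt (fun s => inner ℝ g (P.normal s)) (inner ℝ g (deriv P.normal s)) s :=
  (innerSL ℝ g).hasFDerivAt.comp_hasDerivAt s
    ((contDiff_normal hP).differentiable (by norm_num) s).hasDerivAt

theorem exists_bound_deriv2 (hP : P.Admissible) :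
    ∃ C, 0 ≤ C ∧ ∀ t, ‖deriv (deriv P.X) t‖ ≤ C := by
  have h := hP.X_smooth
  rw [show (2 : WithTop ℕ∞) = 1 + 1 by norm_num, contDiff_succ_iff_deriv,
    show (1 : WithTop ℕ∞) = 0 + 1 by norm_num, contDiff_succ_iff_deriv] at h
  have hc : Continuous (deriv (deriv P.X)) := h.2.2.2.2.continuous
  have hper : Function.Periodic (deriv (deriv P.X)) P.period := by
    have h1 : ∀ f : ℝ → Plane, Function.Periodic f P.period →
        Function.Periodic (deriv f) P.period := fun f hf t => by
      have : (fun s => f (s + P.period)) = f := funext hf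
      rw [← deriv_comp_add_const, this]
    exact h1 _ (h1 _ hP.X_periodic)
  obtain ⟨C, hC⟩ := (isCompact_Icc (a := (0 : ℝ)) (b := 0 + P.period)).exists_bound_of_continuousOn
    hc.continuousOn
  refine ⟨max C 0, le_max_right _ _, fun t => ?_⟩
  have hmem : deriv (deriv P.X) t ∈ deriv (deriv P.X) '' Set.Icc 0 (0 + P.period) := by
    rw [hper.image_Icc hP.period_pos 0]; exact ⟨t, rfl⟩
  obtain ⟨s, hs, he⟩ := hmem
  rw [← he]
  exact (hC s hs).trans (le_max_left _ _)

/-- On the plus side, minus half the jump of `1 / κ` times the curvature `⟪n, X''⟫` of the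
interface: the coefficient of the quadratic term that makes a pair of linear functions with
continuous flux compatible with a curved interface. -/
def curvCoeff (P : InterfaceProblem) (t : ℝ) : Phase → ℝ
  | Phase.minus => 0
  | Phase.plus => -((P.κ Phase.plus)⁻¹ - (P.κ Phase.minus)⁻¹)
      * inner ℝ (P.normal t) (deriv (deriv P.X) t) / 2

/-- The square of the distance from the tangent, divided by `κ`, satisfies the homogeneous
interface relations. -/
theorem homogeneousJump_sq (hP : P.Admissible) (t : ℝ) :
    HomogeneousJump P t (fun s => polyFun (quadPoly (P.X t) 0 0 (P.κ s)⁻¹ (P.normal t) 0 0)) := by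
  have hη := hasDerivAt_inner_X hP (P.normal t) (P.X t)
  have hη' := hasDerivAt_inner_deriv_X hP (P.normal t)
  have h0 := inner_normal_deriv (P := P) t
  refine ⟨?_, ?_, ?_⟩
  · simp only [polyFun_quadPoly]
    set c := (P.κ Phase.plus)⁻¹ - (P.κ Phase.minus)⁻¹ with hc
    have hd : ∀ s, HasDerivAt (fun s => c * (inner ℝ (P.normal t) (P.X s - P.X t)) ^ 2)
        (c * (2 * inner ℝ (P.normal t) (P.X s - P.X t) * inner ℝ (P.normal t) (deriv P.X s))) s :=
      fun s => by
        have := ((hη s).pow 2).const_mul c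
        simpa using this
    have := iteratedDeriv_eq_zero (f := fun s => c * (inner ℝ (P.normal t) (P.X s - P.X t)) ^ 2)
      (t := t) (by simp) hd (by simp) (by
        have := (((hη t).const_mul 2).mul (hη' t)).const_mul c
        simpa [h0] using this)
    intro k hk
    rw [← this k hk]
    congr 1
    ext s
    simp only [inner_zero_left]
    rw [hc]; ring
  · simp only [fderiv_quadPoly]
    intro k hk
    have hz : (fun s => P.κ Phase.plus * (inner ℝ 0 (P.normal s)
          + 2 * (P.κ Phase.plus)⁻¹ * inner ℝ (P.normal t) (P.X s - P.X t)
            * inner ℝ (P.normal t) (P.normal s) + 2 * 0 * inner ℝ 0 (P.X s - P.X t)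
            * inner ℝ 0 (P.normal s))
        - P.κ Phase.minus * (inner ℝ 0 (P.normal s)
          + 2 * (P.κ Phase.minus)⁻¹ * inner ℝ (P.normal t) (P.X s - P.X t)
            * inner ℝ (P.normal t) (P.normal s) + 2 * 0 * inner ℝ 0 (P.X s - P.X t)
            * inner ℝ 0 (P.normal s))) = fun _ => (0 : ℝ) := by
      ext s
      have h1 := (hP.κ_pos Phase.plus).ne'
      have h2 := (hP.κ_pos Phase.minus).ne'
      simp only [inner_zero_left]
      field_simp
      ring
    rw [hz]
    exact iteratedDeriv_eq_zero' rfl (hasDerivAt_const t (0 : ℝ)) k hk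
  · simp only [laplacian_polyFun, polyLap_quadPoly]
    have h1 := (hP.κ_pos Phase.plus).ne'
    have h2 := (hP.κ_pos Phase.minus).ne'
    field_simp
    ring

/-- The distance from the tangent, divided by `κ`, satisfies the homogeneous interface relations up
to a harmonic quadratic correction on one side. -/
theorem homogeneousJump_lin (hP : P.Admissible) (t : ℝ) :
    HomogeneousJump P t (fun s => polyFun (quadPoly (P.X t) 0 ((P.κ s)⁻¹ • P.normal t)
      (curvCoeff P t s) (deriv P.X t) (-curvCoeff P t s) (P.normal t))) := by
  have hη := hasDerivAt_inner_X hP (P.normal t) (P.X t)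
  have hη' := hasDerivAt_inner_deriv_X hP (P.normal t)
  have hξ := hasDerivAt_inner_X hP (deriv P.X t) (P.X t)
  have hξ' := hasDerivAt_inner_deriv_X hP (deriv P.X t)
  have h0 := inner_normal_deriv (P := P) t
  have h1 : inner ℝ (deriv P.X t) (deriv P.X t) = 1 := by
    rw [real_inner_self_eq_norm_sq, hP.X_arclength]; norm_num
  refine ⟨?_, ?_, ?_⟩
  · simp only [polyFun_quadPoly, inner_smul_left, conj_trivial]
    set c := (P.κ Phase.plus)⁻¹ - (P.κ Phase.minus)⁻¹ with hc
    set A := curvCoeff P t Phase.plus with hA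
    let f : ℝ → ℝ := fun s => c * inner ℝ (P.normal t) (P.X s - P.X t)
      + A * ((inner ℝ (deriv P.X t) (P.X s - P.X t)) ^ 2
        - (inner ℝ (P.normal t) (P.X s - P.X t)) ^ 2)
    let f' : ℝ → ℝ := fun s => c * inner ℝ (P.normal t) (deriv P.X s)
      + A * (2 * inner ℝ (deriv P.X t) (P.X s - P.X t) * inner ℝ (deriv P.X t) (deriv P.X s)
        - 2 * inner ℝ (P.normal t) (P.X s - P.X t) * inner ℝ (P.normal t) (deriv P.X s))
    have hd : ∀ s, HasDerivAt f (f' s) s := fun s => by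
      have := ((hη s).const_mul c).add ((((hξ s).pow 2).sub ((hη s).pow 2)).const_mul A)
      refine this.congr_deriv ?_
      simp [f']
    have hd2 : HasDerivAt f' 0 t := by
      have := ((hη' t).const_mul c).add (((((hξ t).const_mul 2).mul (hξ' t)).sub
        (((hη t).const_mul 2).mul (hη' t))).const_mul A)
      refine this.congr_deriv ?_
      simp only [sub_self, inner_zero_right, mul_zero, h0, h1, zero_mul, add_zero, sub_zero, mul_one]
      rw [hA, curvCoeff]
      ring
    have := iteratedDeriv_eq_zero (f := f) (t := t) (by simp [f]) hd (by simp [f', h0]) hd2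
    intro k hk
    rw [← this k hk]
    congr 1
    ext s
    simp only [f, hc, curvCoeff]
    ring
  · simp only [fderiv_quadPoly]
    refine iteratedDeriv_eq_zero' ?_ ?_
    · have h2 := (hP.κ_pos Phase.plus).ne'
      have h3 := (hP.κ_pos Phase.minus).ne'
      simp only [sub_self, inner_zero_right, mul_zero, zero_mul, add_zero, inner_smul_left,
        conj_trivial]
      field_simp
      ring
    · have hτ := hasDerivAt_inner_normal hP (deriv P.X t) t
      have hν := hasDerivAt_inner_normal hP (P.normal t) t
      have hτ0 : inner ℝ (deriv P.X t) (P.normal t) = 0 := by rw [real_inner_comm]; exact h0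
      have := ((((hξ t).mul hτ).sub ((hη t).mul hν)).const_mul
        (2 * P.κ Phase.plus * curvCoeff P t Phase.plus))
      simp only [sub_self, inner_zero_right, hτ0, h0, zero_mul, mul_zero, add_zero] at this
      refine this.congr_of_eventuallyEq (Filter.Eventually.of_forall fun s => ?_)
      have h2 := (hP.κ_pos Phase.plus).ne'
      have h3 := (hP.κ_pos Phase.minus).ne'
      simp only [inner_smul_left, conj_trivial, curvCoeff, Pi.sub_apply, Pi.mul_apply]
      field_simp
      ring
  · simp only [laplacian_polyFun, polyLap_quadPoly, norm_normal hP, hP.X_arclength]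
    ring

/-- Moments of a row of the immersed interface scheme: its exactness on constants, on
`homogeneousJump_sq` and on `homogeneousJump_lin`. -/
theorem immersed_moments (hP : P.Admissible) {u : Phase → Plane → ℝ} (hu : P.IsSolution u)
    {t : ℝ} {a : Node}
    (h : ∀ p : Phase → MvPolynomial (Fin 2) ℝ, (∀ s, (p s).totalDegree ≤ 2) →
      JumpCompatible P t (fun s => polyFun (p s)) →
      ∑ b ∈ nine a 1, S.α a b * polyFun (p (P.phase (T.point P b))) (T.point P b)
        = P.κ (P.phase (T.point P a)) *
            (Δ (polyFun (p (P.phase (T.point P a))))) (T.point P a) + S.corr a) :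
    ∑ b ∈ nine a 1, S.α a b = 0 ∧
    ∑ b ∈ nine a 1, S.α a b * ((P.κ (P.phase (T.point P b)))⁻¹ *
      inner ℝ (P.normal t) (T.point P b - P.X t) ^ 2) = 2 ∧
    ∑ b ∈ nine a 1, S.α a b * ((P.κ (P.phase (T.point P b)))⁻¹ *
        inner ℝ (P.normal t) (T.point P b - P.X t)
      + curvCoeff P t (P.phase (T.point P b)) * (inner ℝ (deriv P.X t) (T.point P b - P.X t) ^ 2
        - inner ℝ (P.normal t) (T.point P b - P.X t) ^ 2)) = 0 := by
  refine ⟨?_, ?_, ?_⟩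
  · have := immersed_exact hP hu h (fun _ => quadPoly (P.X t) 1 0 0 0 0 0)
      (fun _ => totalDegree_quadPoly_le _ _ _ _ _ _ _) ⟨fun k hk => ?_, fun k hk => ?_, ?_⟩
    · simpa [polyFun_quadPoly, polyLap_quadPoly] using this
    · simp only [sub_self]
      exact iteratedDeriv_eq_zero (f := fun _ => 0) (f' := fun _ => 0) rfl
        (fun s => hasDerivAt_const s 0) rfl (hasDerivAt_const t 0) k hk
    · simp only [fderiv_quadPoly, inner_zero_left, mul_zero, add_zero, sub_self]
      exact iteratedDeriv_eq_zero' rfl (hasDerivAt_const t (0 : ℝ)) k hk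
    · simp [laplacian_polyFun, polyLap_quadPoly]
  · have := immersed_exact hP hu h _ (fun _ => totalDegree_quadPoly_le _ _ _ _ _ _ _)
      (homogeneousJump_sq hP t)
    simp only [polyFun_quadPoly, polyLap_quadPoly, inner_zero_left, zero_add, zero_mul, add_zero,
      norm_normal hP] at this
    rw [this]
    have := (hP.κ_pos (P.phase (T.point P a))).ne'
    field_simp
    norm_num
  · have := immersed_exact hP hu h _ (fun _ => totalDegree_quadPoly_le _ _ _ _ _ _ _)
      (homogeneousJump_lin hP t)
    simp only [polyFun_quadPoly, polyLap_quadPoly, inner_smul_left, conj_trivial, zero_add,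
      norm_normal hP, hP.X_arclength] at this
    rw [show P.κ (P.phase (T.point P a)) * (2 * curvCoeff P t (P.phase (T.point P a)) * 1 ^ 2
      + 2 * -curvCoeff P t (P.phase (T.point P a)) * 1 ^ 2) = 0 by ring] at this
    rw [← this]
    refine Finset.sum_congr rfl fun b _ => ?_
    ring

/-! ### Rows at boundary points -/

/-- Moments of a row at a boundary point: its exactness on constants, on linear functions and on
their squares. -/
theorem boundary_exact {K : ℝ} {a : Node} {γ : Side × Node → ℝ}
    (h : ∀ p : MvPolynomial (Fin 2) ℝ, p.totalDegree ≤ 3 →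
      ∑ b ∈ T.boundaryStencil a, S.α a b * polyFun p (T.point P b)
        = ∑ b ∈ T.boundaryStencil a, S.β a b *
            (P.κ (P.phase (T.point P a)) * (Δ (polyFun p)) (T.point P b))
          + ∑ x ∈ dataPoints P T a, γ x *
            (fderiv ℝ (polyFun p) (T.point P x.2) x.1.normal
              + P.σ x.1 (T.point P x.2) * polyFun p (T.point P x.2)))
    (hβ : ∑ b ∈ T.boundaryStencil a, S.β a b = 1) :
    ∑ b ∈ T.boundaryStencil a, S.α a b
      = ∑ x ∈ dataPoints P T a, γ x * P.σ x.1 (T.point P x.2) ∧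
    (∀ g, ∑ b ∈ T.boundaryStencil a, S.α a b * inner ℝ g (T.point P b - T.point P a)
      = ∑ x ∈ dataPoints P T a, γ x * (inner ℝ g x.1.normal
          + P.σ x.1 (T.point P x.2) * inner ℝ g (T.point P x.2 - T.point P a))) ∧
    (∀ g, ∑ b ∈ T.boundaryStencil a, S.α a b * inner ℝ g (T.point P b - T.point P a) ^ 2
      = 2 * P.κ (P.phase (T.point P a)) * ‖g‖ ^ 2 + ∑ x ∈ dataPoints P T a, γ x *
          (2 * inner ℝ g (T.point P x.2 - T.point P a) * inner ℝ g x.1.normal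
          + P.σ x.1 (T.point P x.2) * inner ℝ g (T.point P x.2 - T.point P a) ^ 2)) := by
  have hq := fun m l A g => h (quadPoly (T.point P a) m l A g 0 0)
    ((totalDegree_quadPoly_le _ _ _ _ _ _ _).trans (by norm_num))
  simp only [polyFun_quadPoly, laplacian_polyFun, polyLap_quadPoly, fderiv_quadPoly,
    ← Finset.sum_mul, hβ, inner_zero_left] at hq
  refine ⟨?_, fun g => ?_, fun g => ?_⟩
  · simpa using hq 1 0 0 0
  · simpa using hq 0 g 0 0
  · have := hq 0 0 1 g
    simp only [inner_zero_left, zero_add, one_mul, zero_mul, mul_zero, add_zero, mul_one] at this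
    rw [this]
    ring

end Scheme

end TwoGrid

end

noncomputable section

namespace TwoGrid

/-! ### The truncation error -/

namespace Grid

variable (P : InterfaceProblem) (T : Grid)

open Classical in
/-- The order of the truncation error at a grid point, relative to `h ^ 3 + (h / r) ^ 2`: at
irregular, hanging and boundary points, which lie along curves, it is larger by one power of the
local mesh size. -/
def weight (a : Node) : ℝ :=
  if T.FineInterior P a then (if T.Regular P a then 1 else 1 / T.fineStep)
  else if T.Interior a ∧ T.IsVertex a then 1 else 1 / T.h

variable {P T}

theorem card_nine_le (a : Node) (k : ℤ) : (nine a k).card ≤ 25 :=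
  Finset.card_image_le.trans (by rw [card_offsets]; norm_num)

theorem card_seven_le (a : Node) : (T.seven a).card ≤ 25 := by
  refine (Finset.card_insert_le _ _).trans ?_
  rw [Fintype.card_piFinset, Fin.prod_univ_two]
  have h : ∀ i : Fin 2, (if (T.r : ℤ) ∣ a i then ({a i - T.r, a i, a i + T.r} : Finset ℤ)
      else {(T.r : ℤ) * (a i / (T.r : ℤ)), (T.r : ℤ) * (a i / (T.r : ℤ)) + T.r}).card ≤ 3 := by
    intro i
    split_ifs
    · exact Finset.card_le_three
    · exact Finset.card_le_two.trans (by norm_num)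
  have := Nat.mul_le_mul (h 0) (h 1)
  omega

theorem card_boundaryStencil_le (a : Node) : (T.boundaryStencil a).card ≤ 25 := by
  classical
  refine (Finset.card_filter_le _ _).trans ?_
  rw [Fintype.card_piFinset, Fin.prod_univ_two]
  have h : ∀ i, ({a i - 2 * T.r, a i - T.r, a i, a i + T.r, a i + 2 * T.r} : Finset ℤ).card ≤ 5 :=
    fun i => Finset.card_le_five
  exact Nat.mul_le_mul (h 0) (h 1)

theorem card_stencil_le (a : Node) : (T.stencil P a).card ≤ 25 := by
  classical
  unfold stencil
  split_ifs
  · exact card_nine_le a 1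
  · exact card_nine_le a _
  · exact card_seven_le a
  · exact card_boundaryStencil_le a

theorem card_dataPoints_le (a : Node) : (Scheme.dataPoints P T a).card ≤ 100 := by
  classical
  refine (Finset.card_filter_le _ _).trans ?_
  rw [Finset.card_product]
  have h1 : (Finset.univ : Finset Side).card = 4 := by decide
  rw [h1]
  exact Nat.mul_le_mul_left 4 (card_boundaryStencil_le a)

end Grid

theorem abs_sum_le_card {ι : Type*} {s : Finset ι} {F : ι → ℝ} {N B : ℝ} (hB : 0 ≤ B)
    (hN : (s.card : ℝ) ≤ N) (h : ∀ b ∈ s, |F b| ≤ B) : |∑ b ∈ s, F b| ≤ N * B := by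
  refine (Finset.abs_sum_le_sum_abs _ _).trans ((Finset.sum_le_card_nsmul _ _ _ h).trans ?_)
  rw [nsmul_eq_mul]
  gcongr

namespace Scheme

open Grid InterfaceProblem

variable {P : InterfaceProblem} {T : Grid} {S : Scheme}

/-- The exact solution at a grid point. -/
def nodal (P : InterfaceProblem) (T : Grid) (u : Phase → Plane → ℝ) (b : Node) : ℝ :=
  u (P.phase (T.point P b)) (T.point P b)

theorem Solves.residual_eq {U : Node → ℝ} (hU : S.Solves P T U) {a : Node}
    (ha : HasRow P T a) (u : Phase → Plane → ℝ) :
    ∑ b ∈ T.stencil P a, S.α a b * (nodal P T u b - U b)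
      = ∑ b ∈ T.stencil P a, S.α a b * nodal P T u b
        - ∑ b ∈ T.stencil P a, S.β a b * P.f (P.phase (T.point P b)) (T.point P b)
        - S.corr a := by
  have := hU.equation a ha
  simp only [mul_sub, Finset.sum_sub_distrib, this]
  ring

theorem ExactRow.exact_taylor {n : ℕ} {a : Node} (h : ExactRow P T S n a) (f : Plane → ℝ) :
    ∑ b ∈ T.stencil P a, S.α a b * polyFun (taylorPoly n f (T.point P a)) (T.point P b)
      = ∑ b ∈ T.stencil P a, S.β a b * (P.κ (P.phase (T.point P a)) *
          polyFun (polyLap (taylorPoly n f (T.point P a))) (T.point P b)) := by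
  let Ex : MvPolynomial (Fin 2) ℝ → Prop := fun p =>
    ∑ b ∈ T.stencil P a, S.α a b * polyFun p (T.point P b)
      = ∑ b ∈ T.stencil P a, S.β a b * (P.κ (P.phase (T.point P a)) *
          polyFun (polyLap p) (T.point P b))
  have hadd : ∀ p q, Ex p → Ex q → Ex (p + q) := fun p q hp hq => by
    have hl : polyLap (p + q) = polyLap p + polyLap q := by
      simp only [polyLap, map_add, Finset.sum_add_distrib]
    simp only [Ex, hl, polyFun_add, mul_add, Finset.sum_add_distrib] at *
    rw [hp, hq]
  have hzero : Ex 0 := by simp [Ex, polyLap, polyFun]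
  refine Finset.sum_induction _ Ex hadd hzero fun m hm => ?_
  refine Finset.sum_induction _ Ex hadd hzero fun j hj => ?_
  rw [Finset.HasAntidiagonal.mem_antidiagonal] at hj
  rw [Finset.mem_range] at hm
  have := h.exact j.1 j.2 (by omega)
  have hl : ∀ (c : ℝ) p, polyLap (c • p) = c • polyLap p := fun c p => by
    simp only [polyLap, Derivation.map_smul, Finset.smul_sum]
  have hs : ∀ (c : ℝ) p x, polyFun (c • p) x = c * polyFun p x := fun c p x => by
    simp [polyFun]
  simp only [Ex, hl, hs, mul_left_comm _ (taylorCoeff _ _ _ _), ← Finset.mul_sum] at this ⊢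
  rw [this]

/-- Truncation error of an exact row. -/
theorem ExactRow.residual_le (hT : T.Fits P) {u : Phase → Plane → ℝ} (hu : P.IsSolution u)
    {U : Node → ℝ} (hU : S.Solves P T U) {n : ℕ} {a : Node} (ha : HasRow P T a)
    (h : ExactRow P T S (n + 2) a) {C : ℝ} (hC0 : 0 ≤ C)
    (hC : ∀ s, ∀ a ∈ P.rect, ∀ x ∈ P.rect,
      |u s x - polyFun (taylorPoly (n + 2) (u s) a) x| ≤ C * ‖x - a‖ ^ (n + 2) ∧
      (∀ i, |pd i (u s) x - pd i (polyFun (taylorPoly (n + 2) (u s) a)) x|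
        ≤ C * ‖x - a‖ ^ (n + 1)) ∧
      |(Δ (u s)) x - (Δ (polyFun (taylorPoly (n + 2) (u s) a))) x| ≤ C * ‖x - a‖ ^ n)
    {d A B k : ℝ} (hA : 0 ≤ A) (hB : 0 ≤ B) (hk : ∀ s, P.κ s ≤ k) (hk0 : ∀ s, 0 < P.κ s)
    (hd : ∀ b ∈ T.stencil P a, ‖T.point P b - T.point P a‖ ≤ d)
    (hα : ∀ b ∈ T.stencil P a, |S.α a b| ≤ A) (hβ : ∀ b ∈ T.stencil P a, |S.β a b| ≤ B) :
    |∑ b ∈ T.stencil P a, S.α a b * (nodal P T u b - U b)|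
      ≤ 25 * (A * (C * d ^ (n + 2))) + 25 * (B * (k * (C * d ^ n))) := by
  set s := P.phase (T.point P a) with hs
  set p := taylorPoly (n + 2) (u s) (T.point P a) with hp
  have hrect : ∀ b ∈ T.stencil P a, T.point P b ∈ P.rect := fun b hb =>
    (hT.point_mem_rect_iff b).mpr (isNode_of_mem_stencil hT ha.1 ha.2.2 hb).1
  have har : T.point P a ∈ P.rect := (hT.point_mem_rect_iff a).mpr ha.1.1
  have hd0 : 0 ≤ d := (norm_nonneg _).trans (hd a (self_mem_stencil ha.1))
  rw [hU.residual_eq ha, h.corr, sub_zero]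
  have e1 : ∑ b ∈ T.stencil P a, S.α a b * nodal P T u b
      = ∑ b ∈ T.stencil P a, S.α a b * u s (T.point P b) := by
    refine Finset.sum_congr rfl fun b hb => ?_
    by_cases h0 : S.α a b = 0
    · simp [h0]
    · rw [nodal, h.phase_eq b hb (Or.inl h0)]
  have e2 : ∑ b ∈ T.stencil P a, S.β a b * P.f (P.phase (T.point P b)) (T.point P b)
      = ∑ b ∈ T.stencil P a, S.β a b * (P.κ s * (Δ (u s)) (T.point P b)) := by
    refine Finset.sum_congr rfl fun b hb => ?_
    by_cases h0 : S.β a b = 0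
    · simp [h0]
    · have := hu.pde _ _ (mem_region_phase (hrect b hb))
      rw [h.phase_eq b hb (Or.inr h0)] at this ⊢
      rw [this]
  have e3 : ∑ b ∈ T.stencil P a, S.α a b * u s (T.point P b)
      - ∑ b ∈ T.stencil P a, S.β a b * (P.κ s * (Δ (u s)) (T.point P b))
      = ∑ b ∈ T.stencil P a, S.α a b * (u s (T.point P b) - polyFun p (T.point P b))
        - ∑ b ∈ T.stencil P a, S.β a b *
          (P.κ s * ((Δ (u s)) (T.point P b) - (Δ (polyFun p)) (T.point P b))) := by
    have := h.exact_taylor (u s)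
    simp only [mul_sub, Finset.sum_sub_distrib, laplacian_polyFun]
    rw [← hs, ← hp] at this
    rw [this]
    ring
  rw [e1, e2, e3]
  have hk1 : 0 ≤ k := (hk0 s).le.trans (hk s)
  refine (abs_sub _ _).trans (add_le_add ?_ ?_)
  · refine abs_sum_le_card (by positivity) (by exact_mod_cast card_stencil_le a) fun b hb => ?_
    rw [abs_mul]
    refine mul_le_mul (hα b hb) ((hC s _ har _ (hrect b hb)).1.trans ?_) (abs_nonneg _) hA
    gcongr
    exact hd b hb
  · refine abs_sum_le_card (by positivity) (by exact_mod_cast card_stencil_le a) fun b hb => ?_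
    rw [abs_mul, abs_mul, abs_of_pos (hk0 s)]
    refine mul_le_mul (hβ b hb) (mul_le_mul (hk s) ((hC s _ har _ (hrect b hb)).2.2.trans ?_)
      (abs_nonneg _) hk1) (mul_nonneg (hk0 s).le (abs_nonneg _)) hB
    gcongr
    exact hd b hb

/-- Truncation error at an irregular point. -/
theorem ImmersedRow.residual_le (hP : P.Admissible) (hT : T.Fits P) {u : Phase → Plane → ℝ}
    (hu : P.IsSolution u)
    {U : Node → ℝ} (hU : S.Solves P T U) {a : Node} (ha : HasRow P T a)
    (hf : T.FineInterior P a) (hreg : ¬ T.Regular P a) (h : S.ImmersedRow P T a)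
    {C : ℝ} (hC0 : 0 ≤ C)
    (hC : ∀ s, ∀ a ∈ P.rect, ∀ x ∈ P.rect,
      |u s x - polyFun (taylorPoly 3 (u s) a) x| ≤ C * ‖x - a‖ ^ 3 ∧
      (∀ i, |pd i (u s) x - pd i (polyFun (taylorPoly 3 (u s) a)) x|
        ≤ C * ‖x - a‖ ^ 2) ∧
      |(Δ (u s)) x - (Δ (polyFun (taylorPoly 3 (u s) a))) x| ≤ C * ‖x - a‖ ^ 1)
    {A k : ℝ} (hA : 0 ≤ A) (hk : ∀ s, P.κ s ≤ k)
    (hα : ∀ b ∈ T.stencil P a, |S.α a b| ≤ A) :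
    |∑ b ∈ T.stencil P a, S.α a b * (nodal P T u b - U b)|
      ≤ 25 * (A * (C * (3 * T.fineStep) ^ 3)) + k * (C * T.fineStep) := by
  obtain ⟨hβ, t, ht, hrow⟩ := h
  have hdist : dist (T.point P a) (P.X t) ≤ T.fineStep := by
    rw [ht]; exact infDist_le_of_not_regular hP hT hf hreg
  rw [dist_eq_norm] at hdist
  set p : Phase → MvPolynomial (Fin 2) ℝ := fun s => taylorPoly 3 (u s) (P.X t) with hp
  have hrow := hrow p (fun s => totalDegree_taylorPoly_le 3 _ _) (jumpCompatible_taylor hP hu t)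
  have hXr : P.X t ∈ P.rect := P.openRect_subset_rect (hP.interface_subset ⟨t, rfl⟩)
  have hst := stencil_of_fineInterior hf
  have hrect : ∀ b ∈ T.stencil P a, T.point P b ∈ P.rect := fun b hb =>
    (hT.point_mem_rect_iff b).mpr (isNode_of_mem_stencil hT ha.1 ha.2.2 hb).1
  have har : T.point P a ∈ P.rect := (hT.point_mem_rect_iff a).mpr ha.1.1
  have hd : ∀ b ∈ T.stencil P a, ‖T.point P b - P.X t‖ ≤ 3 * T.fineStep := fun b hb => by
    rw [hst] at hb
    have := norm_le_of_mem_nine_one hT hb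
    calc ‖T.point P b - P.X t‖ = ‖(T.point P b - T.point P a) + (T.point P a - P.X t)‖ := by
          rw [sub_add_sub_cancel]
      _ ≤ _ := (norm_add_le _ _).trans (by linarith)
  have hfs := hT.fineStep_pos
  rw [hU.residual_eq ha]
  set s := P.phase (T.point P a) with hs
  have e2 : ∑ b ∈ T.stencil P a, S.β a b * P.f (P.phase (T.point P b)) (T.point P b)
      = P.κ s * (Δ (u s)) (T.point P a) := by
    rw [hu.pde _ _ (mem_region_phase har)]
    simp only [hβ, ite_mul, one_mul, zero_mul, Finset.sum_ite_eq', self_mem_stencil ha.1, if_true]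
  rw [← hst] at hrow
  have e3 : ∑ b ∈ T.stencil P a, S.α a b * nodal P T u b - P.κ s * (Δ (u s)) (T.point P a)
      - S.corr a = ∑ b ∈ T.stencil P a, S.α a b * (nodal P T u b
          - polyFun (p (P.phase (T.point P b))) (T.point P b))
        - P.κ s * ((Δ (u s)) (T.point P a) - (Δ (polyFun (p s))) (T.point P a)) := by
    simp only [mul_sub, Finset.sum_sub_distrib]
    rw [hrow]
    ring
  rw [e2, e3]
  refine (abs_sub _ _).trans (add_le_add ?_ ?_)
  · refine abs_sum_le_card (by positivity) (by exact_mod_cast card_stencil_le a) fun b hb => ?_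
    rw [abs_mul]
    refine mul_le_mul (hα b hb) ((hC _ _ hXr _ (hrect b hb)).1.trans ?_) (abs_nonneg _) hA
    gcongr
    exact hd b hb
  · rw [abs_mul, abs_of_pos (hP.κ_pos s)]
    refine mul_le_mul (hk s) ((hC s _ hXr _ har).2.2.trans ?_) (abs_nonneg _)
      ((hP.κ_pos s).le.trans (hk s))
    rw [pow_one]
    gcongr

/-- Truncation error at a boundary point. -/
theorem BoundaryRow.residual_le (hT : T.Fits P) {u : Phase → Plane → ℝ} (hu : P.IsSolution u)
    {U : Node → ℝ} (hU : S.Solves P T U) {a : Node} (ha : HasRow P T a)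
    (hi : ¬ T.Interior a) {K : ℝ} (h : S.BoundaryRow P T K a)
    (hph : ∀ b ∈ T.stencil P a, P.phase (T.point P b) = P.phase (T.point P a))
    {C : ℝ} (hC0 : 0 ≤ C)
    (hC : ∀ s, ∀ a ∈ P.rect, ∀ x ∈ P.rect,
      |u s x - polyFun (taylorPoly 4 (u s) a) x| ≤ C * ‖x - a‖ ^ 4 ∧
      (∀ i, |pd i (u s) x - pd i (polyFun (taylorPoly 4 (u s) a)) x|
        ≤ C * ‖x - a‖ ^ 3) ∧
      |(Δ (u s)) x - (Δ (polyFun (taylorPoly 4 (u s) a))) x| ≤ C * ‖x - a‖ ^ 2)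
    {A B k M : ℝ} (hA : 0 ≤ A) (hB : 0 ≤ B) (hk : ∀ s, P.κ s ≤ k) (hk0 : ∀ s, 0 < P.κ s)
    (hK : 0 ≤ K) (hM0 : 0 ≤ M) (hM : ∀ s, ∀ x ∈ P.side s, |P.σ s x| ≤ M)
    (hα : ∀ b ∈ T.stencil P a, |S.α a b| ≤ A) (hβ : ∀ b ∈ T.stencil P a, |S.β a b| ≤ B) :
    |∑ b ∈ T.stencil P a, S.α a b * (nodal P T u b - U b)|
      ≤ 25 * (A * (C * (4 * T.h) ^ 4)) + 25 * (B * (k * (C * (4 * T.h) ^ 2)))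
        + 100 * (K / T.h * (2 * (C * (4 * T.h) ^ 3) + M * (C * (4 * T.h) ^ 4))) := by
  classical
  have hh := hT.h_pos
  have hB0 : 0 ≤ K / T.h * (2 * (C * (4 * T.h) ^ 3) + M * (C * (4 * T.h) ^ 4)) := by positivity
  have hKh : 0 ≤ K / T.h := by positivity
  obtain ⟨-, γ, hγ, hcorr, hrow⟩ := h
  set s := P.phase (T.point P a) with hs
  set p := taylorPoly 4 (u s) (T.point P a) with hp
  have hrow := hrow p (totalDegree_taylorPoly_le 4 _ _)
  have hst := stencil_of_not_interior (P := P) hi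
  have hrect : ∀ b ∈ T.stencil P a, T.point P b ∈ P.rect := fun b hb =>
    (hT.point_mem_rect_iff b).mpr (isNode_of_mem_stencil hT ha.1 ha.2.2 hb).1
  have har : T.point P a ∈ P.rect := (hT.point_mem_rect_iff a).mpr ha.1.1
  have hd : ∀ b ∈ T.stencil P a, ‖T.point P b - T.point P a‖ ≤ 4 * T.h := fun b hb =>
    norm_le_of_mem_stencil hT hb
  have hk1 : 0 ≤ k := (hk0 s).le.trans (hk s)
  rw [hU.residual_eq ha]
  have e1 : ∑ b ∈ T.stencil P a, S.α a b * nodal P T u b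
      = ∑ b ∈ T.stencil P a, S.α a b * u s (T.point P b) :=
    Finset.sum_congr rfl fun b hb => by rw [nodal, hph b hb]
  have e2 : ∑ b ∈ T.stencil P a, S.β a b * P.f (P.phase (T.point P b)) (T.point P b)
      = ∑ b ∈ T.stencil P a, S.β a b * (P.κ s * (Δ (u s)) (T.point P b)) :=
    Finset.sum_congr rfl fun b hb => by
      have := hu.pde _ _ (mem_region_phase (hrect b hb))
      rw [hph b hb] at this ⊢
      rw [this]
  have hdata : ∀ x ∈ dataPoints P T a, x.2 ∈ T.stencil P a ∧ T.point P x.2 ∈ P.side x.1 ∧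
      T.point P x.2 ∉ P.D := fun x hx => by
    rw [dataPoints, Finset.mem_filter, Finset.mem_product] at hx
    rw [hst]
    exact ⟨hx.1.2, hx.2.2⟩
  have e3 : S.corr a = ∑ x ∈ dataPoints P T a, γ x * (fderiv ℝ (u s) (T.point P x.2) x.1.normal
      + P.σ x.1 (T.point P x.2) * u s (T.point P x.2)) := by
    rw [hcorr]
    refine Finset.sum_congr rfl fun x hx => ?_
    obtain ⟨h1, h2, h3⟩ := hdata x hx
    have := hu.robin _ _ h2 h3
    rw [hph _ h1] at this
    rw [← this]
  rw [← hst] at hrow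
  have e4 : ∑ b ∈ T.stencil P a, S.α a b * u s (T.point P b)
      - ∑ b ∈ T.stencil P a, S.β a b * (P.κ s * (Δ (u s)) (T.point P b))
      - ∑ x ∈ dataPoints P T a, γ x * (fderiv ℝ (u s) (T.point P x.2) x.1.normal
          + P.σ x.1 (T.point P x.2) * u s (T.point P x.2))
      = ∑ b ∈ T.stencil P a, S.α a b * (u s (T.point P b) - polyFun p (T.point P b))
        - ∑ b ∈ T.stencil P a, S.β a b *
          (P.κ s * ((Δ (u s)) (T.point P b) - (Δ (polyFun p)) (T.point P b)))
        - ∑ x ∈ dataPoints P T a, γ x *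
          ((fderiv ℝ (u s) (T.point P x.2) x.1.normal
              - fderiv ℝ (polyFun p) (T.point P x.2) x.1.normal)
            + P.σ x.1 (T.point P x.2) * (u s (T.point P x.2) - polyFun p (T.point P x.2))) := by
    simp only [mul_sub, mul_add, Finset.sum_sub_distrib, Finset.sum_add_distrib] at hrow ⊢
    rw [hrow]
    ring
  rw [e1, e2, e3, e4]
  have hpow : ∀ (b : Node) (m : ℕ), b ∈ T.stencil P a →
      C * ‖T.point P b - T.point P a‖ ^ m ≤ C * (4 * T.h) ^ m := fun b m hb => by
    have := hd b hb
    gcongr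
  refine (abs_sub _ _).trans (add_le_add ((abs_sub _ _).trans (add_le_add ?_ ?_)) ?_)
  · refine abs_sum_le_card (by positivity) (by exact_mod_cast card_stencil_le a) fun b hb => ?_
    rw [abs_mul]
    exact mul_le_mul (hα b hb) ((hC s _ har _ (hrect b hb)).1.trans (hpow b _ hb))
      (abs_nonneg _) hA
  · refine abs_sum_le_card (by positivity) (by exact_mod_cast card_stencil_le a) fun b hb => ?_
    rw [abs_mul, abs_mul, abs_of_pos (hk0 s)]
    exact mul_le_mul (hβ b hb) (mul_le_mul (hk s) ((hC s _ har _ (hrect b hb)).2.2.trans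
      (hpow b _ hb)) (abs_nonneg _) hk1) (mul_nonneg (hk0 s).le (abs_nonneg _)) hB
  · refine abs_sum_le_card hB0 (by exact_mod_cast card_dataPoints_le a) fun x hx => ?_
    obtain ⟨h1, h2, h3⟩ := hdata x hx
    have hb := hC s _ har _ (hrect _ h1)
    rw [abs_mul]
    refine mul_le_mul (hγ x) ((abs_add_le _ _).trans (add_le_add ?_ ?_)) (abs_nonneg _)
      hKh
    · have hn : ∀ i, |x.1.normal i| ≤ 1 := fun i => by
        refine (abs_coord_le _ i).trans ?_
        rw [Side.normal, PiLp.norm_single]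
        split_ifs <;> simp
      rw [fderiv_apply_eq_sum_pd, fderiv_apply_eq_sum_pd, ← Finset.sum_sub_distrib,
        Fin.sum_univ_two]
      have hi : ∀ i, |x.1.normal i * pd i (u s) (T.point P x.2)
          - x.1.normal i * pd i (polyFun p) (T.point P x.2)| ≤ C * (4 * T.h) ^ 3 := fun i => by
        rw [← mul_sub, abs_mul]
        calc _ ≤ 1 * (C * (4 * T.h) ^ 3) := mul_le_mul (hn i)
              ((hb.2.1 i).trans (hpow _ _ h1)) (abs_nonneg _) zero_le_one
          _ = _ := one_mul _
      exact (abs_add_le _ _).trans (by linarith [hi 0, hi 1])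
    · rw [abs_mul]
      exact mul_le_mul (hM _ _ h2) (hb.1.trans (hpow _ _ h1)) (abs_nonneg _) hM0

theorem exists_bound_σ (hP : P.Admissible) :
    ∃ M, 0 ≤ M ∧ ∀ s, ∀ x ∈ P.side s, |P.σ s x| ≤ M := by
  choose M hM using fun s => (P.isCompact_side s).exists_bound_of_continuousOn (hP.σ_continuous s)
  refine ⟨∑ s, |M s|, Finset.sum_nonneg fun s _ => abs_nonneg _, fun s x hx => ?_⟩
  refine (hM s x hx).trans ((le_abs_self _).trans ?_)
  exact Finset.single_le_sum (f := fun s => |M s|) (fun s _ => abs_nonneg _) (Finset.mem_univ s)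

/-- Consistency: the truncation error is `O(h³ + (h / r)²)` relative to the weight. -/
theorem exists_residual_le (hP : P.Admissible) {u : Phase → Plane → ℝ} (hu : P.IsSolution u)
    (K : ℝ) : ∃ C h₀ : ℝ, 0 ≤ C ∧ 0 < h₀ ∧ ∀ T : Grid, T.Fits P → T.h ≤ h₀ → T.Resolves P →
      ∀ S : Scheme, S.IsTwoGrid P T K → S.CoeffBound P T K → ∀ U, S.Solves P T U →
      ∀ a, HasRow P T a → |∑ b ∈ T.stencil P a, S.α a b * (nodal P T u b - U b)|
        ≤ C * (T.h ^ 3 + T.fineStep ^ 2) * T.weight P a := by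
  classical
  have hc : ∀ n : ℕ, n + 2 ≤ 6 → ∃ C, 0 ≤ C ∧ ∀ s, ∀ a ∈ P.rect, ∀ x ∈ P.rect,
      |u s x - polyFun (taylorPoly (n + 2) (u s) a) x| ≤ C * ‖x - a‖ ^ (n + 2) ∧
      (∀ i, |pd i (u s) x - pd i (polyFun (taylorPoly (n + 2) (u s) a)) x|
        ≤ C * ‖x - a‖ ^ (n + 1)) ∧
      |(Δ (u s)) x - (Δ (polyFun (taylorPoly (n + 2) (u s) a))) x| ≤ C * ‖x - a‖ ^ n := by
    intro n hn
    choose C hC0 hC using fun s => exists_taylor_bounds P.isCompact_rect P.convex_rect n (u s)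
      ((hu.smooth s).of_le (by exact_mod_cast hn))
    have hle : ∀ s, C s ≤ C Phase.minus + C Phase.plus := fun s => by
      cases s
      · linarith [hC0 Phase.plus]
      · linarith [hC0 Phase.minus]
    refine ⟨C Phase.minus + C Phase.plus, add_nonneg (hC0 _) (hC0 _), fun s a ha x hx => ?_⟩
    obtain ⟨h1, h2, h3⟩ := hC s a ha x hx
    have hm : ∀ m : ℕ, C s * ‖x - a‖ ^ m ≤ (C Phase.minus + C Phase.plus) * ‖x - a‖ ^ m :=
      fun m => mul_le_mul_of_nonneg_right (hle s) (by positivity)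
    exact ⟨h1.trans (hm _), fun i => (h2 i).trans (hm _), h3.trans (hm _)⟩
  obtain ⟨C₁, hC₁0, hC₁⟩ := hc 1 (by norm_num)
  obtain ⟨C₂, hC₂0, hC₂⟩ := hc 2 (by norm_num)
  obtain ⟨C₄, hC₄0, hC₄⟩ := hc 4 (by norm_num)
  obtain ⟨M, hM0, hM⟩ := exists_bound_σ hP
  obtain ⟨d, hd0, hd⟩ := hP.exists_margin
  obtain ⟨k, hk0, hk⟩ : ∃ k, 0 ≤ k ∧ ∀ s, P.κ s ≤ k :=
    ⟨P.κ Phase.minus + P.κ Phase.plus, add_nonneg (hP.κ_pos _).le (hP.κ_pos _).le, fun s => by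
      cases s
      · linarith [hP.κ_pos Phase.plus]
      · linarith [hP.κ_pos Phase.minus]⟩
  rcases lt_or_ge K 0 with hK | hK
  · refine ⟨0, 1, le_rfl, one_pos, fun T hT _ _ S _ hcb U _ a ha => ?_⟩
    have := (hcb a ha a (self_mem_stencil ha.1)).2
    linarith [abs_nonneg (S.β a a)]
  set Cc := 25 * (K * (C₄ * 4 ^ 6)) + 25 * (K * (k * (C₄ * 4 ^ 4))) with hCc
  set Ch := 25 * (K * (C₂ * 4 ^ 4)) + 25 * (K * (k * (C₂ * 4 ^ 2))) with hCh
  set Ci := 25 * (K * (C₁ * 3 ^ 3)) + k * C₁ with hCi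
  set Cb := Ch + 100 * (K * (2 * (C₂ * 4 ^ 3) + M * (C₂ * 4 ^ 4))) with hCb
  have hCc0 : 0 ≤ Cc := by positivity
  have hCh0 : 0 ≤ Ch := by positivity
  have hCi0 : 0 ≤ Ci := by positivity
  have hCb0 : 0 ≤ Cb := by positivity
  refine ⟨Cc + Ch + Ci + Cb, min 1 (d / 8), by positivity, by positivity, ?_⟩
  intro T hT hh hres S hS hcb U hU a ha
  have hh1 : T.h ≤ 1 := hh.trans (min_le_left _ _)
  have hhd : T.h ≤ d / 8 := hh.trans (min_le_right _ _)
  have hpos := hT.h_pos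
  have hfpos := hT.fineStep_pos
  have hα := fun b hb => (hcb a ha b hb).1
  have hβ := fun b hb => (hcb a ha b hb).2
  have hd4 : ∀ b ∈ T.stencil P a, ‖T.point P b - T.point P a‖ ≤ 4 * T.h := fun b hb =>
    norm_le_of_mem_stencil hT hb
  have hE0 : 0 ≤ T.h ^ 3 + T.fineStep ^ 2 := by positivity
  -- each kind of row: a bound `Cx * x` with `x ≤ (h ^ 3 + fineStep ^ 2) * weight`
  have fin : ∀ {r Cx x : ℝ}, r ≤ Cx * x → Cx ≤ Cc + Ch + Ci + Cb → 0 ≤ x →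
      x ≤ (T.h ^ 3 + T.fineStep ^ 2) * T.weight P a →
      r ≤ (Cc + Ch + Ci + Cb) * (T.h ^ 3 + T.fineStep ^ 2) * T.weight P a := by
    intro r Cx x h1 h2 h3 h4
    calc r ≤ Cx * x := h1
      _ ≤ (Cc + Ch + Ci + Cb) * x := mul_le_mul_of_nonneg_right h2 h3
      _ ≤ (Cc + Ch + Ci + Cb) * ((T.h ^ 3 + T.fineStep ^ 2) * T.weight P a) :=
        mul_le_mul_of_nonneg_left h4 (by positivity)
      _ = _ := by ring
  by_cases hi : T.Interior a
  · by_cases hf : T.FineInterior P a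
    · simp only [localStep, hf, if_true] at hα
      by_cases hreg : T.Regular P a
      · have hw : T.weight P a = 1 := by simp [weight, hf, hreg]
        have hd2 : ∀ b ∈ T.stencil P a, ‖T.point P b - T.point P a‖ ≤ 4 * T.fineStep :=
          fun b hb => by
            rw [stencil_of_fineInterior hf] at hb
            linarith [norm_le_of_mem_nine_one hT hb]
        have := (exactRow_fine hT hf hreg (hS.fine a hf hreg)).residual_le (n := 2) hT hu hU ha hC₂0
          hC₂ (by positivity) hK hk hP.κ_pos hd2 hα hβ
        refine fin (Cx := Ch) (x := T.fineStep ^ 2) (this.trans (le_of_eq ?_)) (by linarith)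
          (by positivity) (by rw [hw]; nlinarith [pow_pos hpos 3])
        rw [hCh]
        simp only [Nat.reduceAdd]
        field_simp
        try ring
      · have hw : T.weight P a = 1 / T.fineStep := by simp [weight, hf, hreg]
        have := (hS.immersed a hf hreg).residual_le hP hT hu hU ha hf hreg hC₁0
          hC₁ (by positivity) hk hα
        refine fin (Cx := Ci) (x := T.fineStep) (this.trans (le_of_eq ?_)) (by linarith)
          (by positivity) ?_
        · rw [hCi]
          field_simp
        · rw [hw, mul_one_div, le_div_iff₀ hfpos]
          nlinarith [pow_pos hpos 3]
    · simp only [localStep, hf, if_false] at hα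
      by_cases hv : T.IsVertex a
      · have hw : T.weight P a = 1 := by simp [weight, hf, hi, hv]
        have := (exactRow_coarse hT ha.1 hi hf hv hres
          (hS.coarse a ha.1 hi hf hv)).residual_le (n := 4) hT hu hU ha hC₄0
          hC₄ (by positivity) hK hk hP.κ_pos hd4 hα hβ
        refine fin (Cx := Cc) (x := T.h ^ 4) (this.trans (le_of_eq ?_)) (by linarith)
          (by positivity) ?_
        · rw [hCc]
          simp only [Nat.reduceAdd]
          field_simp
          try ring
        · rw [hw, mul_one]
          nlinarith [pow_pos hpos 3, sq_nonneg T.fineStep]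
      · have hw : T.weight P a = 1 / T.h := by simp [weight, hf, hv]
        have hH : T.Hanging P a := ⟨ha.1, hi, hf, hv⟩
        have := (exactRow_hanging hres hH (hS.hanging a hH)).residual_le (n := 2) hT hu hU ha hC₂0
          hC₂ (by positivity) hK hk hP.κ_pos hd4 hα hβ
        refine fin (Cx := Ch) (x := T.h ^ 2) (this.trans (le_of_eq ?_)) (by linarith)
          (by positivity) ?_
        · rw [hCh]
          simp only [Nat.reduceAdd]
          field_simp
          try ring
        · rw [hw, mul_one_div, le_div_iff₀ hpos]
          nlinarith [pow_pos hpos 3, sq_nonneg T.fineStep]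
  · have hf : ¬ T.FineInterior P a := fun h => hi h.1
    simp only [localStep, hf, if_false] at hα
    have hw : T.weight P a = 1 / T.h := by simp [weight, hf, hi]
    have har : T.point P a ∈ P.rect := (hT.point_mem_rect_iff a).mpr ha.1.1
    have hph : ∀ b ∈ T.stencil P a, P.phase (T.point P b) = P.phase (T.point P a) := by
      intro b hb
      have hbr : T.point P b ∈ P.rect :=
        (hT.point_mem_rect_iff b).mpr (isNode_of_mem_stencil hT ha.1 ha.2.2 hb).1
      refine (hP.phase_eq_of_dist_lt har hbr ?_).symm
      have h1 : d ≤ Metric.infDist (T.point P a) P.interface := by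
        by_contra hlt
        exact hi ((hT.point_mem_openRect_iff a).mp (hd _ (not_le.mp hlt)))
      rw [dist_comm, dist_eq_norm]
      linarith [hd4 b hb]
    have := (hS.boundary a ha hi).residual_le hT hu hU ha hi hph hC₂0
      hC₂ (by positivity) hK hk hP.κ_pos hK hM0 hM hα hβ
    refine fin (Cx := Cb) (x := T.h ^ 2) (this.trans ?_) (by linarith)
      (by positivity) ?_
    · have e : 25 * (K / T.h ^ 2 * (C₂ * (4 * T.h) ^ 4)) + 25 * (K * (k * (C₂ * (4 * T.h) ^ 2)))
        + 100 * (K / T.h * (2 * (C₂ * (4 * T.h) ^ 3) + M * (C₂ * (4 * T.h) ^ 4)))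
        = (Ch + 100 * (K * (2 * (C₂ * 4 ^ 3) + M * (C₂ * 4 ^ 4) * T.h))) * T.h ^ 2 := by
        rw [hCh]
        field_simp
      rw [e, hCb]
      have : M * (C₂ * 4 ^ 4) * T.h ≤ M * (C₂ * 4 ^ 4) :=
        mul_le_of_le_one_right (by positivity) hh1
      gcongr
    · rw [hw, mul_one_div, le_div_iff₀ hpos]
      nlinarith [pow_pos hpos 3, sq_nonneg T.fineStep]

end Scheme

end TwoGrid

end

noncomputable section

namespace TwoGrid

open Grid InterfaceProblem

variable {P : InterfaceProblem} {lam K : ℝ}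

/-! ### Good points and the local maximum principle -/

/-- Normalized discrete subsolutions up to `δ`: grid functions `e ≤ 1` on a grid of mesh size at
most `δ` with `e ≤ 0` at the Dirichlet points and `∑ α e ≥ -δ · weight` in every row. -/
structure IsSubsolution (P : InterfaceProblem) (lam K δ : ℝ) (T : Grid) (S : Scheme)
    (e : Node → ℝ) : Prop where
  fits : T.Fits P
  lam_eq : T.lam = lam
  h_le : T.h ≤ δ
  resolves : T.Resolves P
  scheme : S.IsTwoGrid P T K
  sign : S.SignProperty P T
  coeff : S.CoeffBound P T K
  le_one : ∀ a, T.IsNode P a → e a ≤ 1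
  dirichlet : ∀ a, T.IsNode P a → T.point P a ∈ P.D → e a ≤ 0
  row : ∀ a, Scheme.HasRow P T a → -δ * T.weight P a ≤ ∑ b ∈ T.stencil P a, S.α a b * e b

/-- A point near which subsolutions with small `δ` stay away from their maximal value `1`. -/
def Good (P : InterfaceProblem) (lam K : ℝ) (x : Plane) : Prop :=
  ∃ δ > 0, ∀ T S e, IsSubsolution P lam K δ T S e → ∀ a, T.IsNode P a →
    dist (T.point P a) x < δ → e a ≤ 1 - δ

theorem Grid.weight_pos {T : Grid} (hT : T.Fits P) (a : Node) : 0 < T.weight P a := by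
  unfold Grid.weight
  have := hT.h_pos
  have := hT.fineStep_pos
  split_ifs <;> positivity

theorem IsSubsolution.mono {δ δ' : ℝ} {T : Grid} {S : Scheme} {e : Node → ℝ}
    (h : IsSubsolution P lam K δ T S e) (hδ : δ ≤ δ') : IsSubsolution P lam K δ' T S e where
  fits := h.fits
  lam_eq := h.lam_eq
  h_le := h.h_le.trans hδ
  resolves := h.resolves
  scheme := h.scheme
  sign := h.sign
  coeff := h.coeff
  le_one := h.le_one
  dirichlet := h.dirichlet
  row a ha := (mul_le_mul_of_nonneg_right (neg_le_neg hδ)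
    (Grid.weight_pos h.fits a).le).trans (h.row a ha)

theorem isOpen_good : IsOpen {x | Good P lam K x} := by
  rw [Metric.isOpen_iff]
  rintro x ⟨δ, hδ, h⟩
  refine ⟨δ / 2, by positivity, fun y hy => ⟨δ / 2, by positivity, fun T S e he a ha hd => ?_⟩⟩
  have := h T S e (he.mono (by linarith)) a ha
    ((dist_triangle _ y _).trans_lt (by rw [Metric.mem_ball] at hy; linarith))
  linarith

/-- On a compact set of good points the constant `δ` can be chosen uniformly. -/
theorem exists_uniform_good {A : Set Plane} (hA : IsCompact A) (h : ∀ x ∈ A, Good P lam K x) :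
    ∃ δ > 0, ∀ T S e, IsSubsolution P lam K δ T S e → ∀ a, T.IsNode P a →
      T.point P a ∈ A → e a ≤ 1 - δ := by
  refine hA.induction_on (p := fun A => ∃ δ > 0, ∀ T S e, IsSubsolution P lam K δ T S e →
    ∀ a, T.IsNode P a → T.point P a ∈ A → e a ≤ 1 - δ) ?_ ?_ ?_ ?_
  · exact ⟨1, one_pos, fun T S e _ a _ ha => absurd ha (Set.notMem_empty _)⟩
  · rintro s t hst ⟨δ, hδ, h⟩
    exact ⟨δ, hδ, fun T S e he a ha has => h T S e he a ha (hst has)⟩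
  · rintro s t ⟨δ, hδ, h⟩ ⟨δ', hδ', h'⟩
    refine ⟨min δ δ', lt_min hδ hδ', fun T S e he a ha has => ?_⟩
    rcases has with has | has
    · have := h T S e (he.mono (min_le_left _ _)) a ha has
      linarith [min_le_left δ δ']
    · have := h' T S e (he.mono (min_le_right _ _)) a ha has
      linarith [min_le_right δ δ']
  · intro x hx
    obtain ⟨δ, hδ, h⟩ := h x hx
    exact ⟨Metric.ball x δ, mem_nhdsWithin_of_mem_nhds (Metric.ball_mem_nhds x hδ), δ, hδ,
      fun T S e he a ha has => h T S e he a ha has⟩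

/-- Local maximum principle: `x` is good if there is a family of local strict subsolutions `Λ`,
vanishing at `x`, that on a ring around `x` are negative away from known good points.  At the
maximum of `e + ε Λ` the row of the scheme gives a contradiction. -/
theorem good_of_test (hP : P.Admissible) (hlam : 0 < lam) {x : Plane} {r c B : ℝ} (hr : 0 < r)
    (hc : 0 < c) (hB : 0 ≤ B) {A : Set Plane} (hA : IsCompact A) (hAg : ∀ y ∈ A, Good P lam K y)
    (Λ : Grid → Node → ℝ)
    (hΛ : ∀ T : Grid, T.Fits P → ∀ a, T.IsNode P a → dist (T.point P a) x ≤ r →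
      |Λ T a| ≤ B * dist (T.point P a) x)
    (hring : ∀ T : Grid, T.Fits P → ∀ a, T.IsNode P a → r / 2 ≤ dist (T.point P a) x →
      dist (T.point P a) x ≤ r → Λ T a ≤ -c ∨ T.point P a ∈ A)
    (hrow : ∃ ε₀ > 0, ∀ ε, 0 < ε → ε ≤ ε₀ → ∃ δ > 0, ∀ T S e, IsSubsolution P lam K δ T S e →
      ∀ a, Scheme.HasRow P T a → dist (T.point P a) x < r / 2 → ∀ μ, 1 / 2 ≤ μ → μ ≤ 1 →
      μ * ∑ b ∈ T.stencil P a, S.α a b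
        - ε * ∑ b ∈ T.stencil P a, S.α a b * (Λ T b - Λ T a) < -δ * T.weight P a) :
    Good P lam K x := by
  obtain ⟨δ₁, hδ₁, h1⟩ := exists_uniform_good hA hAg
  obtain ⟨ε₀, hε₀, hrow⟩ := hrow
  obtain ⟨h₀, hh₀, hnode⟩ := exists_hasRow hP hlam
  set ε := min ε₀ (min (δ₁ / 4) (1 / 8) / (B * r + 1)) with hε
  have hBr : 0 < B * r + 1 := by positivity
  have hε0 : 0 < ε := by positivity
  have hεB : ε * (B * r) ≤ min (δ₁ / 4) (1 / 8) := by
    have : ε * (B * r + 1) ≤ min (δ₁ / 4) (1 / 8) := by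
      rw [← le_div_iff₀ hBr]; exact min_le_right _ _
    nlinarith
  have hεB1 := hεB.trans (min_le_left _ _)
  have hεB2 := hεB.trans (min_le_right _ _)
  obtain ⟨δ₂, hδ₂, hrow⟩ := hrow ε hε0 (min_le_left _ _)
  set m := min (min (δ₁ / 4) (ε * c / 4)) (1 / 8) with hm
  have hm0 : 0 < m := by positivity
  have hm1 : m ≤ δ₁ / 4 := (min_le_left _ _).trans (min_le_left _ _)
  have hm2 : m ≤ ε * c / 4 := (min_le_left _ _).trans (min_le_right _ _)
  have hm3 : m ≤ 1 / 8 := min_le_right _ _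
  have hεc : 0 < ε * c := by positivity
  have hεB0 : 0 < 1 + ε * B := by positivity
  set δ := min (min δ₂ (min (r / 8) h₀)) (m / (1 + ε * B)) with hδ
  have hδ0 : 0 < δ := by positivity
  have hδδ₂ : δ ≤ δ₂ := (min_le_left _ _).trans (min_le_left _ _)
  have hδr : δ ≤ r / 8 := (min_le_left _ _).trans ((min_le_right _ _).trans (min_le_left _ _))
  have hδh : δ ≤ h₀ := (min_le_left _ _).trans ((min_le_right _ _).trans (min_le_right _ _))
  have hδm : δ * (1 + ε * B) ≤ m := by rw [← le_div_iff₀ hεB0]; exact min_le_right _ _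
  have hδm' : δ ≤ m := by nlinarith [mul_nonneg hδ0.le (mul_nonneg hε0.le hB)]
  refine ⟨δ, hδ0, fun T S e he a₀ ha₀ hd₀ => ?_⟩
  by_contra hcon
  push Not at hcon
  have hT := he.fits
  -- the maximum of `e + ε Λ` over the grid points in the ball
  have hfin : {a | T.IsNode P a ∧ dist (T.point P a) x ≤ r}.Finite :=
    finite_inRange.subset fun a ha => ha.1.1
  obtain ⟨a, ⟨han, har⟩, hmax⟩ := Set.exists_max_image _ (fun a => e a + ε * Λ T a) hfin
    ⟨a₀, ha₀, by linarith⟩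
  have hΛa := abs_le.mp (hΛ T hT a han har)
  have hΛa₀ := abs_le.mp (hΛ T hT a₀ ha₀ (by linarith))
  have hV : 1 - m < e a + ε * Λ T a := by
    have h2 := hmax a₀ ⟨ha₀, by linarith⟩
    have h3 : B * dist (T.point P a₀) x ≤ B * δ := mul_le_mul_of_nonneg_left hd₀.le hB
    have h4 : -(ε * (B * δ)) ≤ ε * Λ T a₀ := by
      rw [← mul_neg]; exact mul_le_mul_of_nonneg_left (by linarith) hε0.le
    nlinarith
  have hΛr : ε * Λ T a ≤ ε * (B * r) :=
    mul_le_mul_of_nonneg_left (hΛa.2.trans (mul_le_mul_of_nonneg_left har hB)) hε0.le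
  have he1 := he.le_one a han
  -- on the ring, where `Λ ≤ -c` or `e ≤ 1 - δ₁`, the value `e + ε Λ > 1 - m` is not attained
  rcases le_or_gt (r / 2) (dist (T.point P a) x) with hfar | hnear
  · rcases hring T hT a han hfar har with h | h
    · have : ε * Λ T a ≤ ε * -c := mul_le_mul_of_nonneg_left h hε0.le
      linarith
    · have := h1 T S e (he.mono (by linarith)) a han h
      linarith
  · have hD : T.point P a ∉ P.D := fun h => by
      have := he.dirichlet a han h
      linarith
    have ha := hnode T hT he.lam_eq (he.h_le.trans hδh) a han hD
    -- off the ring the stencil of `a` lies in the ball, so that `e b ≤ e a - ε (Λ b - Λ a)` there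
    have key := hrow T S e (he.mono hδδ₂) a ha hnear (e a) (by linarith) he1
    have hle : ∑ b ∈ T.stencil P a, S.α a b * e b ≤ e a * ∑ b ∈ T.stencil P a, S.α a b
        - ε * ∑ b ∈ T.stencil P a, S.α a b * (Λ T b - Λ T a) := by
      rw [Finset.mul_sum, Finset.mul_sum, ← Finset.sum_sub_distrib]
      refine Finset.sum_le_sum fun b hb => ?_
      by_cases hba : b = a
      · subst hba
        linarith [mul_comm (S.α b b) (e b)]
      · have hα := (he.sign a ha).2 b hb hba
        have hbn := isNode_of_mem_stencil hT han ha.2.2 hb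
        have hbd : dist (T.point P b) x ≤ r := by
          have h5 := norm_le_of_mem_stencil hT hb
          rw [← dist_eq_norm] at h5
          have := dist_triangle (T.point P b) (T.point P a) x
          linarith [he.h_le]
        have h6 : e b + ε * Λ T b ≤ e a + ε * Λ T a := hmax b ⟨hbn, hbd⟩
        have h7 : e b ≤ e a - ε * (Λ T b - Λ T a) := by linarith
        calc S.α a b * e b ≤ S.α a b * (e a - ε * (Λ T b - Λ T a)) :=
              mul_le_mul_of_nonneg_left h7 hα
          _ = _ := by ring
    have := he.row a ha
    have hw := Grid.weight_pos hT a
    nlinarith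

end TwoGrid

end

noncomputable section

namespace TwoGrid

open Grid InterfaceProblem

variable {P : InterfaceProblem} {T : Grid} {S : Scheme}

namespace Scheme

/-! ### Rows applied to functions with a quadratic Taylor bound -/

section ExactRow

variable {n : ℕ} {a : Node} {f : Node → ℝ} {g : Plane} {C : ℝ}

/-- A row with nonnegative off-diagonal coefficients, applied to a quantity of size `O(|v|²)`. -/
theorem abs_sum_le_of_sq {s : Finset Node} (hs : ∀ b ∈ s, b ≠ a → 0 ≤ S.α a b) {F : Node → ℝ}
    (hF : ∀ b ∈ s, |F b| ≤ C * ‖T.point P b - T.point P a‖ ^ 2) :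
    |∑ b ∈ s, S.α a b * F b|
      ≤ C * ∑ b ∈ s, S.α a b * ‖T.point P b - T.point P a‖ ^ 2 := by
  rw [Finset.mul_sum]
  refine (Finset.abs_sum_le_sum_abs _ _).trans (Finset.sum_le_sum fun b hb => ?_)
  by_cases hba : b = a
  · subst hba
    have := hF b hb
    simp only [sub_self, norm_zero, ne_eq, OfNat.ofNat_ne_zero, not_false_eq_true, zero_pow,
      mul_zero, abs_nonpos_iff] at this
    simp [this]
  · rw [abs_mul, abs_of_nonneg (hs b hb hba)]
    calc _ ≤ S.α a b * (C * ‖T.point P b - T.point P a‖ ^ 2) :=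
          mul_le_mul_of_nonneg_left (hF b hb) (hs b hb hba)
      _ = _ := by ring

variable (h : ExactRow P T S n a) (hn : 2 < n)
  (hs : ∀ b ∈ T.stencil P a, b ≠ a → 0 ≤ S.α a b)
  (hf : ∀ b ∈ T.stencil P a, |f b - f a - inner ℝ g (T.point P b - T.point P a)|
    ≤ C * ‖T.point P b - T.point P a‖ ^ 2)
include h hn hs hf

theorem ExactRow.abs_sum_sub_le : |∑ b ∈ T.stencil P a, S.α a b * (f b - f a)|
    ≤ 4 * P.κ (P.phase (T.point P a)) * C := by
  have h1 := abs_sum_le_of_sq hs hf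
  rw [h.sum_norm_sq hn] at h1
  simp only [mul_sub _ (f _ - f _), Finset.sum_sub_distrib, h.sum_inner hn, sub_zero] at h1
  linarith

/-- The energy density of `f`: a row applied to `(f - f a)²` is at least `κ |∇f|²`, up to an error of
the order of the square of the stencil diameter. -/
theorem ExactRow.le_sum_sub_sq {d : ℝ} (hP : P.Admissible)
    (hd : ∀ b ∈ T.stencil P a, ‖T.point P b - T.point P a‖ ≤ d) :
    P.κ (P.phase (T.point P a)) * (‖g‖ ^ 2 - 4 * C ^ 2 * d ^ 2)
      ≤ ∑ b ∈ T.stencil P a, S.α a b * (f b - f a) ^ 2 := by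
  have h2 := h.sum_two hn g
  have h3 := h.sum_norm_sq hn
  have hκ := hP.κ_pos (P.phase (T.point P a))
  have key : ∑ b ∈ T.stencil P a, (S.α a b * (inner ℝ g (T.point P b - T.point P a)) ^ 2 / 2
      - C ^ 2 * d ^ 2 * (S.α a b * ‖T.point P b - T.point P a‖ ^ 2))
      ≤ ∑ b ∈ T.stencil P a, S.α a b * (f b - f a) ^ 2 := by
    refine Finset.sum_le_sum fun b hb => ?_
    by_cases hba : b = a
    · subst hba; simp
    · have h4 := hf b hb
      have hα := hs b hb hba
      set v := T.point P b - T.point P a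
      have h5 : (f b - f a - inner ℝ g v) ^ 2 ≤ C ^ 2 * d ^ 2 * ‖v‖ ^ 2 := by
        calc (f b - f a - inner ℝ g v) ^ 2 ≤ (C * ‖v‖ ^ 2) ^ 2 := sq_le_sq' (abs_le.mp h4).1
              (abs_le.mp h4).2
          _ = C ^ 2 * ‖v‖ ^ 2 * ‖v‖ ^ 2 := by ring
          _ ≤ _ := by
            have := hd b hb
            gcongr
      have h6 : (inner ℝ g v) ^ 2 / 2 - C ^ 2 * d ^ 2 * ‖v‖ ^ 2 ≤ (f b - f a) ^ 2 := by
        nlinarith [sq_nonneg (inner ℝ g v - 2 * (f b - f a))]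
      calc _ = S.α a b * ((inner ℝ g v) ^ 2 / 2 - C ^ 2 * d ^ 2 * ‖v‖ ^ 2) := by ring
        _ ≤ _ := mul_le_mul_of_nonneg_left h6 hα
  rw [Finset.sum_sub_distrib, ← Finset.sum_div, h2, ← Finset.mul_sum, h3] at key
  linarith

theorem ExactRow.le_sum_sq_sub_sq {d : ℝ} (hP : P.Admissible)
    (hd : ∀ b ∈ T.stencil P a, ‖T.point P b - T.point P a‖ ≤ d) :
    P.κ (P.phase (T.point P a)) * (‖g‖ ^ 2 - 4 * C ^ 2 * d ^ 2 - 8 * C * |f a|)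
      ≤ ∑ b ∈ T.stencil P a, S.α a b * (f b ^ 2 - f a ^ 2) := by
  have h1 := h.abs_sum_sub_le hn hs hf
  have h2 := h.le_sum_sub_sq hn hs hf hP hd
  have e : ∑ b ∈ T.stencil P a, S.α a b * (f b ^ 2 - f a ^ 2)
      = 2 * f a * ∑ b ∈ T.stencil P a, S.α a b * (f b - f a)
        + ∑ b ∈ T.stencil P a, S.α a b * (f b - f a) ^ 2 := by
    rw [Finset.mul_sum, ← Finset.sum_add_distrib]
    exact Finset.sum_congr rfl fun b _ => by ring
  rw [e]
  have h3 : -(2 * |f a| * (4 * P.κ (P.phase (T.point P a)) * C))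
      ≤ 2 * f a * ∑ b ∈ T.stencil P a, S.α a b * (f b - f a) := by
    refine le_trans (neg_le_neg ?_) (neg_abs_le _)
    rw [abs_mul, abs_mul, abs_two]
    exact mul_le_mul_of_nonneg_left h1 (by positivity)
  linarith

/-- A row applied to a function of `f` with a subgradient of size at most `s₀`. -/
theorem ExactRow.le_sum_convex {F : Node → ℝ} {s s₀ : ℝ}
    (hs₀ : |s| ≤ s₀) (hF : ∀ b ∈ T.stencil P a, s * (f b - f a) ≤ F b - F a) :
    -(4 * P.κ (P.phase (T.point P a)) * C * s₀)
      ≤ ∑ b ∈ T.stencil P a, S.α a b * (F b - F a) := by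
  have h1 := h.abs_sum_sub_le hn hs hf
  have h2 : s * ∑ b ∈ T.stencil P a, S.α a b * (f b - f a)
      ≤ ∑ b ∈ T.stencil P a, S.α a b * (F b - F a) := by
    rw [Finset.mul_sum]
    refine Finset.sum_le_sum fun b hb => ?_
    by_cases hba : b = a
    · subst hba; simp
    · calc _ = S.α a b * (s * (f b - f a)) := by ring
        _ ≤ _ := mul_le_mul_of_nonneg_left (hF b hb) (hs b hb hba)
  refine le_trans (le_trans (neg_le_neg ?_) (neg_abs_le _)) h2
  rw [abs_mul, mul_comm]
  exact mul_le_mul h1 hs₀ (abs_nonneg _) ((abs_nonneg _).trans h1)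

end ExactRow

/-! ### Estimates for boundary rows -/

theorem normal_apply (s : Side) (i : Fin 2) :
    s.normal i = if i = s.1 then (if s.2 then 1 else -1) else 0 := by
  simp [Side.normal]

theorem norm_side_normal (s : Side) : ‖s.normal‖ = 1 := by
  rw [Side.normal, PiLp.norm_single]
  split_ifs <;> simp

theorem inner_side_normal (s : Side) (v : Plane) :
    inner ℝ s.normal v = (if s.2 then 1 else -1) * v s.1 := by
  rw [Side.normal, EuclideanSpace.inner_single_left]
  simp

theorem inner_side_normal_of_mem (s : Side) {x y : Plane} (hx : x ∈ P.side s) (hy : y ∈ P.side s) :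
    inner ℝ s.normal (y - x) = 0 := by
  rw [inner_side_normal, PiLp.sub_apply, hx.2, hy.2]
  simp

theorem inner_side_normal_nonpos (s : Side) {x y : Plane} (hx : x ∈ P.side s) (hy : y ∈ P.rect) :
    inner ℝ s.normal (y - x) ≤ 0 := by
  rw [inner_side_normal, PiLp.sub_apply, hx.2]
  have := hy s.1
  split_ifs <;> simp <;> linarith

theorem inner_side_normal_of_ne (hP : P.Admissible) {s s' : Side} (hss : s ≠ s') {x : Plane}
    (hx : x ∈ P.side s) (hx' : x ∈ P.side s') : inner ℝ s.normal s'.normal = 0 := by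
  rw [inner_side_normal, normal_apply]
  have : s.1 ≠ s'.1 := by
    intro h
    have h2 : s.2 ≠ s'.2 := fun h2 => hss (Prod.ext h h2)
    have e1 := hx.2
    have e2 := hx'.2
    rw [← h] at e2
    have := hP.lo_lt_hi s.1
    cases hs : s.2 <;> cases hs' : s'.2 <;> simp_all
  simp [this]

/-- What is needed about the row of a boundary point `a`: it acts as `∑ γ (∂ₙ + σ)` up to terms of
lower order, and the total weight of the data on each side through `a` is at most `-κ / (2 h)`, up
to `O(1)`. -/
structure BoundaryEstimate (P : InterfaceProblem) (T : Grid) (S : Scheme) (K C : ℝ) (a : Node)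
    (γ : Side × Node → ℝ) : Prop where
  γ_le : ∀ x, |γ x| ≤ K / T.h
  sum : ∑ b ∈ T.stencil P a, S.α a b
    = ∑ x ∈ dataPoints P T a, γ x * P.σ x.1 (T.point P x.2)
  sum_inner : ∀ g, |∑ b ∈ T.stencil P a, S.α a b * inner ℝ g (T.point P b - T.point P a)
    - ∑ x ∈ dataPoints P T a, γ x * inner ℝ g x.1.normal| ≤ C * ‖g‖
  sum_sq : ∑ b ∈ T.stencil P a, S.α a b * ‖T.point P b - T.point P a‖ ^ 2 ≤ C
  side : ∀ s, T.point P a ∈ P.side s →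
    ∑ x ∈ dataPoints P T a with x.1 = s, γ x
      ≤ -(P.κ (P.phase (T.point P a)) / (2 * T.h)) + C

theorem mem_dataPoints {a : Node} {x : Side × Node} : x ∈ dataPoints P T a ↔
    x.2 ∈ T.boundaryStencil a ∧ T.point P a ∈ P.side x.1 ∧ T.point P x.2 ∈ P.side x.1 ∧
      T.point P x.2 ∉ P.D := by
  classical
  simp [dataPoints]

set_option maxHeartbeats 1000000 in
/-- Estimates of boundary rows. The total weight `G` of the data on a side is found by comparing the
first two moments `m₁ = -G + O(1)` and `m₂ = 2 κ + O(h)` in the inward normal direction: as the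
stencil lies in the rectangle and within distance `4 h`, the sign property gives `m₂ ≤ 4 h m₁`. -/
theorem exists_boundaryEstimate (hP : P.Admissible) (K : ℝ) : ∃ C, 0 ≤ C ∧
    ∀ T : Grid, T.Fits P → T.h ≤ 1 → ∀ S : Scheme, S.SignProperty P T → ∀ a, HasRow P T a →
      ¬ T.Interior a → S.BoundaryRow P T K a → ∃ γ, BoundaryEstimate P T S K C a γ := by
  classical
  obtain ⟨M, hM0, hM⟩ := exists_bound_σ hP
  obtain ⟨k, hk0, hk⟩ : ∃ k, 0 ≤ k ∧ ∀ s, P.κ s ≤ k :=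
    ⟨P.κ Phase.minus + P.κ Phase.plus, add_nonneg (hP.κ_pos _).le (hP.κ_pos _).le, fun s => by
      cases s
      · linarith [hP.κ_pos Phase.plus]
      · linarith [hP.κ_pos Phase.minus]⟩
  refine ⟨800 * (|K| * M) + (4 * k + 2 * (100 * (|K| * (8 + 16 * M)))), by positivity, ?_⟩
  intro T hT hh1 S hS a ha hi hrow
  obtain ⟨hβ, γ, hγ, -, hex⟩ := hrow
  obtain ⟨e0, e1, e2⟩ := boundary_exact (K := K) hex hβ
  have hh := hT.h_pos
  have hst := stencil_of_not_interior (P := P) hi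
  rw [← hst] at e0 e1 e2
  have har : T.point P a ∈ P.rect := (hT.point_mem_rect_iff a).mpr ha.1.1
  have hrect : ∀ b ∈ T.stencil P a, T.point P b ∈ P.rect := fun b hb =>
    (hT.point_mem_rect_iff b).mpr (isNode_of_mem_stencil hT ha.1 ha.2.2 hb).1
  have hd : ∀ b ∈ T.stencil P a, ‖T.point P b - T.point P a‖ ≤ 4 * T.h := fun b hb =>
    norm_le_of_mem_stencil hT hb
  have hdata : ∀ x ∈ dataPoints P T a, x.2 ∈ T.stencil P a ∧ T.point P a ∈ P.side x.1 ∧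
      T.point P x.2 ∈ P.side x.1 := fun x hx => by
    rw [mem_dataPoints] at hx
    rw [hst]
    exact ⟨hx.1, hx.2.1, hx.2.2.1⟩
  have hcard : ((dataPoints P T a).card : ℝ) ≤ 100 := by exact_mod_cast card_dataPoints_le a
  have hγ' : ∀ x, |γ x| ≤ |K| / T.h := fun x => (hγ x).trans (by gcongr; exact le_abs_self K)
  have hin : ∀ (g : Plane) (x : Side × Node), x ∈ dataPoints P T a →
      |inner ℝ g (T.point P x.2 - T.point P a)| ≤ ‖g‖ * (4 * T.h) := fun g x hx =>
    (abs_real_inner_le_norm _ _).trans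
      (mul_le_mul_of_nonneg_left (hd _ (hdata x hx).1) (norm_nonneg _))
  have hS' := (hS a ha).2
  have hKM : 0 ≤ |K| * M := mul_nonneg (abs_nonneg K) hM0
  have hrest : 0 ≤ 4 * k + 2 * (100 * (|K| * (8 + 16 * M))) := by positivity
  have hC1 : 400 * (|K| * M) ≤ 800 * (|K| * M) + (4 * k + 2 * (100 * (|K| * (8 + 16 * M)))) := by
    linarith
  have hKh : 0 ≤ |K| / T.h := by positivity
  have hM4 : 0 ≤ M * (4 * T.h) ^ 2 := by positivity
  have hh4 : 0 ≤ 4 * T.h := by positivity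
  have hh2 : 0 ≤ 2 * (4 * T.h) := by positivity
  have hh8 : 0 ≤ 2 * (4 * T.h) * 1 + M * (4 * T.h) ^ 2 := by positivity
  -- the contribution of `σ` to first moments
  have hσ1 : ∀ g : Plane, |∑ x ∈ dataPoints P T a, γ x * (P.σ x.1 (T.point P x.2)
      * inner ℝ g (T.point P x.2 - T.point P a))| ≤ 400 * (|K| * M) * ‖g‖ := by
    intro g
    have := abs_sum_le_card (s := dataPoints P T a) (N := 100)
      (F := fun x => γ x * (P.σ x.1 (T.point P x.2)
      * inner ℝ g (T.point P x.2 - T.point P a))) (B := |K| / T.h * (M * (‖g‖ * (4 * T.h))))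
      (mul_nonneg hKh (mul_nonneg hM0 (mul_nonneg (norm_nonneg g) hh4))) hcard fun x hx => by
        rw [abs_mul, abs_mul]
        exact mul_le_mul (hγ' x) (mul_le_mul (hM _ _ (hdata x hx).2.2) (hin g x hx)
          (abs_nonneg _) hM0) (mul_nonneg (abs_nonneg _) (abs_nonneg _)) hKh
    refine this.trans (le_of_eq ?_)
    field_simp
    ring
  -- the contribution of `σ` to second moments
  have hσ2 : ∀ g : Plane, ‖g‖ = 1 → |∑ x ∈ dataPoints P T a, γ x * (P.σ x.1 (T.point P x.2)
      * inner ℝ g (T.point P x.2 - T.point P a) ^ 2)| ≤ 1600 * (|K| * M) * T.h := by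
    intro g hg
    have := abs_sum_le_card (s := dataPoints P T a) (N := 100)
      (F := fun x => γ x * (P.σ x.1 (T.point P x.2)
      * inner ℝ g (T.point P x.2 - T.point P a) ^ 2)) (B := |K| / T.h * (M * (4 * T.h) ^ 2))
      (mul_nonneg hKh hM4) hcard fun x hx => by
        rw [abs_mul, abs_mul, abs_pow]
        have h1 := hin g x hx
        rw [hg, one_mul] at h1
        exact mul_le_mul (hγ' x) (mul_le_mul (hM _ _ (hdata x hx).2.2)
          (pow_le_pow_left₀ (abs_nonneg _) h1 2) (pow_nonneg (abs_nonneg _) 2) hM0)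
          (mul_nonneg (abs_nonneg _) (pow_nonneg (abs_nonneg _) 2)) hKh
    refine this.trans (le_of_eq ?_)
    field_simp
    ring
  refine ⟨γ, hγ, e0, fun g => ?_, ?_, fun s hs => ?_⟩
  · have e := e1 g
    simp only [mul_add, Finset.sum_add_distrib] at e
    rw [e, add_sub_cancel_left]
    refine (hσ1 g).trans ?_
    exact mul_le_mul_of_nonneg_right hC1 (norm_nonneg g)
  · have h2 : ∀ i : Fin 2, ∑ b ∈ T.stencil P a, S.α a b * (T.point P b - T.point P a) i ^ 2
        ≤ 2 * k + 100 * (|K| * (8 + 16 * M)) := by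
      intro i
      have := e2 (EuclideanSpace.single i 1)
      have hg1 : ‖(EuclideanSpace.single i 1 : Plane)‖ = 1 := by simp
      have hb := abs_sum_le_card (s := dataPoints P T a) (N := 100)
        (F := fun x => γ x * (2 * inner ℝ (EuclideanSpace.single i 1 : Plane)
            (T.point P x.2 - T.point P a) * inner ℝ (EuclideanSpace.single i 1) x.1.normal
          + P.σ x.1 (T.point P x.2) * inner ℝ (EuclideanSpace.single i 1 : Plane)
            (T.point P x.2 - T.point P a) ^ 2))
        (B := |K| / T.h * (2 * (4 * T.h) * 1 + M * (4 * T.h) ^ 2)) (mul_nonneg hKh hh8) hcard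
        fun x hx => by
          rw [abs_mul]
          have h1 := hin (EuclideanSpace.single i 1) x hx
          rw [hg1, one_mul] at h1
          refine mul_le_mul (hγ' x) ((abs_add_le _ _).trans (add_le_add ?_ ?_)) (abs_nonneg _)
            hKh
          · rw [abs_mul, abs_mul, abs_two]
            refine mul_le_mul (mul_le_mul_of_nonneg_left h1 zero_le_two) ?_ (abs_nonneg _)
              hh2
            exact (abs_real_inner_le_norm _ _).trans (by rw [hg1, norm_side_normal, one_mul])
          · rw [abs_mul, abs_pow]
            exact mul_le_mul (hM _ _ (hdata x hx).2.2)
              (pow_le_pow_left₀ (abs_nonneg _) h1 2) (pow_nonneg (abs_nonneg _) 2) hM0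
      have hb := (le_abs_self _).trans hb
      have e : 100 * (|K| / T.h * (2 * (4 * T.h) * 1 + M * (4 * T.h) ^ 2))
          = 100 * (|K| * (8 + 16 * M * T.h)) := by field_simp; ring
      rw [e] at hb
      have h3 : 100 * (|K| * (8 + 16 * M * T.h)) ≤ 100 * (|K| * (8 + 16 * M)) := by
        have : 16 * M * T.h ≤ 16 * M := mul_le_of_le_one_right (by positivity) hh1
        gcongr
      rw [hg1] at this
      have e3 : ∑ b ∈ T.stencil P a, S.α a b * (T.point P b - T.point P a) i ^ 2
          = ∑ b ∈ T.stencil P a, S.α a b *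
            inner ℝ (EuclideanSpace.single i 1 : Plane) (T.point P b - T.point P a) ^ 2 :=
        Finset.sum_congr rfl fun b _ => by
          rw [EuclideanSpace.inner_single_left, map_one, one_mul]
      rw [e3, this]
      linarith [hk (P.phase (T.point P a))]
    have h0 := h2 0
    have h1 := h2 1
    simp only [norm_sq_eq, mul_add, Finset.sum_add_distrib]
    linarith
  · have hn1 : ‖-s.normal‖ = 1 := by rw [norm_neg, norm_side_normal]
    have h1 := e1 (-s.normal)
    have h2 := e2 (-s.normal)
    rw [hn1] at h2
    have hb1 := abs_le.mp (hσ1 (-s.normal))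
    have hb2 := abs_le.mp (hσ2 (-s.normal) hn1)
    rw [hn1] at hb1
    have hfirst : ∑ x ∈ dataPoints P T a, γ x * inner ℝ (-s.normal) x.1.normal
        = -∑ x ∈ dataPoints P T a with x.1 = s, γ x := by
      rw [Finset.sum_filter, ← Finset.sum_neg_distrib]
      refine Finset.sum_congr rfl fun x hx => ?_
      rw [inner_neg_left]
      by_cases hxs : x.1 = s
      · rw [hxs, real_inner_self_eq_norm_sq, norm_side_normal]
        simp
      · rw [inner_side_normal_of_ne hP (fun h => hxs h.symm) hs (hdata x hx).2.1]
        simp [hxs]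
    have hsecond : ∑ x ∈ dataPoints P T a, γ x * (2 * inner ℝ (-s.normal)
        (T.point P x.2 - T.point P a) * inner ℝ (-s.normal) x.1.normal) = 0 := by
      refine Finset.sum_eq_zero fun x hx => ?_
      simp only [inner_neg_left]
      by_cases hxs : x.1 = s
      · have := (hdata x hx).2.2
        rw [hxs] at this
        rw [inner_side_normal_of_mem s hs this]
        simp
      · rw [inner_side_normal_of_ne hP (fun h => hxs h.symm) hs (hdata x hx).2.1]
        simp
    simp only [mul_add, Finset.sum_add_distrib] at h1 h2
    rw [hfirst] at h1
    rw [hsecond] at h2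
    -- the stencil lies on one side of the boundary line through `a`
    have hcmp : ∑ b ∈ T.stencil P a, S.α a b * inner ℝ (-s.normal)
          (T.point P b - T.point P a) ^ 2
        ≤ 4 * T.h * ∑ b ∈ T.stencil P a, S.α a b * inner ℝ (-s.normal)
          (T.point P b - T.point P a) := by
      rw [Finset.mul_sum]
      refine Finset.sum_le_sum fun b hb => ?_
      by_cases hba : b = a
      · subst hba; simp
      · have h3 : 0 ≤ inner ℝ (-s.normal) (T.point P b - T.point P a) := by
          rw [inner_neg_left]
          linarith [inner_side_normal_nonpos s hs (hrect b hb)]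
        have h4 : inner ℝ (-s.normal) (T.point P b - T.point P a) ≤ 4 * T.h := by
          refine (real_inner_le_norm _ _).trans ?_
          rw [hn1, one_mul]
          exact hd b hb
        have h5 := hS' b hb hba
        calc _ = S.α a b * (inner ℝ (-s.normal) (T.point P b - T.point P a)
              * inner ℝ (-s.normal) (T.point P b - T.point P a)) := by ring
          _ ≤ S.α a b * (4 * T.h * inner ℝ (-s.normal) (T.point P b - T.point P a)) := by
            gcongr
          _ = _ := by ring
    rw [h1, h2] at hcmp
    set G := ∑ x ∈ dataPoints P T a with x.1 = s, γ x
    set κ := P.κ (P.phase (T.point P a))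
    have h6 : 2 * κ - 1600 * (|K| * M) * T.h ≤ 4 * T.h * (-G + 400 * (|K| * M)) := by
      have : 4 * T.h * (-G + ∑ x ∈ dataPoints P T a, γ x * (P.σ x.1 (T.point P x.2)
          * inner ℝ (-s.normal) (T.point P x.2 - T.point P a)))
          ≤ 4 * T.h * (-G + 400 * (|K| * M)) := by
        gcongr
        linarith
      linarith
    have h7 : κ / (2 * T.h) ≤ -G + 800 * (|K| * M) := by
      rw [div_le_iff₀ (by positivity)]
      linarith
    linarith

end Scheme

end TwoGrid

end

noncomputable section

namespace TwoGrid

open Grid InterfaceProblem Scheme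

variable {P : InterfaceProblem} {lam K : ℝ}

/-! ### Boundary rows applied to test functions -/

theorem InterfaceProblem.Admissible.exists_κ_bounds (hP : P.Admissible) :
    ∃ κ₀ κ₁ : ℝ, 0 < κ₀ ∧ ∀ s, κ₀ ≤ P.κ s ∧ P.κ s ≤ κ₁ := by
  refine ⟨min (P.κ Phase.minus) (P.κ Phase.plus), max (P.κ Phase.minus) (P.κ Phase.plus),
    lt_min (hP.κ_pos _) (hP.κ_pos _), fun s => ?_⟩
  cases s
  · exact ⟨min_le_left _ _, le_max_left _ _⟩
  · exact ⟨min_le_right _ _, le_max_right _ _⟩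

/-- Uniform continuity of `σ` on the closed sides. -/
theorem exists_σ_modulus (hP : P.Admissible) {ω : ℝ} (hω : 0 < ω) :
    ∃ d > 0, ∀ s, ∀ x ∈ P.side s, ∀ y ∈ P.side s, dist x y < d → |P.σ s x - P.σ s y| ≤ ω := by
  have h : ∀ s, ∃ d > 0, ∀ x ∈ P.side s, ∀ y ∈ P.side s, dist x y < d →
      |P.σ s x - P.σ s y| ≤ ω := by
    intro s
    have := (P.isCompact_side s).uniformContinuousOn_of_continuous (hP.σ_continuous s)
    obtain ⟨d, hd, h⟩ := Metric.uniformContinuousOn_iff.mp this ω hω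
    exact ⟨d, hd, fun x hx y hy hxy => (Real.dist_eq _ _ ▸ h x hx y hy hxy).le⟩
  choose d hd h using h
  refine ⟨Finset.univ.inf' ⟨((0, false) : Side), Finset.mem_univ _⟩ d,
    (Finset.lt_inf'_iff _).mpr fun s _ => hd s, fun s x hx y hy hxy => h s x hx y hy ?_⟩
  exact hxy.trans_le (Finset.inf'_le _ (Finset.mem_univ s))

/-- The condition on a direction `w` at a boundary point under which a test function with gradient
`w` has the right sign in the boundary condition: on each side through `x`, either `w` points
inward, or the condition is of Robin type, or of Dirichlet type near `x`. -/
def InwardOrRobin (P : InterfaceProblem) (x w : Plane) : Prop :=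
  ∀ s, x ∈ P.side s → inner ℝ w s.normal < 0 ∨ 0 < P.σ s x ∨ ∀ᶠ y in 𝓝 x, y ∈ P.side s → y ∈ P.D

/-- Quantitative form of `InwardOrRobin`, stable under small perturbations of the point and of the
direction: `μ σ` dominates the normal derivative of the test function `ε Λ`, whose gradient is
`m g`. Points of `D` are excluded, as they carry no boundary data. -/
theorem InwardOrRobin.exists_pos (hP : P.Admissible) {x w : Plane} (h : InwardOrRobin P x w) :
    ∃ q > 0, ∀ s, ∀ y ∈ P.side s, dist y x ≤ q → y ∉ P.D → ∀ g, ‖g - w‖ ≤ q →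
      ∀ μ m ε, 1 / 2 ≤ μ → 1 / 2 ≤ m → m ≤ 2 → 0 < ε → ε ≤ q →
      ε * q ≤ μ * P.σ s y - ε * m * inner ℝ g s.normal := by
  suffices hs : ∀ s, ∀ᶠ q in 𝓝[>] (0 : ℝ), ∀ y ∈ P.side s, dist y x ≤ q → y ∉ P.D → ∀ g,
      ‖g - w‖ ≤ q → ∀ μ m ε, 1 / 2 ≤ μ → 1 / 2 ≤ m → m ≤ 2 → 0 < ε → ε ≤ q →
      ε * q ≤ μ * P.σ s y - ε * m * inner ℝ g s.normal by
    obtain ⟨q, hq, hq0⟩ := ((Filter.eventually_all.mpr hs).and self_mem_nhdsWithin).exists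
    exact ⟨q, hq0, hq⟩
  intro s
  have hI : ∀ {q₀ : ℝ}, 0 < q₀ → ∀ᶠ q in 𝓝[>] (0 : ℝ), 0 < q ∧ q ≤ q₀ := fun hq₀ =>
    Filter.mem_of_superset (Ioc_mem_nhdsGT hq₀) fun q hq => ⟨hq.1, hq.2⟩
  have hin : ∀ g q, ‖g - w‖ ≤ q → |inner ℝ g s.normal - inner ℝ w s.normal| ≤ q := by
    intro g q hg
    rw [← inner_sub_left]
    refine (abs_real_inner_le_norm _ _).trans ?_
    rwa [norm_side_normal, mul_one]
  by_cases hxs : x ∈ P.side s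
  · rcases h s hxs with h | h | h
    · filter_upwards [hI (q₀ := -inner ℝ w s.normal / 4) (by linarith)] with q hq
      intro y hy _ _ g hg μ m ε hμ hm hm2 hε _
      have h1 := abs_le.mp (hin g q hg)
      have h2 := mul_nonneg (by linarith : (0 : ℝ) ≤ μ) (hP.σ_nonneg s y hy)
      have h3 : inner ℝ g s.normal ≤ -(3 * q) := by linarith
      have h4 : q ≤ -(m * inner ℝ g s.normal) := by nlinarith
      nlinarith
    · have hc := hP.σ_continuous s x hxs
      have hev : ∀ᶠ y in 𝓝[P.side s] x, P.σ s x / 2 < P.σ s y :=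
        hc.eventually (lt_mem_nhds (by linarith))
      obtain ⟨d, hd, hball⟩ := Metric.mem_nhdsWithin_iff.mp hev
      set W := ‖w‖
      have hW : 0 ≤ W := norm_nonneg _
      filter_upwards [hI (q₀ := min (min (d / 2) 1) (P.σ s x / (16 * (W + 2)))) (by positivity)]
        with q hq
      obtain ⟨hq0, hq⟩ := hq
      have hqd : q ≤ d / 2 := hq.trans ((min_le_left _ _).trans (min_le_left _ _))
      have hq1 : q ≤ 1 := hq.trans ((min_le_left _ _).trans (min_le_right _ _))
      have hqσ : q * (16 * (W + 2)) ≤ P.σ s x := by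
        rw [← le_div_iff₀ (by positivity)]; exact hq.trans (min_le_right _ _)
      intro y hy hyx _ g hg μ m ε hμ hm hm2 hε hεq
      have h1 := abs_le.mp (hin g q hg)
      have h2 : P.σ s x / 2 < P.σ s y := hball ⟨by rw [Metric.mem_ball]; linarith, hy⟩
      have h3 : inner ℝ w s.normal ≤ W := (real_inner_le_norm _ _).trans (by
        rw [norm_side_normal, mul_one])
      have h4 : inner ℝ g s.normal ≤ W + 1 := by linarith
      have h5 : m * inner ℝ g s.normal ≤ 2 * (W + 1) := by
        calc _ ≤ m * (W + 1) := by gcongr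
          _ ≤ _ := by gcongr
      have h6 : ε * (q + m * inner ℝ g s.normal) ≤ q * (2 * (W + 2)) := by
        calc _ ≤ ε * (2 * (W + 2)) := by gcongr; linarith
          _ ≤ _ := by gcongr
      have h7 : 1 / 2 * (P.σ s x / 2) ≤ μ * P.σ s y := by gcongr
      nlinarith
    · obtain ⟨d, hd, hball⟩ := Metric.eventually_nhds_iff.mp h
      filter_upwards [hI (q₀ := d / 2) (by linarith)] with q hq
      intro y hy hyx hyD
      exact absurd (hball (by linarith) hy) hyD
  · obtain ⟨d, hd, hball⟩ := Metric.isOpen_iff.mp (P.isClosed_side s).isOpen_compl x hxs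
    filter_upwards [hI (q₀ := d / 2) (by linarith)] with q hq
    intro y hy hyx
    exact absurd hy (hball (by rw [Metric.mem_ball]; linarith))

section BoundaryEstimate

variable {T : Grid} {S : Scheme} {C : ℝ} {a : Node} {γ : Side × Node → ℝ}

/-- The data weights, summed against a function of the side that is at least `c`. -/
theorem Scheme.BoundaryEstimate.sum_mul_le (hE : BoundaryEstimate P T S K C a γ) (hT : T.Fits P)
    {κ₀ c : ℝ} (hκ : κ₀ ≤ P.κ (P.phase (T.point P a))) (hκ₀ : 0 ≤ κ₀) (hC : 4 * T.h * C ≤ κ₀)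
    (hc : 0 ≤ c) {G : Side → ℝ} (hG : ∀ s, T.point P a ∈ P.side s → c ≤ G s)
    (ha : ∃ s, T.point P a ∈ P.side s) :
    ∑ x ∈ dataPoints P T a, γ x * G x.1 ≤ -(κ₀ * c / (4 * T.h)) := by
  classical
  obtain ⟨s₀, hs₀⟩ := ha
  have hh := hT.h_pos
  have hΓ : ∀ s, T.point P a ∈ P.side s →
      ∑ x ∈ dataPoints P T a with x.1 = s, γ x ≤ -(κ₀ / (4 * T.h)) := by
    intro s hs
    refine (hE.side s hs).trans ?_
    have h1 : C ≤ κ₀ / (4 * T.h) := by rw [le_div_iff₀ (by positivity)]; linarith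
    have h2 : κ₀ / (2 * T.h) ≤ P.κ (P.phase (T.point P a)) / (2 * T.h) := by gcongr
    have h3 : κ₀ / (2 * T.h) = 2 * (κ₀ / (4 * T.h)) := by field_simp; norm_num
    linarith
  have hterm : ∀ s, T.point P a ∈ P.side s →
      (∑ x ∈ dataPoints P T a with x.1 = s, γ x) * G s ≤ -(κ₀ * c / (4 * T.h)) := by
    intro s hs
    have h0 : 0 ≤ κ₀ / (4 * T.h) := by positivity
    have h1 := hΓ s hs
    have h2 := hG s hs
    have h3 : (∑ x ∈ dataPoints P T a with x.1 = s, γ x) * G s ≤ -(κ₀ / (4 * T.h)) * c := by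
      nlinarith
    refine h3.trans (le_of_eq ?_)
    ring
  have hnonpos : ∀ s, (∑ x ∈ dataPoints P T a with x.1 = s, γ x) * G s ≤ 0 := by
    intro s
    by_cases hs : T.point P a ∈ P.side s
    · refine (hterm s hs).trans ?_
      have : 0 ≤ κ₀ * c / (4 * T.h) := by positivity
      linarith
    · rw [Finset.sum_eq_zero, zero_mul]
      intro x hx
      rw [Finset.mem_filter, mem_dataPoints] at hx
      exact absurd (hx.2 ▸ hx.1.2.1) hs
  have e : ∑ x ∈ dataPoints P T a, γ x * G x.1
      = ∑ s, (∑ x ∈ dataPoints P T a with x.1 = s, γ x) * G s := by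
    rw [← Finset.sum_fiberwise (dataPoints P T a) (fun x => x.1)]
    refine Finset.sum_congr rfl fun s _ => ?_
    rw [Finset.sum_mul]
    exact Finset.sum_congr rfl fun x hx => by rw [(Finset.mem_filter.mp hx).2]
  rw [e, ← Finset.add_sum_erase _ _ (Finset.mem_univ s₀)]
  have := Finset.sum_nonpos fun s (_ : s ∈ Finset.univ.erase s₀) => hnonpos s
  linarith [hterm s₀ hs₀]

/-- A row at a boundary point, applied to a test function that is nearly linear near the point. -/
theorem Scheme.BoundaryEstimate.test_le (hE : BoundaryEstimate P T S K C a γ) (hT : T.Fits P)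
    (hs : ∀ b ∈ T.stencil P a, b ≠ a → 0 ≤ S.α a b)
    {κ₀ c : ℝ} (hκ : κ₀ ≤ P.κ (P.phase (T.point P a))) (hκ₀ : 0 ≤ κ₀) (hC : 4 * T.h * C ≤ κ₀)
    (hC0 : 0 ≤ C) (hc : 0 ≤ c) (ha : ∃ s, T.point P a ∈ P.side s)
    {Λ : Node → ℝ} {g : Plane} {m E μ ε ω W : ℝ} (hE0 : 0 ≤ E) (hm : 0 ≤ m) (hm2 : m ≤ 2)
    (hΛ : ∀ b ∈ T.stencil P a, |Λ b - Λ a - m * inner ℝ g (T.point P b - T.point P a)|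
      ≤ E * ‖T.point P b - T.point P a‖ ^ 2)
    (hμ : 0 ≤ μ) (hμ1 : μ ≤ 1) (hε : 0 ≤ ε) (hg : ‖g‖ ≤ W)
    (hG : ∀ s, T.point P a ∈ P.side s →
      c ≤ μ * P.σ s (T.point P a) - ε * m * inner ℝ g s.normal)
    (hω : ∀ x ∈ dataPoints P T a, |P.σ x.1 (T.point P x.2) - P.σ x.1 (T.point P a)| ≤ ω)
    (hω0 : 0 ≤ ω) :
    μ * ∑ b ∈ T.stencil P a, S.α a b - ε * ∑ b ∈ T.stencil P a, S.α a b * (Λ b - Λ a)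
      ≤ -(κ₀ * c / (4 * T.h)) + 100 * (|K| / T.h * ω) + ε * (2 * (C * W) + E * C) := by
  have hh := hT.h_pos
  have h1 := hE.sum_mul_le hT hκ hκ₀ hC hc hG ha
  have h2 : |∑ x ∈ dataPoints P T a, γ x * (P.σ x.1 (T.point P x.2) - P.σ x.1 (T.point P a))|
      ≤ 100 * (|K| / T.h * ω) := by
    refine abs_sum_le_card (by positivity) (by exact_mod_cast card_dataPoints_le a) fun x hx => ?_
    rw [abs_mul]
    refine mul_le_mul ((hE.γ_le x).trans ?_) (hω x hx) (abs_nonneg _) (by positivity)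
    gcongr
    exact le_abs_self K
  have h3 := abs_sum_le_of_sq hs hΛ
  have h4 := hE.sum_inner g
  have h5 := hE.sum_sq
  set A := ∑ x ∈ dataPoints P T a, γ x * inner ℝ g x.1.normal
  set B := ∑ x ∈ dataPoints P T a, γ x * P.σ x.1 (T.point P a) with hB
  have e1 : ∑ x ∈ dataPoints P T a, γ x * (μ * P.σ x.1 (T.point P a)
      - ε * m * inner ℝ g x.1.normal) = μ * B - ε * m * A := by
    simp only [A, B, Finset.mul_sum, ← Finset.sum_sub_distrib]
    exact Finset.sum_congr rfl fun x _ => by ring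
  have e2 : ∑ b ∈ T.stencil P a, S.α a b = B
      + ∑ x ∈ dataPoints P T a, γ x * (P.σ x.1 (T.point P x.2) - P.σ x.1 (T.point P a)) := by
    rw [hE.sum, hB, ← Finset.sum_add_distrib]
    exact Finset.sum_congr rfl fun x _ => by ring
  set O := ∑ x ∈ dataPoints P T a, γ x * (P.σ x.1 (T.point P x.2) - P.σ x.1 (T.point P a))
  set L := ∑ b ∈ T.stencil P a, S.α a b * inner ℝ g (T.point P b - T.point P a)
  set R := ∑ b ∈ T.stencil P a, S.α a b *
    (Λ b - Λ a - m * inner ℝ g (T.point P b - T.point P a)) with hR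
  have e3 : ∑ b ∈ T.stencil P a, S.α a b * (Λ b - Λ a) = m * L + R := by
    simp only [L, R, Finset.mul_sum, ← Finset.sum_add_distrib]
    exact Finset.sum_congr rfl fun x _ => by ring
  rw [e1] at h1
  rw [e2, e3]
  have h6 : μ * O ≤ 100 * (|K| / T.h * ω) := by
    have : 0 ≤ 100 * (|K| / T.h * ω) := by positivity
    have := (abs_le.mp h2).2
    nlinarith
  have h7 : |R| ≤ E * C := h3.trans (mul_le_mul_of_nonneg_left h5 hE0)
  have h8 : m * (A - L) ≤ 2 * (C * W) := by
    have h9 : A - L ≤ C * W := by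
      have := (abs_le.mp h4).1
      have := mul_le_mul_of_nonneg_left hg hC0
      linarith
    have h10 : 0 ≤ C * W := mul_nonneg hC0 ((norm_nonneg g).trans hg)
    nlinarith
  have h9 : ε * (m * (A - L) - R) ≤ ε * (2 * (C * W) + E * C) := by
    have := (abs_le.mp h7).1
    exact mul_le_mul_of_nonneg_left (by linarith) hε
  calc _ = (μ * B - ε * m * A) + μ * O + ε * (m * (A - L) - R) := by ring
    _ ≤ _ := by linarith

end BoundaryEstimate

end TwoGrid

end

noncomputable section

namespace TwoGrid

open Grid InterfaceProblem Scheme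

variable {P : InterfaceProblem} {lam K : ℝ}

/-! ### The Hopf lemma and the strong maximum principle off the interface -/

/-- Finitely many smallness conditions on a positive number can be met simultaneously. -/
theorem eventually_mul_lt (A : ℝ) {c : ℝ} (hc : 0 < c) : ∀ᶠ δ in 𝓝[>] (0 : ℝ), A * δ < c := by
  have h : Filter.Tendsto (fun δ : ℝ => A * δ) (𝓝[>] 0) (𝓝 0) := by
    have : Filter.Tendsto (fun δ : ℝ => A * δ) (𝓝 0) (𝓝 (A * 0)) :=
      (continuous_const.mul continuous_id).tendsto 0
    rw [mul_zero] at this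
    exact this.mono_left nhdsWithin_le_nhds
  exact h.eventually (gt_mem_nhds hc)

/-- The paraboloid with gradient `w` at `x`. -/
def paraboloid (x w z : Plane) : ℝ := inner ℝ w (z - x) - ‖z - x‖ ^ 2

theorem paraboloid_sub (x w y z : Plane) : paraboloid x w z - paraboloid x w y
    = inner ℝ (w - (2 : ℝ) • (y - x)) (z - y) - ‖z - y‖ ^ 2 := by
  have e : z - x = (z - y) + (y - x) := (sub_add_sub_cancel z y x).symm
  rw [paraboloid, paraboloid, e]
  generalize z - y = v
  generalize y - x = p
  rw [inner_add_right, norm_add_sq_real, inner_sub_left, real_inner_smul_left,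
    real_inner_comm p v]
  ring

theorem abs_paraboloid_le {x w z : Plane} (h : ‖z - x‖ ≤ ‖w‖) :
    |paraboloid x w z| ≤ 2 * ‖w‖ * ‖z - x‖ := by
  have h1 := abs_real_inner_le_norm w (z - x)
  have h2 : ‖z - x‖ ^ 2 ≤ ‖w‖ * ‖z - x‖ := by
    rw [sq]; exact mul_le_mul_of_nonneg_right h (norm_nonneg _)
  have h3 : 0 ≤ ‖z - x‖ ^ 2 := by positivity
  rw [abs_le] at h1 ⊢
  unfold paraboloid
  constructor <;> linarith

/-- A row of the coarse scheme, applied to `F + N F²` with a paraboloid `F`. The Laplacian of `F` is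
`-4`, that of `F²` at `x` is `2 ‖w‖²`; the choice `N = 40 / ‖w‖²` makes the second term dominate. -/
theorem Scheme.ExactRow.le_sum_paraboloid (hP : P.Admissible) {T : Grid} {S : Scheme} {n : ℕ}
    {a : Node} (h : ExactRow P T S n a) (hn : 2 < n)
    (hs : ∀ b ∈ T.stencil P a, b ≠ a → 0 ≤ S.α a b) {x w : Plane} (hw : w ≠ 0)
    {d : ℝ} (hd : ∀ b ∈ T.stencil P a, ‖T.point P b - T.point P a‖ ≤ d)
    (hd0 : 0 ≤ d) (hdw : d ≤ ‖w‖ / 25) (ha : ‖T.point P a - x‖ ≤ ‖w‖ / 400) :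
    P.κ (P.phase (T.point P a)) ≤ ∑ b ∈ T.stencil P a, S.α a b *
      ((paraboloid x w (T.point P b) + 40 / ‖w‖ ^ 2 * paraboloid x w (T.point P b) ^ 2)
        - (paraboloid x w (T.point P a) + 40 / ‖w‖ ^ 2 * paraboloid x w (T.point P a) ^ 2)) := by
  have hW : 0 < ‖w‖ := norm_pos_iff.mpr hw
  set F : Node → ℝ := fun b => paraboloid x w (T.point P b) with hF
  set g := w - (2 : ℝ) • (T.point P a - x) with hgdef
  have hf : ∀ b ∈ T.stencil P a, |F b - F a - inner ℝ g (T.point P b - T.point P a)|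
      ≤ 1 * ‖T.point P b - T.point P a‖ ^ 2 := fun b _ => by
    rw [hF, paraboloid_sub, sub_sub_cancel_left, abs_neg, one_mul, abs_of_nonneg (sq_nonneg _)]
  have h1 := (abs_le.mp (h.abs_sum_sub_le hn hs hf)).1
  have h2 := h.le_sum_sq_sub_sq hn hs hf hP hd
  have hFa : |F a| ≤ ‖w‖ ^ 2 / 200 := by
    refine (abs_paraboloid_le (ha.trans (by linarith))).trans ?_
    nlinarith
  have hg : 199 / 200 * ‖w‖ ≤ ‖g‖ := by
    have := norm_sub_norm_le w ((2 : ℝ) • (T.point P a - x))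
    rw [norm_smul, Real.norm_ofNat] at this
    linarith
  have hg2 : 3 / 4 * ‖w‖ ^ 2 ≤ ‖g‖ ^ 2 := by nlinarith
  have hd2 : d ^ 2 ≤ ‖w‖ ^ 2 / 625 := by nlinarith
  have hκ := hP.κ_pos (P.phase (T.point P a))
  set κ := P.κ (P.phase (T.point P a))
  set D := ∑ b ∈ T.stencil P a, S.α a b * (F b ^ 2 - F a ^ 2)
  have e : ∑ b ∈ T.stencil P a, S.α a b * ((F b + 40 / ‖w‖ ^ 2 * F b ^ 2)
      - (F a + 40 / ‖w‖ ^ 2 * F a ^ 2))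
      = ∑ b ∈ T.stencil P a, S.α a b * (F b - F a) + 40 / ‖w‖ ^ 2 * D := by
    rw [Finset.mul_sum, ← Finset.sum_add_distrib]
    exact Finset.sum_congr rfl fun b _ => by ring
  change κ ≤ ∑ b ∈ T.stencil P a, S.α a b * ((F b + 40 / ‖w‖ ^ 2 * F b ^ 2)
      - (F a + 40 / ‖w‖ ^ 2 * F a ^ 2))
  rw [e]
  have h3 : κ * (‖w‖ ^ 2 / 2) ≤ D := by
    refine le_trans ?_ h2
    refine mul_le_mul_of_nonneg_left ?_ hκ.le
    linarith [sq_nonneg ‖w‖]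
  have h4 : 20 * κ ≤ 40 / ‖w‖ ^ 2 * D := by
    calc 20 * κ = 40 / ‖w‖ ^ 2 * (κ * (‖w‖ ^ 2 / 2)) := by field_simp; norm_num
      _ ≤ _ := by gcongr
  linarith

/-- A point `x` off the interface is good if, near `x`, the points `y` with
`⟪w, y - x⟫ ≥ 3/4 ‖y - x‖²` are good: this is the argument of the Hopf lemma and of the strong
maximum principle. -/
theorem good_of_quadratic (hP : P.Admissible) (hlam : 0 < lam) {x w : Plane}
    (hx : x ∉ P.interface) (hw : w ≠ 0) {r₀ : ℝ} (hr₀ : 0 < r₀)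
    (hg : ∀ y ∈ P.rect, y ≠ x → dist y x ≤ r₀ → 3 / 4 * ‖y - x‖ ^ 2 ≤ inner ℝ w (y - x) →
      Good P lam K y)
    (hb : InwardOrRobin P x w) : Good P lam K x := by
  obtain ⟨q, hq, hbq⟩ := hb.exists_pos hP
  obtain ⟨κ₀, κ₁, hκ₀, hκ⟩ := hP.exists_κ_bounds
  obtain ⟨C, hC, hE⟩ := exists_boundaryEstimate hP K
  obtain ⟨CI, hCI, hI⟩ := exists_infDist_le hP hlam
  have hd := hP.infDist_pos hx
  set d := Metric.infDist x P.interface with hddef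
  have hW : 0 < ‖w‖ := norm_pos_iff.mpr hw
  set W := ‖w‖
  set r := min (min r₀ (W / 400)) (min q d) with hr
  have hr0 : 0 < r := by positivity
  have hrr₀ : r ≤ r₀ := (min_le_left _ _).trans (min_le_left _ _)
  have hrW : r ≤ W / 400 := (min_le_left _ _).trans (min_le_right _ _)
  have hrq : r ≤ q := (min_le_right _ _).trans (min_le_left _ _)
  have hrd : r ≤ d := (min_le_right _ _).trans (min_le_right _ _)
  set N := 40 / W ^ 2 with hN
  have hN0 : 0 < N := by positivity
  set F : Plane → ℝ := paraboloid x w with hFdef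
  have hF : ∀ z, ‖z - x‖ ≤ r → |F z| ≤ 2 * W * ‖z - x‖ := fun z hz =>
    abs_paraboloid_le (hz.trans (by linarith))
  have hNF : ∀ z, ‖z - x‖ ≤ r → |N * F z| ≤ 1 / 5 := by
    intro z hz
    rw [abs_mul, abs_of_pos hN0]
    calc N * |F z| ≤ N * (2 * W * (W / 400)) := by
          gcongr; exact (hF z hz).trans (by gcongr; exact hz.trans hrW)
      _ = 1 / 5 := by rw [hN]; field_simp; norm_num
  -- on the rest of the ring `F ≤ -‖y - x‖² / 4`
  set A := P.rect ∩ {y | r / 2 ≤ ‖y - x‖ ∧ ‖y - x‖ ≤ r ∧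
    3 / 4 * ‖y - x‖ ^ 2 ≤ inner ℝ w (y - x)} with hA
  have hAc : IsCompact A := by
    refine P.isCompact_rect.inter_right ?_
    have h1 : Continuous fun y : Plane => ‖y - x‖ := by fun_prop
    have h2 : Continuous fun y : Plane => (inner ℝ w (y - x) : ℝ) := by fun_prop
    exact (isClosed_le continuous_const h1).inter ((isClosed_le h1 continuous_const).inter
      (isClosed_le (continuous_const.mul (h1.pow 2)) h2))
  refine good_of_test hP hlam (c := r ^ 2 / 32) (B := 3 * W) hr0 (by positivity) (by positivity)
    hAc (fun y hy => ?_) (fun T a => F (T.point P a) + N * F (T.point P a) ^ 2) ?_ ?_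
    ⟨q, hq, fun ε hε hεq => ?_⟩
  · refine hg y hy.1 ?_ ?_ hy.2.2.2
    · rintro rfl
      have := hy.2.1
      rw [sub_self, norm_zero] at this
      linarith
    · rw [dist_eq_norm]
      exact hy.2.2.1.trans hrr₀
  · intro T hT a ha had
    rw [dist_eq_norm] at had ⊢
    have e : F (T.point P a) + N * F (T.point P a) ^ 2
        = F (T.point P a) * (1 + N * F (T.point P a)) := by ring
    have h1 := hF _ had
    have h2 := abs_le.mp (hNF _ had)
    rw [e, abs_mul]
    have h3 : |1 + N * F (T.point P a)| ≤ 3 / 2 := by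
      rw [abs_le]; constructor <;> linarith
    calc _ ≤ 2 * W * ‖T.point P a - x‖ * (3 / 2) := by gcongr
      _ = _ := by ring
  · intro T hT a ha h1 h2
    rw [dist_eq_norm] at h1 h2
    by_cases hin : 3 / 4 * ‖T.point P a - x‖ ^ 2 ≤ inner ℝ w (T.point P a - x)
    · exact Or.inr ⟨(hT.point_mem_rect_iff a).mpr ha.1, h1, h2, hin⟩
    · left
      push Not at hin
      have h3 : F (T.point P a) ≤ -(‖T.point P a - x‖ ^ 2 / 4) := by
        rw [hFdef]; unfold paraboloid; linarith
      have h4 := abs_le.mp (hNF _ h2)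
      have h5 : r ^ 2 / 4 ≤ ‖T.point P a - x‖ ^ 2 := by nlinarith
      have h6 : F (T.point P a) ≤ -(r ^ 2 / 16) := by linarith
      have e : F (T.point P a) + N * F (T.point P a) ^ 2
        = F (T.point P a) * (1 + N * F (T.point P a)) := by ring
      rw [e]
      nlinarith [sq_nonneg r]
  · obtain ⟨dω, hdω, hω⟩ := exists_σ_modulus hP (ω := κ₀ * ε * q / (1600 * (|K| + 1)))
      (by positivity)
    set ω := κ₀ * ε * q / (1600 * (|K| + 1)) with hωdef
    have hω0 : 0 < ω := by positivity
    have hKω : 100 * (|K| * ω) ≤ κ₀ * ε * q / 16 := by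
      have h0 : |K| * ω ≤ (|K| + 1) * ω := by gcongr; linarith
      have : (|K| + 1) * ω = κ₀ * ε * q / 1600 := by rw [hωdef]; field_simp
      linarith
    obtain ⟨δ, ⟨h1, h2, h3, h4, h5, h6, h7⟩, hδ⟩ := (((eventually_mul_lt 1 one_pos).and
      ((eventually_mul_lt (4 * C) hκ₀).and ((eventually_mul_lt 100 hW).and
      ((eventually_mul_lt (2 * CI) hd).and ((eventually_mul_lt 4 hdω).and
      ((eventually_mul_lt (ε * (2 * (C * (2 * W)) + 400 * C) + 1)
        (c := κ₀ * ε * q / 16) (by positivity)).and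
        (eventually_mul_lt 1 (c := ε * κ₀) (by positivity)))))))).and
        self_mem_nhdsWithin).exists
    replace hδ : 0 < δ := hδ
    refine ⟨δ, hδ, fun T S e he a ha had μ hμ hμ1 => ?_⟩
    have hT := he.fits
    have hh := hT.h_pos
    have hhδ := he.h_le
    rw [dist_eq_norm] at had
    have hsg := (he.sign a ha).2
    have hst : ∀ b ∈ T.stencil P a, ‖T.point P b - T.point P a‖ ≤ 4 * T.h := fun b hb =>
      norm_le_of_mem_stencil hT hb
    -- close to `x` there are only rows of the coarse scheme and boundary rows
    have hcoarse : T.IsVertex a ∧ ¬ T.FineInterior P a := by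
      by_contra hcon
      rw [Classical.not_and_iff_not_or_not, not_not] at hcon
      have h8 := hI T hT he.lam_eq a ha.1 hcon
      have h9 := Metric.infDist_le_infDist_add_dist (s := P.interface) (x := x)
        (y := T.point P a)
      rw [dist_comm, dist_eq_norm] at h9
      have : CI * T.h ≤ CI * δ := by gcongr
      linarith
    by_cases hi : T.Interior a
    · have hrow := exactRow_coarse hT ha.1 hi hcoarse.2 hcoarse.1 he.resolves
        (he.scheme.coarse a ha.1 hi hcoarse.2 hcoarse.1)
      have hw1 : T.weight P a = 1 := by
        rw [Grid.weight, if_neg hcoarse.2, if_pos ⟨hi, hcoarse.1⟩]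
      have hmain := hrow.le_sum_paraboloid hP (by norm_num) hsg (x := x) hw hst (by positivity)
        (by linarith) (by linarith)
      rw [hrow.sum_zero (by norm_num), hw1, mul_zero]
      have h8 := (hκ (P.phase (T.point P a))).1
      have h9 : ε * κ₀ ≤ ε * ∑ b ∈ T.stencil P a, S.α a b * (F (T.point P b)
          + N * F (T.point P b) ^ 2 - (F (T.point P a) + N * F (T.point P a) ^ 2)) :=
        mul_le_mul_of_nonneg_left (h8.trans hmain) hε.le
      linarith
    · obtain ⟨γ, hγ⟩ := hE T hT (by linarith) S he.sign a ha hi (he.scheme.boundary a ha hi)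
      have hside : ∃ s, T.point P a ∈ P.side s :=
        P.exists_mem_side ((hT.point_mem_rect_iff a).mpr ha.1.1)
          (by rwa [hT.point_mem_openRect_iff])
      have hw1 : T.weight P a = 1 / T.h := by
        rw [Grid.weight, if_neg hcoarse.2, if_neg fun h => hi h.1]
      set g := w - (2 : ℝ) • (T.point P a - x) with hgdef
      have har : ‖T.point P a - x‖ ≤ r := by linarith
      have hgw : ‖g - w‖ ≤ r := by
        rw [hgdef, sub_sub_cancel_left, norm_neg, norm_smul, Real.norm_ofNat]
        linarith
      have hgW : ‖g‖ ≤ 2 * W := by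
        have : ‖g‖ ≤ W + ‖w - g‖ := norm_le_norm_add_norm_sub w g
        rw [norm_sub_rev w g] at this
        linarith
      have hNa := abs_le.mp (hNF _ har)
      have hv : ∀ b ∈ T.stencil P a, ‖T.point P b - T.point P a‖ ≤ W := fun b hb =>
        (hst b hb).trans (by linarith)
      have key := hγ.test_le hT hsg (hκ _).1 hκ₀.le
        (by have : C * T.h ≤ C * δ := by gcongr
            linarith) hC
        (c := ε * q) (by positivity) hside
        (Λ := fun b => F (T.point P b) + N * F (T.point P b) ^ 2) (g := g)
        (m := 1 + 2 * (N * F (T.point P a))) (E := 400) (μ := μ) (ε := ε) (ω := ω) (W := 2 * W)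
        (by norm_num) (by linarith) (by linarith) (fun b hb => ?_) (by linarith) hμ1 hε.le hgW
        (fun s hs => hbq s _ hs (by rw [dist_eq_norm]; linarith) ha.2.1 g (by linarith) μ _ ε hμ
          (by linarith) (by linarith) hε hεq)
        (fun y hy => ?_) hω0.le
      · refine key.trans_lt ?_
        rw [hw1]
        have e1 : -(κ₀ * (ε * q) / (4 * T.h)) + 100 * (|K| / T.h * ω)
            + ε * (2 * (C * (2 * W)) + 400 * C)
            = (-(κ₀ * ε * q / 4) + 100 * (|K| * ω)
              + ε * (2 * (C * (2 * W)) + 400 * C) * T.h) * (1 / T.h) := by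
          field_simp
        rw [e1]
        refine mul_lt_mul_of_pos_right ?_ (by positivity)
        have : ε * (2 * (C * (2 * W)) + 400 * C) * T.h
            ≤ ε * (2 * (C * (2 * W)) + 400 * C) * δ := by gcongr
        linarith [mul_pos (mul_pos hκ₀ hε) hq]
      -- the test function is nearly linear, with gradient `(1 + 2 N F) g`
      · have h8 : F (T.point P b) - F (T.point P a)
            = inner ℝ g (T.point P b - T.point P a) - ‖T.point P b - T.point P a‖ ^ 2 :=
          paraboloid_sub _ _ _ _
        have h9 := abs_real_inner_le_norm g (T.point P b - T.point P a)
        have h10 := hv b hb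
        set v := T.point P b - T.point P a
        have e2 : F (T.point P b) + N * F (T.point P b) ^ 2
            - (F (T.point P a) + N * F (T.point P a) ^ 2)
            - (1 + 2 * (N * F (T.point P a))) * inner ℝ g v
            = -((1 + 2 * (N * F (T.point P a))) * ‖v‖ ^ 2)
              + N * (F (T.point P b) - F (T.point P a)) ^ 2 := by
          linear_combination (1 + 2 * (N * F (T.point P a))) * h8
        have h11 : |F (T.point P b) - F (T.point P a)| ≤ 3 * W * ‖v‖ := by
          rw [h8]
          have h12 : ‖g‖ * ‖v‖ ≤ 2 * W * ‖v‖ := by gcongr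
          have h13 : ‖v‖ ^ 2 ≤ W * ‖v‖ := by rw [sq]; gcongr
          refine (abs_sub _ _).trans ?_
          rw [abs_of_nonneg (sq_nonneg ‖v‖)]
          linarith
        have h14 : N * (F (T.point P b) - F (T.point P a)) ^ 2 ≤ 360 * ‖v‖ ^ 2 := by
          rw [← sq_abs]
          calc _ ≤ N * (3 * W * ‖v‖) ^ 2 := by gcongr
            _ = _ := by rw [hN]; field_simp; ring
        have h15 : 0 ≤ N * (F (T.point P b) - F (T.point P a)) ^ 2 := by positivity
        have h16 : 0 ≤ (1 + 2 * (N * F (T.point P a))) * ‖v‖ ^ 2 :=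
          mul_nonneg (by linarith) (sq_nonneg _)
        have h17 : (1 + 2 * (N * F (T.point P a))) * ‖v‖ ^ 2 ≤ 2 * ‖v‖ ^ 2 := by
          gcongr; linarith
        simp only [e2]
        rw [abs_le]
        constructor <;> linarith
      · rw [mem_dataPoints] at hy
        refine hω _ _ hy.2.2.1 _ hy.2.1 ?_
        rw [dist_eq_norm]
        have hyst := hst y.2 (by rw [stencil_of_not_interior hi]; exact hy.1)
        linarith

end TwoGrid

end

noncomputable section

namespace TwoGrid

open Grid InterfaceProblem Scheme

variable {P : InterfaceProblem}

/-! ### The interface as a graph -/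

/-- Height of a point over the curve that, in the tangential and normal coordinates at `X t₀`, is
the graph of `γ`. -/
def height (P : InterfaceProblem) (t₀ : ℝ) (γ : ℝ → ℝ) (z : Plane) : ℝ :=
  inner ℝ (P.normal t₀) (z - P.X t₀) - γ (inner ℝ (deriv P.X t₀) (z - P.X t₀))

/-- The point with tangential coordinate `y.1` and height `y.2`. -/
def ofHeight (P : InterfaceProblem) (t₀ : ℝ) (γ : ℝ → ℝ) (y : ℝ × ℝ) : Plane :=
  P.X t₀ + (y.1 • deriv P.X t₀ + (γ y.1 + y.2) • P.normal t₀)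

/-- Near `X t₀`, in a disk of radius `r` in the open rectangle, the interface is the graph of `γ`
over the tangent; `γ` has the derivative `γ'` and a second derivative of size `O(L)`. -/
structure IsGraph (P : InterfaceProblem) (t₀ : ℝ) (γ γ' : ℝ → ℝ) (L r : ℝ) : Prop where
  r_pos : 0 < r
  L_nonneg : 0 ≤ L
  L_mul_le : L * r ≤ 1 / 16
  zero : γ 0 = 0
  deriv_zero : γ' 0 = 0
  taylor : ∀ a b, |a| < r → |b| < r → |γ b - γ a - γ' a * (b - a)| ≤ L * |b - a| ^ 2
  mem_openRect : ∀ z, dist z (P.X t₀) < r → z ∈ P.openRect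
  mem_interface_iff : ∀ z, dist z (P.X t₀) < r → (z ∈ P.interface ↔ height P t₀ γ z = 0)

theorem IsGraph.mono {t₀ L r r' : ℝ} {γ γ' : ℝ → ℝ} (h : IsGraph P t₀ γ γ' L r) (hr : 0 < r')
    (hr' : r' ≤ r) : IsGraph P t₀ γ γ' L r' where
  r_pos := hr
  L_nonneg := h.L_nonneg
  L_mul_le := (mul_le_mul_of_nonneg_left hr' h.L_nonneg).trans h.L_mul_le
  zero := h.zero
  deriv_zero := h.deriv_zero
  taylor a b ha hb := h.taylor a b (ha.trans_le hr') (hb.trans_le hr')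
  mem_openRect z hz := h.mem_openRect z (hz.trans_le hr')
  mem_interface_iff z hz := h.mem_interface_iff z (hz.trans_le hr')

theorem eq_tangent_add_normal (hP : P.Admissible) (t : ℝ) (v : Plane) :
    v = (inner ℝ (deriv P.X t) v : ℝ) • deriv P.X t + (inner ℝ (P.normal t) v : ℝ) • P.normal t := by
  have h := hP.X_arclength t
  have h2 : deriv P.X t 0 ^ 2 + deriv P.X t 1 ^ 2 = 1 := by
    rw [← norm_sq_eq, h, one_pow]
  ext i
  fin_cases i
  · simp [inner_plane, normal]
    linear_combination (-v 0) * h2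
  · simp [inner_plane, normal]
    linear_combination (-v 1) * h2

theorem norm_sq_eq_tangent_normal (hP : P.Admissible) (t : ℝ) (v : Plane) :
    ‖v‖ ^ 2 = (inner ℝ (deriv P.X t) v : ℝ) ^ 2 + (inner ℝ (P.normal t) v : ℝ) ^ 2 := by
  have h := hP.X_arclength t
  have h2 : deriv P.X t 0 ^ 2 + deriv P.X t 1 ^ 2 = 1 := by
    rw [← norm_sq_eq, h, one_pow]
  rw [norm_sq_eq, inner_plane, inner_plane]
  simp [normal]
  linear_combination (-(v 0 ^ 2) - v 1 ^ 2) * h2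

theorem inner_self_deriv (hP : P.Admissible) (t : ℝ) :
    inner ℝ (deriv P.X t) (deriv P.X t) = (1 : ℝ) := by
  rw [real_inner_self_eq_norm_sq, hP.X_arclength, one_pow]

theorem inner_self_normal (hP : P.Admissible) (t : ℝ) :
    inner ℝ (P.normal t) (P.normal t) = (1 : ℝ) := by
  rw [real_inner_self_eq_norm_sq, norm_normal hP, one_pow]

theorem tangent_ofHeight (hP : P.Admissible) (t₀ : ℝ) (γ : ℝ → ℝ) (y : ℝ × ℝ) :
    inner ℝ (deriv P.X t₀) (ofHeight P t₀ γ y - P.X t₀) = y.1 := by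
  rw [ofHeight, add_sub_cancel_left, inner_add_right, real_inner_smul_right,
    real_inner_smul_right, inner_self_deriv hP, real_inner_comm, inner_normal_deriv]
  ring

theorem normal_ofHeight (hP : P.Admissible) (t₀ : ℝ) (γ : ℝ → ℝ) (y : ℝ × ℝ) :
    inner ℝ (P.normal t₀) (ofHeight P t₀ γ y - P.X t₀) = γ y.1 + y.2 := by
  rw [ofHeight, add_sub_cancel_left, inner_add_right, real_inner_smul_right,
    real_inner_smul_right, inner_self_normal hP, inner_normal_deriv]
  ring

theorem height_ofHeight (hP : P.Admissible) (t₀ : ℝ) (γ : ℝ → ℝ) (y : ℝ × ℝ) :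
    height P t₀ γ (ofHeight P t₀ γ y) = y.2 := by
  rw [height, tangent_ofHeight hP, normal_ofHeight hP, add_sub_cancel_left]

theorem ofHeight_height (hP : P.Admissible) (t₀ : ℝ) (γ : ℝ → ℝ) (z : Plane) :
    ofHeight P t₀ γ (inner ℝ (deriv P.X t₀) (z - P.X t₀), height P t₀ γ z) = z := by
  rw [ofHeight, height, add_sub_cancel, ← eq_tangent_add_normal hP, add_sub_cancel]

theorem abs_tangent_le (hP : P.Admissible) (t : ℝ) (v : Plane) :
    |inner ℝ (deriv P.X t) v| ≤ ‖v‖ := by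
  have := abs_real_inner_le_norm (deriv P.X t) v
  rwa [hP.X_arclength, one_mul] at this

theorem abs_normal_le (hP : P.Admissible) (t : ℝ) (v : Plane) :
    |inner ℝ (P.normal t) v| ≤ ‖v‖ := by
  have := abs_real_inner_le_norm (P.normal t) v
  rwa [norm_normal hP, one_mul] at this

/-- A parameter near `X t₀` can be chosen near `t₀`, because the curve is simple. -/
theorem exists_param_near (hP : P.Admissible) (t₀ : ℝ) {U : Set ℝ} (hU : IsOpen U) (ht : t₀ ∈ U) :
    ∃ r > 0, ∀ z ∈ P.interface, dist z (P.X t₀) < r → ∃ s ∈ U, P.X s = z := by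
  have hp := hP.period_pos
  set I := Set.Icc (t₀ - P.period / 2) (t₀ + P.period / 2) with hI
  have hK : IsCompact (P.X '' (I \ U)) :=
    (isCompact_Icc.diff hU).image hP.X_smooth.continuous
  have hnot : P.X t₀ ∉ P.X '' (I \ U) := by
    rintro ⟨s, ⟨hsI, hsU⟩, hs⟩
    refine hsU ?_
    have h1 : P.X (toIcoMod hp 0 s) = P.X (toIcoMod hp 0 t₀) := by
      rw [toIcoMod, toIcoMod, hP.X_periodic.sub_zsmul_eq, hP.X_periodic.sub_zsmul_eq, hs]
    have h2 := hP.X_simple (by simpa using toIcoMod_mem_Ico hp 0 s)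
      (by simpa using toIcoMod_mem_Ico hp 0 t₀) h1
    rw [toIcoMod, toIcoMod, zsmul_eq_mul, zsmul_eq_mul] at h2
    set m := toIcoDiv hp 0 s
    set n := toIcoDiv hp 0 t₀
    have h3 : s - t₀ = ((m - n : ℤ) : ℝ) * P.period := by push_cast; linarith
    have h4 : |s - t₀| ≤ P.period / 2 := by
      rw [abs_le]; constructor <;> linarith [hsI.1, hsI.2]
    have h5 : m - n = 0 := by
      by_contra hne
      have h6 : (1 : ℝ) ≤ |((m - n : ℤ) : ℝ)| := by
        rw [← Int.cast_abs]; exact_mod_cast Int.one_le_abs hne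
      rw [h3, abs_mul, abs_of_pos hp] at h4
      nlinarith
    rw [h5, Int.cast_zero, zero_mul] at h3
    rwa [show s = t₀ by linarith]
  obtain ⟨r, hr, hball⟩ := Metric.isOpen_iff.mp hK.isClosed.isOpen_compl _ hnot
  refine ⟨r, hr, fun z hz hd => ?_⟩
  have hz' : z ∈ P.X '' I := by
    have := hP.X_periodic.image_Icc hp (t₀ - P.period / 2)
    rw [show t₀ - P.period / 2 + P.period = t₀ + P.period / 2 by ring] at this
    rw [this]; exact hz
  obtain ⟨s, hs, rfl⟩ := hz'
  refine ⟨s, ?_, rfl⟩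
  by_contra hsU
  exact hball hd ⟨s, ⟨hs, hsU⟩, rfl⟩

/-- A `C²` function has a uniform quadratic Taylor bound near a point. -/
theorem exists_taylor_two {γ : ℝ → ℝ} (h : ContDiffAt ℝ 2 γ 0) :
    ∃ γ' : ℝ → ℝ, ∃ L r, 0 ≤ L ∧ 0 < r ∧ HasDerivAt γ (γ' 0) 0 ∧
      ∀ a b, |a| < r → |b| < r → |γ b - γ a - γ' a * (b - a)| ≤ L * |b - a| ^ 2 := by
  rw [show (2 : WithTop ℕ∞) = ((1 : ℕ) : WithTop ℕ∞) + 1 by norm_num,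
    contDiffAt_succ_iff_hasFDerivAt] at h
  obtain ⟨f', ⟨u, hu, hd⟩, h1⟩ := h
  obtain ⟨L, v, hv, hL⟩ := ContDiffAt.exists_lipschitzOnWith (𝕂 := ℝ) h1
  obtain ⟨r, hr, hball⟩ := Metric.mem_nhds_iff.mp (Filter.inter_mem hu hv)
  have hmem : ∀ a, |a| < r → a ∈ u ∩ v := fun a ha => hball (by simpa using ha)
  refine ⟨fun a => f' a 1, L, r, L.2, hr, (hd 0 (mem_of_mem_nhds hu)).hasDerivAt,
    fun a b ha hb => ?_⟩
  have hseg : ∀ x ∈ Set.uIcc a b, |x| < r := by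
    intro x hx
    have h1 := abs_lt.mp ha
    have h2 := abs_lt.mp hb
    rw [Set.mem_uIcc] at hx
    rw [abs_lt]
    rcases hx with hx | hx <;> constructor <;> linarith [hx.1, hx.2]
  have key := Convex.norm_image_sub_le_of_norm_hasDerivWithin_le (s := Set.uIcc a b)
    (f := fun x => γ x - f' a 1 * x) (f' := fun x => f' x 1 - f' a 1 * 1) (C := L * |b - a|)
    (x := a) (y := b) (fun x hx => (((hd x (hmem x (hseg x hx)).1).hasDerivAt).sub
      ((hasDerivAt_id x).const_mul _)).hasDerivWithinAt) (fun x hx => ?_) (convex_uIcc a b)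
    Set.left_mem_uIcc Set.right_mem_uIcc
  · rw [Real.norm_eq_abs, Real.norm_eq_abs] at key
    calc _ = |γ b - f' a 1 * b - (γ a - f' a 1 * a)| := by congr 1; ring
      _ ≤ L * |b - a| * |b - a| := key
      _ = _ := by ring
  · rw [mul_one, ← sub_apply]
    refine ((f' x - f' a).le_opNorm 1).trans ?_
    rw [norm_one, mul_one]
    refine (hL.norm_sub_le (hmem x (hseg x hx)).2 (hmem a ha).2).trans ?_
    rw [Real.norm_eq_abs]
    exact mul_le_mul_of_nonneg_left (Set.abs_sub_left_of_mem_uIcc hx) L.2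

/-- Near each of its points the interface is a graph over its tangent: the inverse function theorem,
applied to the tangential coordinate along the curve. -/
theorem exists_isGraph (hP : P.Admissible) (t₀ : ℝ) : ∃ γ γ' L r, IsGraph P t₀ γ γ' L r := by
  set p : ℝ → ℝ := fun s => inner ℝ (deriv P.X t₀) (P.X s - P.X t₀) with hp
  have hX : ContDiff ℝ 2 fun s => P.X s - P.X t₀ := hP.X_smooth.sub contDiff_const
  have hpc : ContDiffAt ℝ 2 p t₀ := (contDiff_const.inner ℝ hX).contDiffAt
  have hp' : HasFDerivAt p ((ContinuousLinearEquiv.refl ℝ ℝ : ℝ ≃L[ℝ] ℝ) : ℝ →L[ℝ] ℝ) t₀ := by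
    have := (hasDerivAt_inner_X hP (deriv P.X t₀) (P.X t₀) t₀)
    rw [inner_self_deriv hP] at this
    exact this.hasFDerivAt.congr_fderiv (by ext; simp)
  set e := hpc.toOpenPartialHomeomorph p hp' two_ne_zero with he
  have hpe : ∀ s, e s = p s := fun s => rfl
  have hp0 : p t₀ = 0 := by simp [p]
  have hsrc : t₀ ∈ e.source := hpc.mem_toOpenPartialHomeomorph_source hp' two_ne_zero
  have htgt : (0 : ℝ) ∈ e.target := by
    have := hpc.image_mem_toOpenPartialHomeomorph_target hp' two_ne_zero
    rwa [hp0] at this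
  have hsymm : e.symm 0 = t₀ := by
    have := e.left_inv hsrc
    rwa [hpe, hp0] at this
  have hψ : ContDiffAt ℝ 2 e.symm 0 := by
    have := hpc.to_localInverse hp' two_ne_zero
    rwa [hp0] at this
  set γ : ℝ → ℝ := fun ξ => inner ℝ (P.normal t₀) (P.X (e.symm ξ) - P.X t₀) with hγ
  have hγc : ContDiffAt ℝ 2 γ 0 :=
    ((contDiff_const.inner ℝ hX).contDiffAt).comp (0 : ℝ) hψ
  obtain ⟨γ', L, r₁, hL, hr₁, hd, htay⟩ := exists_taylor_two hγc
  have hγ0 : γ 0 = 0 := by simp [γ, hsymm]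
  have hγ'0 : γ' 0 = 0 := by
    have h1 : HasDerivAt γ (inner ℝ (P.normal t₀) (deriv P.X t₀) * deriv e.symm 0) 0 := by
      have h2 := hasDerivAt_inner_X hP (P.normal t₀) (P.X t₀) (e.symm 0)
      rw [hsymm] at h2
      have h3 := (hψ.differentiableAt (by norm_num)).hasDerivAt
      exact HasDerivAt.comp (0 : ℝ) (by rw [hsymm]; exact h2) h3
    rw [inner_normal_deriv, zero_mul] at h1
    exact hd.unique h1
  obtain ⟨r₂, hr₂, hball₂⟩ := Metric.isOpen_iff.mp e.open_target 0 htgt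
  obtain ⟨r₃, hr₃, hpar⟩ := exists_param_near hP t₀ e.open_source hsrc
  obtain ⟨r₄, hr₄, hball₄⟩ := Metric.isOpen_iff.mp P.isOpen_openRect (P.X t₀)
    (hP.interface_subset ⟨t₀, rfl⟩)
  refine ⟨γ, γ', L, min (min (min r₁ r₂) (min r₃ r₄)) (1 / (16 * (L + 1))), ?_⟩
  set r := min (min (min r₁ r₂) (min r₃ r₄)) (1 / (16 * (L + 1))) with hr
  have hr1 : r ≤ r₁ := (min_le_left _ _).trans ((min_le_left _ _).trans (min_le_left _ _))
  have hr2 : r ≤ r₂ := (min_le_left _ _).trans ((min_le_left _ _).trans (min_le_right _ _))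
  have hr3 : r ≤ r₃ := (min_le_left _ _).trans ((min_le_right _ _).trans (min_le_left _ _))
  have hr4 : r ≤ r₄ := (min_le_left _ _).trans ((min_le_right _ _).trans (min_le_right _ _))
  have hr0 : 0 < r := by positivity
  have hLr : r * (16 * (L + 1)) ≤ 1 := by
    rw [← le_div_iff₀ (by positivity)]; exact min_le_right _ _
  refine ⟨hr0, hL, by nlinarith, hγ0, hγ'0, fun a b ha hb => htay a b (by linarith)
    (by linarith), fun z hz => hball₄ (by rw [Metric.mem_ball]; linarith), fun z hz => ?_⟩
  constructor
  · intro hzΓ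
    obtain ⟨s, hs, rfl⟩ := hpar z hzΓ (by linarith)
    have : e.symm (inner ℝ (deriv P.X t₀) (P.X s - P.X t₀)) = s := e.left_inv hs
    rw [height, hγ]
    simp only [this, sub_self]
  · intro h0
    have hξ : inner ℝ (deriv P.X t₀) (z - P.X t₀) ∈ e.target := by
      refine hball₂ ?_
      rw [mem_ball_zero_iff, Real.norm_eq_abs]
      refine (abs_tangent_le hP t₀ _).trans_lt ?_
      rw [← dist_eq_norm]
      linarith
    set ξ : ℝ := inner ℝ (deriv P.X t₀) (z - P.X t₀) with hξdef
    have h1 : inner ℝ (deriv P.X t₀) (P.X (e.symm ξ) - P.X t₀) = ξ := e.right_inv hξ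
    have h2 : inner ℝ (P.normal t₀) (z - P.X t₀)
        = inner ℝ (P.normal t₀) (P.X (e.symm ξ) - P.X t₀) := sub_eq_zero.mp h0
    have h3 : z - P.X t₀ = P.X (e.symm ξ) - P.X t₀ := by
      rw [eq_tangent_add_normal hP t₀ (z - P.X t₀),
        eq_tangent_add_normal hP t₀ (P.X (e.symm ξ) - P.X t₀), h1, h2]
    exact ⟨e.symm ξ, (sub_left_injective h3).symm⟩

namespace IsGraph

variable {t₀ L r : ℝ} {γ γ' : ℝ → ℝ} (h : IsGraph P t₀ γ γ' L r)
include h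

theorem abs_apply_le {a : ℝ} (ha : |a| < r) : |γ a| ≤ |a| / 16 := by
  have h1 := h.taylor 0 a (by simpa using h.r_pos) ha
  rw [h.zero, h.deriv_zero, zero_mul, sub_zero, sub_zero, sub_zero] at h1
  have h2 : L * |a| ≤ 1 / 16 := (mul_le_mul_of_nonneg_left ha.le h.L_nonneg).trans h.L_mul_le
  nlinarith [abs_nonneg a]

theorem abs_deriv_sub_le {a b : ℝ} (ha : |a| < r) (hb : |b| < r) :
    |γ' b - γ' a| ≤ 2 * L * |b - a| := by
  rcases eq_or_ne a b with rfl | hab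
  · simp
  · have h1 := abs_le.mp (h.taylor a b ha hb)
    have h2 := abs_le.mp (h.taylor b a hb ha)
    have hpos : 0 < |b - a| := abs_pos.mpr (sub_ne_zero.mpr hab.symm)
    rw [abs_sub_comm a b] at h2
    have h3 : |γ' b - γ' a| * |b - a| ≤ 2 * L * |b - a| * |b - a| := by
      rw [← abs_mul, abs_le]
      constructor <;> linarith
    exact le_of_mul_le_mul_right h3 hpos

theorem abs_deriv_le {a : ℝ} (ha : |a| < r) : |γ' a| ≤ 1 / 8 := by
  have h1 := h.abs_deriv_sub_le (a := 0) (by simpa using h.r_pos) ha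
  rw [h.deriv_zero, sub_zero, sub_zero] at h1
  have h2 : L * |a| ≤ 1 / 16 := (mul_le_mul_of_nonneg_left ha.le h.L_nonneg).trans h.L_mul_le
  linarith

theorem continuousOn : ContinuousOn γ (Set.Ioo (-r) r) := by
  intro a ha
  have ha' : |a| < r := abs_lt.mpr ha
  have hlim : Filter.Tendsto (fun b => |γ' a| * |b - a| + L * |b - a| ^ 2)
      (𝓝[Set.Ioo (-r) r] a) (𝓝 0) := by
    have hc : Continuous fun b : ℝ => |γ' a| * |b - a| + L * |b - a| ^ 2 := by fun_prop
    have := hc.tendsto a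
    simp only [sub_self, abs_zero, mul_zero, ne_eq, OfNat.ofNat_ne_zero, not_false_eq_true,
      zero_pow, add_zero] at this
    exact this.mono_left nhdsWithin_le_nhds
  rw [ContinuousWithinAt, tendsto_iff_dist_tendsto_zero]
  refine squeeze_zero' (Filter.Eventually.of_forall fun b => dist_nonneg) ?_ hlim
  filter_upwards [self_mem_nhdsWithin] with b hb
  have h1 := h.taylor a b ha' (abs_lt.mpr hb)
  rw [Real.dist_eq]
  calc |γ b - γ a| = |γ' a * (b - a) + (γ b - γ a - γ' a * (b - a))| := by congr 1; ring
    _ ≤ |γ' a| * |b - a| + _ := (abs_add_le _ _).trans (by rw [abs_mul])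
    _ ≤ _ := by gcongr

theorem hasDerivAt {a : ℝ} (ha : |a| < r) : HasDerivAt γ (γ' a) a := by
  rw [hasDerivAt_iff_isLittleO]
  have h1 : (fun b => γ b - γ a - (b - a) • γ' a) =O[𝓝 a] fun b => (b - a) ^ 2 := by
    refine Asymptotics.IsBigO.of_bound L ?_
    filter_upwards [(continuous_abs.tendsto a).eventually (gt_mem_nhds ha)] with b hb
    have := h.taylor a b ha hb
    rw [smul_eq_mul, mul_comm (b - a)]
    simpa using this
  refine h1.trans_isLittleO ?_
  have := (Asymptotics.isLittleO_pow_id (𝕜 := ℝ) one_lt_two)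
  exact this.comp_tendsto (tendsto_sub_nhds_zero_iff.mpr Filter.tendsto_id)

theorem dist_ofHeight_lt (hP : P.Admissible) {y : ℝ × ℝ} (h1 : |y.1| < r / 4) (h2 : |y.2| < r / 4) :
    dist (ofHeight P t₀ γ y) (P.X t₀) < r := by
  have hr := h.r_pos
  have h3 := h.abs_apply_le (a := y.1) (by linarith)
  rw [ofHeight, dist_self_add_left]
  refine (norm_add_le _ _).trans_lt ?_
  rw [norm_smul, norm_smul, hP.X_arclength, norm_normal hP, Real.norm_eq_abs, Real.norm_eq_abs]
  have := abs_add_le (γ y.1) y.2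
  linarith [abs_nonneg y.1]

theorem isPreconnected_image {I : Set ℝ} (hI : IsPreconnected I) :
    IsPreconnected (ofHeight P t₀ γ '' (Set.Ioo (-(r / 4)) (r / 4) ×ˢ I)) := by
  have hr := h.r_pos
  refine (isPreconnected_Ioo.prod hI).image _ ?_
  have hγ : ContinuousOn (fun y : ℝ × ℝ => γ y.1) (Set.Ioo (-(r / 4)) (r / 4) ×ˢ I) :=
    h.continuousOn.comp continuousOn_fst fun y hy =>
      ⟨by linarith [hy.1.1], by linarith [hy.1.2]⟩
  unfold ofHeight
  exact continuousOn_const.add ((continuousOn_fst.smul continuousOn_const).add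
    ((hγ.add continuousOn_snd).smul continuousOn_const))

theorem abs_height_le (hP : P.Admissible) {z : Plane} (hz : dist z (P.X t₀) < r) :
    |height P t₀ γ z| ≤ 2 * dist z (P.X t₀) := by
  rw [dist_eq_norm] at hz ⊢
  have h1 := abs_normal_le hP t₀ (z - P.X t₀)
  have h2 := abs_tangent_le hP t₀ (z - P.X t₀)
  have h3 := h.abs_apply_le (h2.trans_lt hz)
  rw [height]
  refine (abs_sub _ _).trans ?_
  linarith [norm_nonneg (z - P.X t₀)]

end IsGraph

/-- A graph whose upper side is the part of the plane on which `φ` is positive. -/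
structure IsChart (P : InterfaceProblem) (t₀ : ℝ) (γ γ' : ℝ → ℝ) (L r : ℝ) : Prop
    extends IsGraph P t₀ γ γ' L r where
  pos_iff : ∀ z, dist z (P.X t₀) < r → (0 < P.φ z ↔ 0 < height P t₀ γ z)

/-- The two half-boxes over and under a graph, on which `φ` is positive and negative. -/
theorem IsGraph.exists_sides (hP : P.Admissible) {t₀ L r : ℝ} {γ γ' : ℝ → ℝ}
    (h : IsGraph P t₀ γ γ' L r) : ∃ V : Phase → Set Plane, (∀ s, IsPreconnected (V s)) ∧
      (∀ s, V s ⊆ P.openRect) ∧ (∀ z ∈ V Phase.plus, 0 < P.φ z) ∧ (∀ z ∈ V Phase.minus, P.φ z < 0) ∧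
      ∀ z, dist z (P.X t₀) < r / 16 → (0 < height P t₀ γ z → z ∈ V Phase.plus) ∧
        (height P t₀ γ z < 0 → z ∈ V Phase.minus) := by
  have hr := h.r_pos
  set I : Phase → Set ℝ := fun s => match s with
    | Phase.plus => Set.Ioo 0 (r / 4)
    | Phase.minus => Set.Ioo (-(r / 4)) 0 with hI
  have hIabs : ∀ s, ∀ η ∈ I s, |η| < r / 4 ∧ η ≠ 0 := by
    intro s η hη
    cases s
    · exact ⟨abs_lt.mpr ⟨hη.1, by linarith [hη.2]⟩, hη.2.ne⟩
    · exact ⟨abs_lt.mpr ⟨by linarith [hη.1], hη.2⟩, hη.1.ne'⟩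
  have hIc : ∀ s, IsPreconnected (I s) := by
    intro s; cases s <;> exact isPreconnected_Ioo
  set V : Phase → Set Plane := fun s => ofHeight P t₀ γ '' (Set.Ioo (-(r / 4)) (r / 4) ×ˢ I s)
  have hVc : ∀ s, IsPreconnected (V s) := fun s => h.isPreconnected_image (hIc s)
  have hVd : ∀ s, ∀ z ∈ V s, dist z (P.X t₀) < r := by
    rintro s _ ⟨y, hy, rfl⟩
    exact h.dist_ofHeight_lt hP (abs_lt.mpr hy.1) (hIabs s _ hy.2).1
  have hVR : ∀ s, V s ⊆ P.openRect := fun s z hz => h.mem_openRect z (hVd s z hz)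
  have hVΓ : ∀ s, ∀ z ∈ V s, z ∉ P.interface := by
    intro s z hz hzΓ
    rw [h.mem_interface_iff z (hVd s z hz)] at hzΓ
    obtain ⟨y, hy, rfl⟩ := hz
    rw [height_ofHeight hP] at hzΓ
    exact (hIabs s _ hy.2).2 hzΓ
  have hev := (hP.φ_sign t₀).and (Ioo_mem_nhdsGT (show (0 : ℝ) < r / 4 by linarith))
  obtain ⟨ε, ⟨hεm, hεp⟩, hε0, hεr⟩ := hev.exists
  have hz0 : (0 : ℝ) ∈ Set.Ioo (-(r / 4)) (r / 4) := ⟨by linarith, by linarith⟩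
  have hp : P.X t₀ + ε • P.normal t₀ ∈ V Phase.plus :=
    ⟨(0, ε), ⟨hz0, hε0, hεr⟩, by simp [ofHeight, h.zero]⟩
  have hm : P.X t₀ - ε • P.normal t₀ ∈ V Phase.minus :=
    ⟨(0, -ε), ⟨hz0, show -(r / 4) < -ε by linarith, show -ε < 0 by linarith⟩, by
      simp [ofHeight, h.zero, sub_eq_add_neg]⟩
  have hsub : ∀ s, V s ⊆ P.rect := fun s => (hVR s).trans P.openRect_subset_rect
  refine ⟨V, hVc, hVR, fun z hz => ?_, fun z hz => ?_, fun z hz => ?_⟩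
  · exact hP.φ_sign_of_isPreconnected (hVc Phase.plus) (hsub Phase.plus) (hVΓ Phase.plus) hp hz hεp
  · refine lt_of_le_of_ne (not_lt.mp fun hpos => ?_) fun h0 => ?_
    · have := hP.φ_sign_of_isPreconnected (hVc Phase.minus) (hsub Phase.minus) (hVΓ Phase.minus) hz hm hpos
      linarith
    · exact hVΓ Phase.minus z hz ((hP.φ_eq_zero_iff (hsub Phase.minus hz)).mp h0)
  · have h1 := abs_tangent_le hP t₀ (z - P.X t₀)
    rw [← dist_eq_norm] at h1
    have h2 := abs_le.mp (h.abs_height_le hP (z := z) (by linarith))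
    have hmem : inner ℝ (deriv P.X t₀) (z - P.X t₀) ∈ Set.Ioo (-(r / 4)) (r / 4) :=
      abs_lt.mp (h1.trans_lt (by linarith))
    exact ⟨fun h0 => ⟨_, ⟨hmem, h0, show height P t₀ γ z < r / 4 by linarith⟩,
        ofHeight_height hP t₀ γ z⟩,
      fun h0 => ⟨_, ⟨hmem, show -(r / 4) < height P t₀ γ z by linarith, h0⟩,
        ofHeight_height hP t₀ γ z⟩⟩

theorem exists_isChart (hP : P.Admissible) (t₀ : ℝ) : ∃ γ γ' L r, IsChart P t₀ γ γ' L r := by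
  obtain ⟨γ, γ', L, r, h⟩ := exists_isGraph hP t₀
  have hr := h.r_pos
  obtain ⟨V, -, hR, hp, hm, hV⟩ := h.exists_sides hP
  refine ⟨γ, γ', L, r / 16, h.mono (by linarith) (by linarith), fun z hz => ?_⟩
  obtain ⟨h1, h2⟩ := hV z hz
  refine ⟨fun h0 => ?_, fun h0 => hp z (h1 h0)⟩
  rcases lt_trichotomy (height P t₀ γ z) 0 with h3 | h3 | h3
  · linarith [hm z (h2 h3)]
  · have hz' : dist z (P.X t₀) < r := by linarith
    have := (hP.φ_eq_zero_iff (P.openRect_subset_rect (h.mem_openRect z hz'))).mpr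
      ((h.mem_interface_iff z hz').mpr h3)
    linarith
  · exact h3

/-- Gradient of the height, if `γ'` is the derivative of `γ`. -/
def heightGrad (P : InterfaceProblem) (t₀ : ℝ) (γ' : ℝ → ℝ) (z : Plane) : Plane :=
  P.normal t₀ - γ' (inner ℝ (deriv P.X t₀) (z - P.X t₀)) • deriv P.X t₀

namespace IsGraph

variable {t₀ L r : ℝ} {γ γ' : ℝ → ℝ} (h : IsGraph P t₀ γ γ' L r)
include h

theorem height_taylor (hP : P.Admissible) {y z : Plane} (hy : dist y (P.X t₀) < r)
    (hz : dist z (P.X t₀) < r) :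
    |height P t₀ γ z - height P t₀ γ y - inner ℝ (heightGrad P t₀ γ' y) (z - y)|
      ≤ L * ‖z - y‖ ^ 2 := by
  rw [dist_eq_norm] at hy hz
  have h1 := abs_tangent_le hP t₀ (y - P.X t₀)
  have h2 := abs_tangent_le hP t₀ (z - P.X t₀)
  have h3 := h.taylor _ _ (h1.trans_lt hy) (h2.trans_lt hz)
  have e : ∀ g : Plane, (inner ℝ g (z - P.X t₀) : ℝ)
      = inner ℝ g (y - P.X t₀) + inner ℝ g (z - y) := fun g => by
    rw [← inner_add_right]; congr 1; abel
  have h4 : |inner ℝ (deriv P.X t₀) (z - P.X t₀) - inner ℝ (deriv P.X t₀) (y - P.X t₀)|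
      ≤ ‖z - y‖ := by
    rw [e, add_sub_cancel_left]; exact abs_tangent_le hP t₀ _
  rw [height, height, heightGrad, inner_sub_left, real_inner_smul_left, ← abs_neg]
  calc _ = |γ (inner ℝ (deriv P.X t₀) (z - P.X t₀)) - γ (inner ℝ (deriv P.X t₀) (y - P.X t₀))
        - γ' (inner ℝ (deriv P.X t₀) (y - P.X t₀)) *
          (inner ℝ (deriv P.X t₀) (z - P.X t₀) - inner ℝ (deriv P.X t₀) (y - P.X t₀))| := by
        congr 1
        linear_combination (-1 : ℝ) * e (P.normal t₀)
          + γ' (inner ℝ (deriv P.X t₀) (y - P.X t₀)) * e (deriv P.X t₀)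
    _ ≤ _ := h3
    _ ≤ _ := by gcongr; exact h.L_nonneg

theorem norm_heightGrad (hP : P.Admissible) {z : Plane} (hz : dist z (P.X t₀) < r) :
    1 ≤ ‖heightGrad P t₀ γ' z‖ ∧ ‖heightGrad P t₀ γ' z‖ ≤ 2 := by
  rw [dist_eq_norm] at hz
  have h1 := abs_le.mp
    (h.abs_deriv_le ((abs_tangent_le hP t₀ (z - P.X t₀)).trans_lt hz))
  have h2 : ‖heightGrad P t₀ γ' z‖ ^ 2
      = 1 + γ' (inner ℝ (deriv P.X t₀) (z - P.X t₀)) ^ 2 := by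
    rw [heightGrad, norm_sub_sq_real, real_inner_smul_right, inner_normal_deriv, norm_smul,
      norm_normal hP, hP.X_arclength, Real.norm_eq_abs, mul_one, sq_abs]
    ring
  have h3 := norm_nonneg (heightGrad P t₀ γ' z)
  constructor <;> nlinarith

/-- On the interface the gradient of the height is normal. -/
theorem heightGrad_X (hP : P.Admissible) {t : ℝ} (ht : dist (P.X t) (P.X t₀) < r) :
    ∃ m : ℝ, |m| ≤ 2 ∧ 1 ≤ |m| ∧ heightGrad P t₀ γ' (P.X t) = m • P.normal t := by
  have hz := ht
  rw [dist_eq_norm] at ht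
  have h1 : HasDerivAt (fun s => height P t₀ γ (P.X s))
      (inner ℝ (P.normal t₀) (deriv P.X t) - γ' (inner ℝ (deriv P.X t₀) (P.X t - P.X t₀))
        * inner ℝ (deriv P.X t₀) (deriv P.X t)) t :=
    (hasDerivAt_inner_X hP (P.normal t₀) (P.X t₀) t).sub
      ((h.hasDerivAt ((abs_tangent_le hP t₀ _).trans_lt ht)).comp t
        (hasDerivAt_inner_X hP (deriv P.X t₀) (P.X t₀) t))
  have h2 : (fun s => height P t₀ γ (P.X s)) =ᶠ[𝓝 t] fun _ => 0 := by
    have hc : Filter.Tendsto (fun s => dist (P.X s) (P.X t₀)) (𝓝 t) (𝓝 (dist (P.X t) (P.X t₀))) :=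
      (hP.X_smooth.continuous.dist continuous_const).tendsto t
    filter_upwards [hc.eventually (gt_mem_nhds hz)] with s hs
    exact (h.mem_interface_iff _ hs).mp ⟨s, rfl⟩
  have h3 := h1.unique ((hasDerivAt_const t (0 : ℝ)).congr_of_eventuallyEq h2)
  have h4 : inner ℝ (deriv P.X t) (heightGrad P t₀ γ' (P.X t)) = 0 := by
    rw [real_inner_comm, heightGrad, inner_sub_left, real_inner_smul_left, h3]
  have h5 := eq_tangent_add_normal hP t (heightGrad P t₀ γ' (P.X t))
  rw [h4, zero_smul, zero_add] at h5
  refine ⟨inner ℝ (P.normal t) (heightGrad P t₀ γ' (P.X t)), ?_, ?_, h5⟩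
  all_goals
    have h6 := h.norm_heightGrad hP hz
    have h7 : ‖heightGrad P t₀ γ' (P.X t)‖
        = |inner ℝ (P.normal t) (heightGrad P t₀ γ' (P.X t))| := by
      conv_lhs => rw [h5]
      rw [norm_smul, norm_normal hP, mul_one, Real.norm_eq_abs]
    linarith

end IsGraph

end TwoGrid

end

noncomputable section

namespace TwoGrid

open Grid InterfaceProblem Scheme

variable {P : InterfaceProblem} {T : Grid} {S : Scheme}

/-! ### Test functions at the interface -/

/-- The convex function `z² / k`, continued linearly outside the interval `|z| ≤ R k`. Its slope is
bounded by `2 R` uniformly in `k`, while its second derivative near `0` is `2 / k`. -/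
def hub (R k z : ℝ) : ℝ := if |z| ≤ R * k then z ^ 2 / k else 2 * R * |z| - R ^ 2 * k

theorem mul_sub_le_hub {R k p : ℝ} (hk : 0 < k) (hp : |p| ≤ 2 * R) (z : ℝ) :
    p * z - p ^ 2 * k / 4 ≤ hub R k z := by
  unfold hub
  split_ifs with h
  · rw [le_div_iff₀ hk]
    nlinarith [sq_nonneg (z - p * k / 2)]
  · push Not at h
    have h1 : p * z ≤ |p| * |z| := by rw [← abs_mul]; exact le_abs_self _
    have h2 : (2 * R - |p|) * (R * k) ≤ (2 * R - |p|) * |z| :=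
      mul_le_mul_of_nonneg_left h.le (by linarith)
    have h3 : 0 ≤ (2 * R - |p|) ^ 2 * k := by positivity
    nlinarith [sq_abs p]

/-- `hub` is the supremum of the affine functions `p z - p² k / 4`, `|p| ≤ 2 R`, and it is attained. -/
theorem exists_hub_eq {R k : ℝ} (hR : 0 ≤ R) (hk : 0 < k) (z : ℝ) :
    ∃ p, |p| ≤ 2 * R ∧ hub R k z = p * z - p ^ 2 * k / 4 := by
  unfold hub
  split_ifs with h
  · refine ⟨2 * z / k, ?_, by field_simp; ring⟩
    rw [abs_div, abs_mul, abs_two, abs_of_pos hk, div_le_iff₀ hk]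
    linarith
  · rcases le_total 0 z with hz | hz
    · exact ⟨2 * R, by rw [abs_of_nonneg (by positivity)], by rw [abs_of_nonneg hz]; ring⟩
    · exact ⟨-(2 * R), by rw [abs_neg, abs_of_nonneg (by positivity)], by
        rw [abs_of_nonpos hz]; ring⟩

theorem hub_nonneg {R k : ℝ} (hR : 0 ≤ R) (hk : 0 < k) (z : ℝ) : 0 ≤ hub R k z := by
  simpa using mul_sub_le_hub hk (p := 0) (by simpa using hR) z

theorem hub_le {R k : ℝ} (hR : 0 ≤ R) (hk : 0 < k) (z : ℝ) : hub R k z ≤ 2 * R * |z| := by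
  obtain ⟨p, hp, h⟩ := exists_hub_eq hR hk z
  rw [h]
  have h1 : p * z ≤ |p| * |z| := by rw [← abs_mul]; exact le_abs_self _
  have h2 : |p| * |z| ≤ 2 * R * |z| := by gcongr
  have h3 : 0 ≤ p ^ 2 * k / 4 := by positivity
  linarith

theorem hub_of_le {R k z : ℝ} (h : |z| ≤ R * k) : hub R k z = z ^ 2 / k := if_pos h

/-- Test function near `X t₀`, in terms of the height `ζ` and the tangential coordinate `ξ`.  The
linear term `B ζ` increases towards one side of the interface; division by `κ` makes the result of
the rows of the immersed interface scheme bounded.  The terms `hub R k` and `hub R h` have second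
differences of size `1 / k` at the irregular points and `1 / h` at the hanging points, `N ζ²`
dominates the curvature terms at the other points, and `-ξ²` makes the function negative along the
interface away from `X t₀`. -/
def interfaceTest (P : InterfaceProblem) (t₀ : ℝ) (γ : ℝ → ℝ) (B N R k h : ℝ) (z : Plane) : ℝ :=
  (B * height P t₀ γ z + hub R k (height P t₀ γ z) + hub R h (height P t₀ γ z)) / P.κ (P.phase z)
    + N * height P t₀ γ z ^ 2 - (inner ℝ (deriv P.X t₀) (z - P.X t₀) : ℝ) ^ 2

section ExactRow

variable {n : ℕ} {a : Node} {t₀ L r : ℝ} {γ γ' : ℝ → ℝ} {d : ℝ}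

theorem Scheme.ExactRow.le_sum_hub (h : ExactRow P T S n a) (hn : 2 < n)
    (hs : ∀ b ∈ T.stencil P a, b ≠ a → 0 ≤ S.α a b) {f : Node → ℝ} {g : Plane} {C : ℝ}
    (hf : ∀ b ∈ T.stencil P a, |f b - f a - inner ℝ g (T.point P b - T.point P a)|
      ≤ C * ‖T.point P b - T.point P a‖ ^ 2) {R k : ℝ} (hR : 0 ≤ R) (hk : 0 < k) :
    -(8 * P.κ (P.phase (T.point P a)) * C * R)
      ≤ ∑ b ∈ T.stencil P a, S.α a b * (hub R k (f b) - hub R k (f a)) := by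
  obtain ⟨p, hp, he⟩ := exists_hub_eq hR hk (f a)
  have := h.le_sum_convex hn hs hf (F := fun b => hub R k (f b)) hp fun b _ => by
    have := mul_sub_le_hub hk hp (f b)
    rw [he]; linarith
  linarith

/-- Rows at regular and hanging points, applied to the test function. -/
theorem Scheme.ExactRow.le_sum_interfaceTest (hP : P.Admissible) (h : ExactRow P T S n a)
    (hn : 2 < n) (hs : ∀ b ∈ T.stencil P a, b ≠ a → 0 ≤ S.α a b) (hG : IsGraph P t₀ γ γ' L r)
    (hd : ∀ b ∈ T.stencil P a, ‖T.point P b - T.point P a‖ ≤ d) (hd0 : 0 ≤ d)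
    (had : dist (T.point P a) (P.X t₀) + d < r) {B N R k l c : ℝ} (hN : 0 ≤ N) (hR : 0 ≤ R)
    (hk : 0 < k) (hc : c ≤ ∑ b ∈ T.stencil P a, S.α a b *
      (hub R l (height P t₀ γ (T.point P b)) - hub R l (height P t₀ γ (T.point P a)))) :
    P.κ (P.phase (T.point P a)) *
        (N * (1 - 4 * L ^ 2 * d ^ 2 - 8 * L * |height P t₀ γ (T.point P a)|) - 2)
      - 4 * |B| * L - 8 * L * R + c / P.κ (P.phase (T.point P a))
      ≤ ∑ b ∈ T.stencil P a, S.α a b * (interfaceTest P t₀ γ B N R k l (T.point P b)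
        - interfaceTest P t₀ γ B N R k l (T.point P a)) := by
  have hκ := hP.κ_pos (P.phase (T.point P a))
  set κ := P.κ (P.phase (T.point P a)) with hκdef
  set ζ : Node → ℝ := fun b => height P t₀ γ (T.point P b) with hζ
  set ξ : Node → ℝ := fun b => inner ℝ (deriv P.X t₀) (T.point P b - P.X t₀) with hξ
  set g := heightGrad P t₀ γ' (T.point P a)
  have har : dist (T.point P a) (P.X t₀) < r := by linarith
  have hf : ∀ b ∈ T.stencil P a, |ζ b - ζ a - inner ℝ g (T.point P b - T.point P a)|
      ≤ L * ‖T.point P b - T.point P a‖ ^ 2 := fun b hb => by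
    refine hG.height_taylor hP har ?_
    have h1 := dist_triangle (T.point P b) (T.point P a) (P.X t₀)
    have h2 := hd b hb
    rw [← dist_eq_norm] at h2
    linarith
  have h1 := h.abs_sum_sub_le hn hs hf
  have h2 := h.le_sum_sq_sub_sq hn hs hf hP hd
  have h3 := h.le_sum_hub hn hs hf hR hk
  have h4 : ∑ b ∈ T.stencil P a, S.α a b * (ξ b ^ 2 - ξ a ^ 2) = 2 * κ := by
    have e1 := h.sum_inner hn (deriv P.X t₀)
    have e2 := h.sum_two hn (deriv P.X t₀)
    rw [hP.X_arclength, one_pow, mul_one] at e2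
    rw [← hκdef] at e2
    have e : ∀ b, ξ b = ξ a + inner ℝ (deriv P.X t₀) (T.point P b - T.point P a) := fun b => by
      rw [hξ, ← inner_add_right, add_comm, sub_add_sub_cancel]
    calc _ = 2 * ξ a * ∑ b ∈ T.stencil P a, S.α a b *
          inner ℝ (deriv P.X t₀) (T.point P b - T.point P a)
          + ∑ b ∈ T.stencil P a, S.α a b *
            inner ℝ (deriv P.X t₀) (T.point P b - T.point P a) ^ 2 := by
          rw [Finset.mul_sum, ← Finset.sum_add_distrib]
          refine Finset.sum_congr rfl fun b _ => ?_
          rw [e b]; ring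
      _ = _ := by rw [e1, e2]; ring
  have hg : 1 ≤ ‖g‖ ^ 2 := by
    have := (hG.norm_heightGrad hP har).1
    nlinarith
  set A1 := ∑ b ∈ T.stencil P a, S.α a b * (ζ b - ζ a)
  set A2 := ∑ b ∈ T.stencil P a, S.α a b * (ζ b ^ 2 - ζ a ^ 2)
  set A3 := ∑ b ∈ T.stencil P a, S.α a b * (hub R k (ζ b) - hub R k (ζ a))
  set A4 := ∑ b ∈ T.stencil P a, S.α a b * (hub R l (ζ b) - hub R l (ζ a))
  set A5 := ∑ b ∈ T.stencil P a, S.α a b * (ξ b ^ 2 - ξ a ^ 2)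
  have e : ∑ b ∈ T.stencil P a, S.α a b * (interfaceTest P t₀ γ B N R k l (T.point P b)
        - interfaceTest P t₀ γ B N R k l (T.point P a))
      = (B * A1 + A3 + A4) / κ + N * A2 - A5 := by
    simp only [A1, A2, A3, A4, A5, Finset.mul_sum, ← Finset.sum_add_distrib,
      ← Finset.sum_sub_distrib, Finset.sum_div]
    refine Finset.sum_congr rfl fun b hb => ?_
    by_cases hα : S.α a b = 0
    · simp [hα]
    · rw [interfaceTest, interfaceTest, h.phase_eq b hb (Or.inl hα)]
      ring
  rw [e, h4]
  have h5 : -(4 * κ * L * |B|) ≤ B * A1 := by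
    have : |B * A1| ≤ |B| * (4 * κ * L) := by rw [abs_mul]; gcongr
    linarith [(abs_le.mp this).1]
  have h6 : (-(4 * κ * L * |B|) - 8 * κ * L * R + c) / κ ≤ (B * A1 + A3 + A4) / κ := by
    gcongr
    linarith
  have h7 : (-(4 * κ * L * |B|) - 8 * κ * L * R + c) / κ = -(4 * |B| * L) - 8 * L * R + c / κ := by
    field_simp
  have h8 : N * (κ * (1 - 4 * L ^ 2 * d ^ 2 - 8 * L * |ζ a|)) ≤ N * A2 := by
    refine mul_le_mul_of_nonneg_left (le_trans ?_ h2) hN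
    refine mul_le_mul_of_nonneg_left ?_ hκ.le
    linarith
  linarith

/-- At a hanging point the term `hub R h` has a second difference of size `1 / h`. -/
theorem Scheme.ExactRow.le_sum_hub_of_le (hP : P.Admissible) (h : ExactRow P T S n a)
    (hn : 2 < n) (hs : ∀ b ∈ T.stencil P a, b ≠ a → 0 ≤ S.α a b) (hG : IsGraph P t₀ γ γ' L r)
    (hd : ∀ b ∈ T.stencil P a, ‖T.point P b - T.point P a‖ ≤ d) (hd0 : 0 ≤ d)
    (had : dist (T.point P a) (P.X t₀) + d < r) {R l : ℝ} (hl : 0 < l)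
    (hζ : ∀ b ∈ T.stencil P a, |height P t₀ γ (T.point P b)| ≤ R * l) (ha : a ∈ T.stencil P a) :
    P.κ (P.phase (T.point P a)) *
        (1 - 4 * L ^ 2 * d ^ 2 - 8 * L * |height P t₀ γ (T.point P a)|) / l
      ≤ ∑ b ∈ T.stencil P a, S.α a b *
        (hub R l (height P t₀ γ (T.point P b)) - hub R l (height P t₀ γ (T.point P a))) := by
  have hκ := hP.κ_pos (P.phase (T.point P a))
  have har : dist (T.point P a) (P.X t₀) < r := by linarith
  have h2 := h.le_sum_sq_sub_sq hn hs (f := fun b => height P t₀ γ (T.point P b))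
    (fun b hb => hG.height_taylor hP har (by
      have h1 := dist_triangle (T.point P b) (T.point P a) (P.X t₀)
      have h2 := hd b hb
      rw [← dist_eq_norm] at h2
      linarith)) hP hd
  have hg : 1 ≤ ‖heightGrad P t₀ γ' (T.point P a)‖ ^ 2 := by
    have := (hG.norm_heightGrad hP har).1
    nlinarith
  have e : ∑ b ∈ T.stencil P a, S.α a b *
        (hub R l (height P t₀ γ (T.point P b)) - hub R l (height P t₀ γ (T.point P a)))
      = (∑ b ∈ T.stencil P a, S.α a b *
        (height P t₀ γ (T.point P b) ^ 2 - height P t₀ γ (T.point P a) ^ 2)) / l := by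
    rw [Finset.sum_div]
    refine Finset.sum_congr rfl fun b hb => ?_
    rw [hub_of_le (hζ b hb), hub_of_le (hζ a ha)]
    ring
  rw [e]
  gcongr
  refine le_trans ?_ h2
  refine mul_le_mul_of_nonneg_left ?_ hκ.le
  linarith

end ExactRow

theorem exists_curvCoeff_le (hP : P.Admissible) :
    ∃ C, 0 ≤ C ∧ ∀ t s, |curvCoeff P t s| ≤ C := by
  obtain ⟨C, hC, h⟩ := exists_bound_deriv2 hP
  refine ⟨|(P.κ Phase.plus)⁻¹ - (P.κ Phase.minus)⁻¹| * C, by positivity, fun t s => ?_⟩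
  cases s
  · simp only [curvCoeff, abs_zero]; positivity
  · have h1 : |inner ℝ (P.normal t) (deriv (deriv P.X) t)| ≤ C :=
      (abs_normal_le hP t _).trans (h t)
    simp only [curvCoeff]
    rw [abs_div, abs_mul, abs_neg, abs_two]
    have : |(P.κ Phase.plus)⁻¹ - (P.κ Phase.minus)⁻¹| *
        |inner ℝ (P.normal t) (deriv (deriv P.X) t)|
        ≤ |(P.κ Phase.plus)⁻¹ - (P.κ Phase.minus)⁻¹| * C := by gcongr
    have h2 : 0 ≤ |(P.κ Phase.plus)⁻¹ - (P.κ Phase.minus)⁻¹| *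
        |inner ℝ (P.normal t) (deriv (deriv P.X) t)| := by positivity
    linarith

theorem abs_sum_mul_le {ι : Type*} {s : Finset ι} {k K₀ E : ℝ} (hk : 0 < k) (hK : 0 ≤ K₀)
    (hE : 0 ≤ E) (hs : (s.card : ℝ) ≤ 25) {α F : ι → ℝ} (hα : ∀ b ∈ s, |α b| ≤ K₀ / k ^ 2)
    (hF : ∀ b ∈ s, |F b| ≤ E * k ^ 2) : |∑ b ∈ s, α b * F b| ≤ 25 * (K₀ * E) := by
  refine abs_sum_le_card (mul_nonneg hK hE) hs fun b hb => ?_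
  rw [abs_mul]
  calc |α b| * |F b| ≤ K₀ / k ^ 2 * (E * k ^ 2) :=
        mul_le_mul (hα b hb) (hF b hb) (abs_nonneg _) (by positivity)
    _ = K₀ * E := by field_simp

section Moments

variable {ι : Type*} {s : Finset ι} {α q w τ η ζ : ι → ℝ} {k K₀ κ₀ L Cc m : ℝ}

/-- First moment of `q ζ`, if `ζ` is close to `m η` and `q η + w (τ² - η²)` has first moment `0`. -/
theorem abs_first_moment_le (hk : 0 < k) (hK : 0 ≤ K₀) (hL : 0 ≤ L) (hκ₀ : 0 < κ₀) (hC : 0 ≤ Cc)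
    (hs : (s.card : ℝ) ≤ 25) (hα : ∀ b ∈ s, |α b| ≤ K₀ / k ^ 2)
    (hm : |m| ≤ 2) (hq0 : ∀ b, 0 ≤ q b) (hqκ : ∀ b, q b ≤ κ₀⁻¹) (hw : ∀ b, |w b| ≤ Cc)
    (hη : ∀ b ∈ s, |η b| ≤ 3 * k) (hτ : ∀ b ∈ s, |τ b| ≤ 3 * k)
    (hζ : ∀ b ∈ s, |ζ b - m * η b| ≤ 9 * L * k ^ 2)
    (m1 : ∑ b ∈ s, α b * (q b * η b + w b * (τ b ^ 2 - η b ^ 2)) = 0) :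
    |∑ b ∈ s, α b * (q b * ζ b)|
      ≤ 2 * (25 * (K₀ * (18 * Cc))) + 25 * (K₀ * (9 * L / κ₀)) := by
  have e : ∑ b ∈ s, α b * (q b * ζ b) = -(m * ∑ b ∈ s, α b * (w b * (τ b ^ 2 - η b ^ 2)))
      + ∑ b ∈ s, α b * (q b * (ζ b - m * η b)) := by
    have : m * ∑ b ∈ s, α b * (q b * η b + w b * (τ b ^ 2 - η b ^ 2)) = 0 := by
      rw [m1, mul_zero]
    rw [Finset.mul_sum] at this ⊢
    rw [← sub_eq_zero, ← this, ← Finset.sum_neg_distrib, ← Finset.sum_add_distrib,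
      ← Finset.sum_sub_distrib]
    exact Finset.sum_congr rfl fun b _ => by ring
  have h1 : |∑ b ∈ s, α b * (w b * (τ b ^ 2 - η b ^ 2))| ≤ 25 * (K₀ * (18 * Cc)) := by
    refine abs_sum_mul_le hk hK (by positivity) hs hα fun b hb => ?_
    have h2 : |τ b ^ 2 - η b ^ 2| ≤ 18 * k ^ 2 := by
      have h3 := sq_le_sq' (abs_le.mp (hτ b hb)).1 (abs_le.mp (hτ b hb)).2
      have h4 := sq_le_sq' (abs_le.mp (hη b hb)).1 (abs_le.mp (hη b hb)).2
      rw [abs_le]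
      constructor <;> nlinarith [sq_nonneg (τ b), sq_nonneg (η b)]
    rw [abs_mul]
    calc |w b| * |τ b ^ 2 - η b ^ 2| ≤ Cc * (18 * k ^ 2) :=
          mul_le_mul (hw _) h2 (abs_nonneg _) hC
      _ = 18 * Cc * k ^ 2 := by ring
  have h2 : |∑ b ∈ s, α b * (q b * (ζ b - m * η b))| ≤ 25 * (K₀ * (9 * L / κ₀)) := by
    refine abs_sum_mul_le hk hK (by positivity) hs hα fun b hb => ?_
    rw [abs_mul, abs_of_nonneg (hq0 b)]
    calc q b * |ζ b - m * η b| ≤ κ₀⁻¹ * (9 * L * k ^ 2) :=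
          mul_le_mul (hqκ b) (hζ b hb) (abs_nonneg _) (by positivity)
      _ = 9 * L / κ₀ * k ^ 2 := by ring
  rw [e]
  refine (abs_add_le _ _).trans (add_le_add ?_ h2)
  rw [abs_neg, abs_mul]
  exact mul_le_mul hm h1 (abs_nonneg _) (by norm_num)

/-- Second moment of `ζ`, if `ζ` is close to `m η`. -/
theorem one_le_second_moment (hk : 0 < k) (hK : 0 ≤ K₀) (hL : 0 ≤ L) (hκ₀ : 0 < κ₀)
    (hs : (s.card : ℝ) ≤ 25) (hα : ∀ b ∈ s, |α b| ≤ K₀ / k ^ 2)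
    (hm : 1 ≤ |m|) (hq0 : ∀ b, 0 ≤ q b) (hqκ : ∀ b, q b ≤ κ₀⁻¹)
    (hζ : ∀ b ∈ s, |ζ b - m * η b| ≤ 9 * L * k ^ 2) (hmη : ∀ b ∈ s, |m * η b| ≤ 6 * k)
    (hζ9 : ∀ b ∈ s, |ζ b| ≤ 9 * k)
    (m2 : ∑ b ∈ s, α b * (q b * η b ^ 2) = 2) (hsmall : 25 * (K₀ * (135 * L / κ₀)) * k ≤ 1) :
    1 ≤ ∑ b ∈ s, α b * (q b * ζ b ^ 2) := by
  have e : ∑ b ∈ s, α b * (q b * ζ b ^ 2)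
      = 2 * m ^ 2 + ∑ b ∈ s, α b * (q b * (ζ b ^ 2 - (m * η b) ^ 2)) := by
    rw [← m2, Finset.sum_mul, ← Finset.sum_add_distrib]
    exact Finset.sum_congr rfl fun b _ => by ring
  have h1 : |∑ b ∈ s, α b * (q b * (ζ b ^ 2 - (m * η b) ^ 2))|
      ≤ 25 * (K₀ * (135 * L / κ₀ * k)) := by
    refine abs_sum_mul_le hk hK (by positivity) hs hα fun b hb => ?_
    have h2 : |ζ b ^ 2 - (m * η b) ^ 2| ≤ 9 * L * k ^ 2 * (15 * k) := by
      rw [show ζ b ^ 2 - (m * η b) ^ 2 = (ζ b - m * η b) * (ζ b + m * η b) by ring, abs_mul]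
      refine mul_le_mul (hζ b hb) ((abs_add_le _ _).trans ?_) (abs_nonneg _) (by positivity)
      linarith [hζ9 b hb, hmη b hb]
    rw [abs_mul, abs_of_nonneg (hq0 b)]
    calc q b * |ζ b ^ 2 - (m * η b) ^ 2| ≤ κ₀⁻¹ * (9 * L * k ^ 2 * (15 * k)) :=
          mul_le_mul (hqκ b) h2 (abs_nonneg _) (by positivity)
      _ = 135 * L / κ₀ * k * k ^ 2 := by ring
  have h3 : 1 ≤ m ^ 2 := by rw [← sq_abs]; nlinarith
  rw [e]
  linarith [(abs_le.mp h1).1]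

/-- A sum of squares over a stencil of diameter `O(k)`, at distance `ρ` from the zero. -/
theorem abs_sum_sq_le (hk : 0 < k) (hK : 0 ≤ K₀) {ρ : ℝ} (hρ : 0 ≤ ρ) (hs : (s.card : ℝ) ≤ 25)
    (hα : ∀ b ∈ s, |α b| ≤ K₀ / k ^ 2) (m0 : ∑ b ∈ s, α b = 0) {ξ : ι → ℝ} {c : ℝ}
    (hc : |c| ≤ ρ) (hξ : ∀ b ∈ s, |ξ b| ≤ ρ) (hξc : ∀ b ∈ s, |ξ b - c| ≤ 2 * k) :
    |∑ b ∈ s, α b * ξ b ^ 2| ≤ 25 * (K₀ * (4 * ρ)) / k := by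
  have e : ∑ b ∈ s, α b * ξ b ^ 2 = ∑ b ∈ s, α b * (ξ b ^ 2 - c ^ 2) := by
    simp only [mul_sub, Finset.sum_sub_distrib, ← Finset.sum_mul, m0, zero_mul, sub_zero]
  have h1 : |∑ b ∈ s, α b * (ξ b ^ 2 - c ^ 2)| ≤ 25 * (K₀ * (4 * ρ / k)) := by
    refine abs_sum_mul_le hk hK (by positivity) hs hα fun b hb => ?_
    rw [show ξ b ^ 2 - c ^ 2 = (ξ b - c) * (ξ b + c) by ring, abs_mul]
    calc |ξ b - c| * |ξ b + c| ≤ 2 * k * (ρ + ρ) := mul_le_mul (hξc b hb)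
          ((abs_add_le _ _).trans (add_le_add (hξ b hb) hc)) (abs_nonneg _) (by positivity)
      _ = 4 * ρ / k * k ^ 2 := by field_simp; ring
  rw [e]
  refine h1.trans (le_of_eq ?_)
  ring

end Moments

/-- Rows of the immersed interface scheme, applied to the test function. -/
theorem immersed_le_sum_interfaceTest (hP : P.Admissible) {a : Node} {t₀ t L r : ℝ}
    {γ γ' : ℝ → ℝ} (hG : IsGraph P t₀ γ γ' L r) {κ₀ Cc K₀ k l R ρ : ℝ} (hκ₀ : 0 < κ₀)
    (hκ : ∀ s, κ₀ ≤ P.κ s) (hCc : ∀ s, |curvCoeff P t s| ≤ Cc) (hk : 0 < k) (hkl : k ≤ l)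
    (hK : 0 ≤ K₀) (hα : ∀ b ∈ nine a 1, |S.α a b| ≤ K₀ / k ^ 2)
    (m0 : ∑ b ∈ nine a 1, S.α a b = 0)
    (m2 : ∑ b ∈ nine a 1, S.α a b * ((P.κ (P.phase (T.point P b)))⁻¹ *
      inner ℝ (P.normal t) (T.point P b - P.X t) ^ 2) = 2)
    (m1 : ∑ b ∈ nine a 1, S.α a b * ((P.κ (P.phase (T.point P b)))⁻¹ *
        inner ℝ (P.normal t) (T.point P b - P.X t)
      + curvCoeff P t (P.phase (T.point P b)) * (inner ℝ (deriv P.X t) (T.point P b - P.X t) ^ 2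
        - inner ℝ (P.normal t) (T.point P b - P.X t) ^ 2)) = 0)
    (ht : dist (P.X t) (P.X t₀) < r) (hbr : ∀ b ∈ nine a 1, dist (T.point P b) (P.X t₀) < r)
    (hbt : ∀ b ∈ nine a 1, ‖T.point P b - P.X t‖ ≤ 3 * k) (hR : 9 ≤ R)
    (hab : ∀ b ∈ nine a 1, ‖T.point P b - T.point P a‖ ≤ 2 * k) (ha : a ∈ nine a 1)
    (hρ : ∀ b ∈ nine a 1, dist (T.point P b) (P.X t₀) ≤ ρ) (hLk : 3 * L * k ≤ 1)
    {B N : ℝ} (hN : 0 ≤ N) (hsmall : 25 * (K₀ * (135 * L / κ₀)) * k ≤ 1) :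
    1 / k - |B| * (2 * (25 * (K₀ * (18 * Cc))) + 25 * (K₀ * (9 * L / κ₀)))
        - N * (25 * (K₀ * 81)) - 25 * (K₀ * (4 * ρ)) / k
      ≤ ∑ b ∈ nine a 1, S.α a b * (interfaceTest P t₀ γ B N R k l (T.point P b)
        - interfaceTest P t₀ γ B N R k l (T.point P a)) := by
  have hL := hG.L_nonneg
  have hl : 0 < l := hk.trans_le hkl
  have hρ0 : 0 ≤ ρ := dist_nonneg.trans (hρ a ha)
  have hCc0 : 0 ≤ Cc := (abs_nonneg _).trans (hCc Phase.minus)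
  have hcard : ((nine a 1).card : ℝ) ≤ 25 := by exact_mod_cast card_nine_le a 1
  obtain ⟨m, hm2, hm1, hm⟩ := hG.heightGrad_X hP ht
  have hq0 : ∀ b, 0 ≤ (P.κ (P.phase (T.point P b)))⁻¹ := fun b => (inv_pos.mpr (hP.κ_pos _)).le
  have hqκ : ∀ b, (P.κ (P.phase (T.point P b)))⁻¹ ≤ κ₀⁻¹ := fun b => inv_anti₀ hκ₀ (hκ _)
  have hη3 : ∀ b ∈ nine a 1, |inner ℝ (P.normal t) (T.point P b - P.X t)| ≤ 3 * k := fun b hb =>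
    (abs_normal_le hP t _).trans (hbt b hb)
  have hτ3 : ∀ b ∈ nine a 1, |inner ℝ (deriv P.X t) (T.point P b - P.X t)| ≤ 3 * k :=
    fun b hb => (abs_tangent_le hP t _).trans (hbt b hb)
  have hX0 : height P t₀ γ (P.X t) = 0 := (hG.mem_interface_iff _ ht).mp ⟨t, rfl⟩
  have hζη : ∀ b ∈ nine a 1, |height P t₀ γ (T.point P b)
      - m * inner ℝ (P.normal t) (T.point P b - P.X t)| ≤ 9 * L * k ^ 2 := by
    intro b hb
    have h1 := hG.height_taylor hP ht (hbr b hb)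
    rw [hX0, sub_zero, hm, real_inner_smul_left] at h1
    have h2 : ‖T.point P b - P.X t‖ ^ 2 ≤ (3 * k) ^ 2 :=
      pow_le_pow_left₀ (norm_nonneg _) (hbt b hb) 2
    have h3 := mul_le_mul_of_nonneg_left h2 hL
    linarith
  have hmη : ∀ b ∈ nine a 1, |m * inner ℝ (P.normal t) (T.point P b - P.X t)| ≤ 6 * k :=
    fun b hb => by
      rw [abs_mul]
      have := mul_le_mul hm2 (hη3 b hb) (abs_nonneg _) (by norm_num)
      linarith
  have hζ9 : ∀ b ∈ nine a 1, |height P t₀ γ (T.point P b)| ≤ 9 * k := by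
    intro b hb
    have h1 : 9 * L * k ^ 2 ≤ 3 * k := by nlinarith
    have h2 := abs_le.mp (hζη b hb)
    have h3 := abs_le.mp (hmη b hb)
    rw [abs_le]
    constructor <;> linarith
  have hξ : ∀ b ∈ nine a 1, |inner ℝ (deriv P.X t₀) (T.point P b - P.X t₀)| ≤ ρ := fun b hb => by
    have := abs_tangent_le hP t₀ (T.point P b - P.X t₀)
    rw [← dist_eq_norm] at this
    exact this.trans (hρ b hb)
  have s1 := abs_first_moment_le hk hK hL hκ₀ hCc0 hcard hα hm2 hq0 hqκ
    (fun b => hCc (P.phase (T.point P b))) hη3 hτ3 hζη m1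
  have s2 := one_le_second_moment hk hK hL hκ₀ hcard hα hm1 hq0 hqκ hζη hmη hζ9 m2 hsmall
  have s3 : |∑ b ∈ nine a 1, S.α a b * height P t₀ γ (T.point P b) ^ 2| ≤ 25 * (K₀ * 81) :=
    abs_sum_mul_le hk hK (by norm_num) hcard hα fun b hb => by
      rw [abs_pow]
      have := pow_le_pow_left₀ (abs_nonneg _) (hζ9 b hb) 2
      linarith
  have s4 := abs_sum_sq_le hk hK hρ0 hcard hα m0 (hξ a ha) hξ fun b hb => by
    rw [← inner_sub_right, sub_sub_sub_cancel_right]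
    exact (abs_tangent_le hP t₀ _).trans (hab b hb)
  have e : ∑ b ∈ nine a 1, S.α a b * (interfaceTest P t₀ γ B N R k l (T.point P b)
        - interfaceTest P t₀ γ B N R k l (T.point P a))
      = B * (∑ b ∈ nine a 1, S.α a b *
          ((P.κ (P.phase (T.point P b)))⁻¹ * height P t₀ γ (T.point P b)))
        + (∑ b ∈ nine a 1, S.α a b *
          ((P.κ (P.phase (T.point P b)))⁻¹ * height P t₀ γ (T.point P b) ^ 2)) / k
        + (∑ b ∈ nine a 1, S.α a b *
          ((P.κ (P.phase (T.point P b)))⁻¹ * height P t₀ γ (T.point P b) ^ 2)) / l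
        + N * (∑ b ∈ nine a 1, S.α a b * height P t₀ γ (T.point P b) ^ 2)
        - ∑ b ∈ nine a 1, S.α a b * inner ℝ (deriv P.X t₀) (T.point P b - P.X t₀) ^ 2 := by
    simp only [mul_sub, Finset.sum_sub_distrib, ← Finset.sum_mul, m0, zero_mul, sub_zero]
    simp only [Finset.mul_sum, ← Finset.sum_add_distrib, ← Finset.sum_sub_distrib, Finset.sum_div]
    refine Finset.sum_congr rfl fun b hb => ?_
    have h1 : |height P t₀ γ (T.point P b)| ≤ R * k :=
      (hζ9 b hb).trans (mul_le_mul_of_nonneg_right hR hk.le)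
    have h2 : |height P t₀ γ (T.point P b)| ≤ R * l :=
      h1.trans (mul_le_mul_of_nonneg_left hkl (by linarith))
    rw [interfaceTest, hub_of_le h1, hub_of_le h2]
    ring
  rw [e]
  generalize (∑ b ∈ nine a 1, S.α a b *
    ((P.κ (P.phase (T.point P b)))⁻¹ * height P t₀ γ (T.point P b))) = A1 at *
  generalize (∑ b ∈ nine a 1, S.α a b *
    ((P.κ (P.phase (T.point P b)))⁻¹ * height P t₀ γ (T.point P b) ^ 2)) = A2 at *
  generalize (∑ b ∈ nine a 1, S.α a b * height P t₀ γ (T.point P b) ^ 2) = A3 at *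
  generalize (∑ b ∈ nine a 1, S.α a b *
    inner ℝ (deriv P.X t₀) (T.point P b - P.X t₀) ^ 2) = A4 at *
  have h1 : |B * A1| ≤ |B| * (2 * (25 * (K₀ * (18 * Cc))) + 25 * (K₀ * (9 * L / κ₀))) := by
    rw [abs_mul]; exact mul_le_mul_of_nonneg_left s1 (abs_nonneg _)
  have h2 : 1 / k ≤ A2 / k := div_le_div_of_nonneg_right s2 hk.le
  have h3 : 0 ≤ A2 / l := div_nonneg (by linarith) hl.le
  have h4 : |N * A3| ≤ N * (25 * (K₀ * 81)) := by
    rw [abs_mul, abs_of_nonneg hN]; exact mul_le_mul_of_nonneg_left s3 hN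
  linarith [(abs_le.mp h1).1, (abs_le.mp h4).1, (abs_le.mp s4).2]

end TwoGrid

end

noncomputable section

namespace TwoGrid

open Grid InterfaceProblem Scheme

variable {P : InterfaceProblem} {lam K : ℝ}

/-! ### The strong maximum principle across the interface -/

/-- The test function on a ring around `X t₀`, where `y` is the height, signed so that the test
function increases with it: on the side `y < 0` the linear term wins against the `hub` terms `H`,
`H'`, and for small `y ≥ 0` the term `-ξ²` does. -/
theorem interfaceTest_ring_le {R κ κ₀ κ₁ N r θ ξ y H H' : ℝ} (hR : 0 ≤ R) (hκ₀ : 0 < κ₀)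
    (h0 : κ₀ ≤ κ) (h1 : κ ≤ κ₁) (hN : 0 ≤ N) (hr : 0 < r) (hθ : 0 < θ) (hθ1 : θ ≤ 1)
    (hθr : θ ≤ r / 8) (hsmall : ((8 * R + 1) / κ₀ + N) * θ ≤ r ^ 2 / 128)
    (hH : H ≤ 2 * R * |y|) (hH' : H' ≤ 2 * R * |y|) (hNy : N * |y| ≤ 1 / (2 * κ₁)) (hy : y < θ)
    (hd : r / 8 ≤ |ξ| ∨ r / 8 ≤ |y|) :
    ((4 * R + 1) * y + H + H') / κ + N * y ^ 2 - ξ ^ 2 ≤ -min (r ^ 2 / 128) (r / (16 * κ₁)) := by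
  have hκ : 0 < κ := hκ₀.trans_le h0
  have hκ1 : 0 < κ₁ := hκ.trans_le h1
  rcases le_or_gt 0 y with hy0 | hy0
  · rw [abs_of_nonneg hy0] at hH hH' hNy hd
    have hξ : r / 8 ≤ |ξ| := hd.resolve_right (by linarith)
    have h2 : r ^ 2 / 64 ≤ ξ ^ 2 := by rw [← sq_abs ξ]; nlinarith
    have h3 : ((4 * R + 1) * y + H + H') / κ ≤ (8 * R + 1) / κ₀ * θ := by
      rw [div_mul_eq_mul_div]
      refine div_le_div₀ (by positivity) ?_ hκ₀ h0
      nlinarith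
    have h4 : N * y ^ 2 ≤ N * θ := by
      refine mul_le_mul_of_nonneg_left ?_ hN
      nlinarith
    have h5 := min_le_left (r ^ 2 / 128) (r / (16 * κ₁))
    linarith
  · rw [abs_of_neg hy0] at hH hH' hNy hd
    have h3 : ((4 * R + 1) * y + H + H') / κ ≤ y / κ₁ := by
      have : ((4 * R + 1) * y + H + H') / κ ≤ y / κ := by
        gcongr
        linarith
      refine this.trans ?_
      rw [div_le_div_iff₀ hκ hκ1]
      nlinarith
    have h4 : N * y ^ 2 ≤ -(y / κ₁) / 2 := by
      have : N * -y * -y ≤ 1 / (2 * κ₁) * -y := mul_le_mul_of_nonneg_right hNy (by linarith)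
      calc N * y ^ 2 = N * -y * -y := by ring
        _ ≤ 1 / (2 * κ₁) * -y := this
        _ = _ := by ring
    have h6 : y / κ₁ ≤ 0 := div_nonpos_of_nonpos_of_nonneg hy0.le hκ1.le
    rcases hd with hd | hd
    · have h2 : r ^ 2 / 64 ≤ ξ ^ 2 := by rw [← sq_abs ξ]; nlinarith
      have h5 := min_le_left (r ^ 2 / 128) (r / (16 * κ₁))
      nlinarith [sq_nonneg r]
    · have h2 : y / κ₁ ≤ -(r / 8) / κ₁ := by gcongr; linarith
      have h5 := min_le_right (r ^ 2 / 128) (r / (16 * κ₁))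
      have e : -(r / 8) / κ₁ = -(2 * (r / (16 * κ₁))) := by field_simp; norm_num
      nlinarith [sq_nonneg ξ]

theorem abs_interfaceTest_le (hP : P.Admissible) {t₀ L r r' κ₀ B N R k l : ℝ} {γ γ' : ℝ → ℝ}
    (hG : IsGraph P t₀ γ γ' L r) (hκ₀ : 0 < κ₀) (hκ : ∀ s, κ₀ ≤ P.κ s) (hN : 0 ≤ N) (hR : 0 ≤ R)
    (hk : 0 < k) (hl : 0 < l) {z : Plane} (hr' : r' < r) (hz : dist z (P.X t₀) ≤ r') :
    |interfaceTest P t₀ γ B N R k l z|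
      ≤ ((2 * |B| + 8 * R) / κ₀ + 4 * N * r' + r') * dist z (P.X t₀) := by
  have h1 := hG.abs_height_le hP (hz.trans_lt hr')
  have h2 := abs_tangent_le hP t₀ (z - P.X t₀)
  rw [← dist_eq_norm] at h2
  have h3 := hub_le hR hk (height P t₀ γ z)
  have h4 := hub_le hR hl (height P t₀ γ z)
  have h5 := hub_nonneg hR hk (height P t₀ γ z)
  have h6 := hub_nonneg hR hl (height P t₀ γ z)
  unfold interfaceTest
  generalize hub R k (height P t₀ γ z) = H at *
  generalize hub R l (height P t₀ γ z) = H' at *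
  generalize height P t₀ γ z = ζ at *
  generalize inner ℝ (deriv P.X t₀) (z - P.X t₀) = ξ at *
  generalize dist z (P.X t₀) = d at *
  have hd : 0 ≤ d := (abs_nonneg _).trans h2
  have hRζ : 2 * R * |ζ| ≤ 4 * R * d := by
    have := mul_le_mul_of_nonneg_left h1 hR
    linarith
  have hBζ : |B * ζ| ≤ |B| * (2 * d) := by
    rw [abs_mul]; exact mul_le_mul_of_nonneg_left h1 (abs_nonneg _)
  have h7 : |B * ζ + H + H'| ≤ (2 * |B| + 8 * R) * d := by
    have := abs_le.mp hBζ
    rw [abs_le]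
    constructor <;> linarith
  have h8 : |(B * ζ + H + H') / P.κ (P.phase z)| ≤ (2 * |B| + 8 * R) / κ₀ * d := by
    rw [abs_div, abs_of_pos (hP.κ_pos _), div_mul_eq_mul_div]
    exact div_le_div₀ (by positivity) h7 hκ₀ (hκ _)
  have h9 : ζ ^ 2 ≤ 4 * r' * d := by
    rw [← sq_abs]; nlinarith [abs_nonneg ζ]
  have h10 : ξ ^ 2 ≤ r' * d := by
    rw [← sq_abs]; nlinarith [abs_nonneg ξ]
  have h11 := mul_le_mul_of_nonneg_left h9 hN
  have h12 : 0 ≤ N * ζ ^ 2 := by positivity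
  have h13 := abs_le.mp h8
  rw [abs_le]
  constructor <;> nlinarith [sq_nonneg ξ]

theorem IsChart.sign (hP : P.Admissible) {t₀ L r ϖ : ℝ} {γ γ' : ℝ → ℝ}
    (h : IsChart P t₀ γ γ' L r) (hϖ : ϖ = 1 ∨ ϖ = -1) {z : Plane} (hz : dist z (P.X t₀) < r)
    (hpos : 0 < ϖ * height P t₀ γ z) : 0 < ϖ * P.φ z := by
  rcases hϖ with rfl | rfl
  · rw [one_mul] at hpos ⊢
    exact (h.pos_iff z hz).mpr hpos
  · have h1 : ¬ 0 < P.φ z := fun h1 => by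
      have := (h.pos_iff z hz).mp h1
      linarith
    have h2 : P.φ z ≠ 0 := fun h2 => by
      rw [hP.φ_eq_zero_iff (P.openRect_subset_rect (h.mem_openRect z hz)),
        h.mem_interface_iff z hz] at h2
      linarith
    have := lt_of_le_of_ne (not_lt.mp h1) h2
    linarith

theorem IsGraph.continuousOn_height {t₀ L r : ℝ} {γ γ' : ℝ → ℝ} (hP : P.Admissible)
    (h : IsGraph P t₀ γ γ' L r) : ContinuousOn (height P t₀ γ) (Metric.ball (P.X t₀) r) := by
  unfold height
  refine ContinuousOn.sub (by fun_prop) (h.continuousOn.comp (by fun_prop) fun z hz => ?_)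
  rw [Metric.mem_ball, dist_eq_norm] at hz
  exact abs_lt.mp ((abs_tangent_le hP t₀ _).trans_lt hz)

/-- On a ring around `X t₀` one of the two coordinates is not small. -/
theorem IsGraph.coord_of_ring (hP : P.Admissible) {t₀ L r₁ r : ℝ} {γ γ' : ℝ → ℝ}
    (h : IsGraph P t₀ γ γ' L r₁) (hr : 0 < r) (hr₁ : r < r₁) {z : Plane}
    (h1 : r / 2 ≤ dist z (P.X t₀)) (h2 : dist z (P.X t₀) ≤ r) :
    r / 8 ≤ |inner ℝ (deriv P.X t₀) (z - P.X t₀)| ∨ r / 8 ≤ |height P t₀ γ z| := by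
  rw [dist_eq_norm] at h1 h2
  by_contra hcon
  push Not at hcon
  obtain ⟨h3, h4⟩ := hcon
  have h5 := h.abs_apply_le (a := inner ℝ (deriv P.X t₀) (z - P.X t₀)) (by linarith)
  have h6 := norm_sq_eq_tangent_normal hP t₀ (z - P.X t₀)
  have h7 : |inner ℝ (P.normal t₀) (z - P.X t₀)| < r / 4 := by
    have e : inner ℝ (P.normal t₀) (z - P.X t₀)
        = height P t₀ γ z + γ (inner ℝ (deriv P.X t₀) (z - P.X t₀)) := by
      rw [height, sub_add_cancel]
    rw [e]
    refine (abs_add_le _ _).trans_lt ?_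
    linarith
  rw [← sq_abs (inner ℝ (deriv P.X t₀) (z - P.X t₀)),
    ← sq_abs (inner ℝ (P.normal t₀) (z - P.X t₀))] at h6
  nlinarith [abs_nonneg (inner ℝ (deriv P.X t₀) (z - P.X t₀)),
    abs_nonneg (inner ℝ (P.normal t₀) (z - P.X t₀)), norm_nonneg (z - P.X t₀)]

/-- Points near the interface have small height. -/
theorem IsGraph.abs_height_le_of_X (hP : P.Admissible) {t₀ t L r D : ℝ} {γ γ' : ℝ → ℝ}
    (h : IsGraph P t₀ γ γ' L r) {z : Plane} (ht : dist (P.X t) (P.X t₀) < r)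
    (hz : dist z (P.X t₀) < r) (hd : ‖z - P.X t‖ ≤ D) (hLD : L * D ≤ 1) :
    |height P t₀ γ z| ≤ 3 * D := by
  have h1 := abs_le.mp (h.height_taylor hP ht hz)
  rw [(h.mem_interface_iff _ ht).mp ⟨t, rfl⟩, sub_zero] at h1
  have h2 := abs_le.mp (abs_real_inner_le_norm (heightGrad P t₀ γ' (P.X t)) (z - P.X t))
  have h3 := (h.norm_heightGrad hP ht).2
  have h4 := norm_nonneg (z - P.X t)
  have h5 : ‖heightGrad P t₀ γ' (P.X t)‖ * ‖z - P.X t‖ ≤ 2 * D :=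
    mul_le_mul h3 hd h4 (by norm_num)
  have h6 : L * ‖z - P.X t‖ ^ 2 ≤ D := by
    have h7 : ‖z - P.X t‖ ^ 2 ≤ D ^ 2 := pow_le_pow_left₀ h4 hd 2
    have h8 := mul_le_mul_of_nonneg_left h7 h.L_nonneg
    have h9 : L * D * D ≤ 1 * D := mul_le_mul_of_nonneg_right hLD (h4.trans hd)
    nlinarith
  rw [abs_le]
  constructor <;> linarith

end TwoGrid

end

noncomputable section

namespace TwoGrid

open Grid InterfaceProblem Scheme

variable {P : InterfaceProblem} {lam K : ℝ}

theorem exists_dist_X_le (hP : P.Admissible) {z : Plane} {d : ℝ}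
    (h : Metric.infDist z P.interface ≤ d) : ∃ t, ‖z - P.X t‖ ≤ d := by
  obtain ⟨_, ⟨t, rfl⟩, ht⟩ := hP.isCompact_interface.exists_infDist_eq_dist P.interface_nonempty z
  exact ⟨t, by rw [← dist_eq_norm, ← ht]; exact h⟩

set_option maxHeartbeats 1000000 in
/-- Rows near a point of the interface, applied to the test function; see `interfaceTest` for the
choice of the parameters. -/
theorem exists_row_interfaceTest (hP : P.Admissible) {u : Phase → Plane → ℝ}
    (hu : P.IsSolution u) (K : ℝ) {t₀ L r₁ r R B N : ℝ} {γ γ' : ℝ → ℝ}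
    (hG : IsGraph P t₀ γ γ' L r₁) {κ₀ κ₁ C : ℝ} (hκ₀ : 0 < κ₀)
    (hκ : ∀ s, κ₀ ≤ P.κ s ∧ P.κ s ≤ κ₁) (hC : 0 < C)
    (hI : ∀ T : Grid, T.Fits P → T.lam = lam → ∀ a, T.IsNode P a →
      (¬ T.IsVertex a ∨ T.FineInterior P a) →
      Metric.infDist (T.point P a) P.interface ≤ C * T.h)
    (hR : R = 3 * (C + 4)) (hN0 : 0 ≤ N)
    (hN : 4 * |B| * L + 16 * L * R + 2 * κ₁ + 1 ≤ κ₀ * (N / 2)) (hr : 0 < r) (hr₁ : r ≤ r₁ / 4)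
    (hrK : r * (400 * (|K| + 1)) ≤ 1) :
    ∃ δ > 0, ∀ T S e, IsSubsolution P lam K δ T S e → ∀ a, HasRow P T a →
      dist (T.point P a) (P.X t₀) < r / 2 →
      ∑ b ∈ T.stencil P a, S.α a b = 0 ∧ 1 / 2 * T.weight P a ≤ ∑ b ∈ T.stencil P a, S.α a b *
        (interfaceTest P t₀ γ B N R T.fineStep T.h (T.point P b)
          - interfaceTest P t₀ γ B N R T.fineStep T.h (T.point P a)) := by
  classical
  obtain ⟨Cc, hCc0, hCc⟩ := exists_curvCoeff_le hP
  have hL := hG.L_nonneg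
  have hR0 : 0 ≤ R := by rw [hR]; linarith
  have hr₁0 := hG.r_pos
  have hLr := hG.L_mul_le
  have hK0 := abs_nonneg K
  set M := |B| * (2 * (25 * (|K| * (18 * Cc))) + 25 * (|K| * (9 * L / κ₀)))
        + N * (25 * (|K| * 81)) with hM
  have hE0 : 0 ≤ 25 * (|K| * (135 * L / κ₀)) := by positivity
  have hM0 : 0 ≤ M := by positivity
  obtain ⟨δ, ⟨h1, h2, h3, h4, h5, h6⟩, hδ⟩ := (((eventually_mul_lt 1 one_pos).and
    ((eventually_mul_lt 8 hr).and ((eventually_mul_lt (4 * (C + 4)) hr).and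
    ((eventually_mul_lt (L * (C + 4)) one_pos).and
    ((eventually_mul_lt (25 * (|K| * (135 * L / κ₀))) one_pos).and
    (eventually_mul_lt M (c := 1 / 4) (by norm_num))))))).and self_mem_nhdsWithin).exists
  replace hδ : 0 < δ := hδ
  refine ⟨δ, hδ, fun T S e he a ha had => ?_⟩
  have hT := he.fits
  have hh := hT.h_pos
  have hk := hT.fineStep_pos
  have hkh := hT.fineStep_le
  have h4h : 0 ≤ 4 * T.h := by linarith
  have h1h : 0 ≤ 1 / T.h := (one_div_pos.mpr hh).le
  have hhδ := he.h_le
  have hsg := (he.sign a ha).2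
  have hst : ∀ b ∈ T.stencil P a, ‖T.point P b - T.point P a‖ ≤ 4 * T.h := fun b hb =>
    norm_le_of_mem_stencil hT hb
  have hself : a ∈ T.stencil P a := self_mem_stencil ha.1
  have har : dist (T.point P a) (P.X t₀) + 4 * T.h < r₁ := by linarith
  have hbr : ∀ b ∈ T.stencil P a, dist (T.point P b) (P.X t₀) < r := fun b hb => by
    have h7 := dist_triangle (T.point P b) (T.point P a) (P.X t₀)
    have h8 := hst b hb
    rw [← dist_eq_norm] at h8
    linarith
  have hi : T.Interior a := by
    rw [← hT.point_mem_openRect_iff (P := P)]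
    exact hG.mem_openRect _ (by linarith)
  have hζa : |height P t₀ γ (T.point P a)| ≤ r := by
    have := hG.abs_height_le hP (z := T.point P a) (by linarith)
    linarith
  -- the factor that `N ζ²` receives in an exact row
  have hhalf : 1 / 2 ≤ 1 - 4 * L ^ 2 * (4 * T.h) ^ 2 - 8 * L * |height P t₀ γ (T.point P a)| := by
    have h7 : L * |height P t₀ γ (T.point P a)| ≤ L * (r₁ / 4) :=
      mul_le_mul_of_nonneg_left (by linarith) hL
    have h8 : L * T.h ≤ L * (r₁ / 4) := mul_le_mul_of_nonneg_left (by linarith) hL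
    have h9 : 0 ≤ L * T.h := mul_nonneg hL hh.le
    have h10 : (L * T.h) ^ 2 ≤ (1 / 64) ^ 2 := pow_le_pow_left₀ h9 (by linarith) 2
    have e1 : 4 * L ^ 2 * (4 * T.h) ^ 2 = 64 * (L * T.h) ^ 2 := by ring
    rw [e1]
    linarith
  -- exact rows, with the `hub R h` term left open: it is estimated from below by convexity at
  -- regular points, and by its second difference at hanging nodes
  have hexact : ∀ n, ExactRow P T S n a → 2 < n → ∀ c,
      c ≤ ∑ b ∈ T.stencil P a, S.α a b * (hub R T.h (height P t₀ γ (T.point P b))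
        - hub R T.h (height P t₀ γ (T.point P a))) →
      1 + 8 * L * R + c / P.κ (P.phase (T.point P a)) ≤ ∑ b ∈ T.stencil P a, S.α a b *
        (interfaceTest P t₀ γ B N R T.fineStep T.h (T.point P b)
          - interfaceTest P t₀ γ B N R T.fineStep T.h (T.point P a)) := by
    intro n hrow hn c hc
    have h7 := hrow.le_sum_interfaceTest hP hn hsg hG hst h4h har (B := B) hN0 hR0 hk hc
    refine le_trans ?_ h7
    have h8 := hκ (P.phase (T.point P a))
    have h9 : κ₀ * (N / 2) ≤ P.κ (P.phase (T.point P a)) *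
        (N * (1 - 4 * L ^ 2 * (4 * T.h) ^ 2 - 8 * L * |height P t₀ γ (T.point P a)|)) := by
      refine mul_le_mul h8.1 ?_ (by linarith) (hκ₀.le.trans h8.1)
      calc N / 2 = N * (1 / 2) := by ring
        _ ≤ _ := mul_le_mul_of_nonneg_left hhalf hN0
    rw [mul_sub]
    linarith
  have hregular : ∀ n, ExactRow P T S n a → 2 < n → 1 ≤ ∑ b ∈ T.stencil P a, S.α a b *
        (interfaceTest P t₀ γ B N R T.fineStep T.h (T.point P b)
          - interfaceTest P t₀ γ B N R T.fineStep T.h (T.point P a)) := by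
    intro n hrow hn
    have h7 := hrow.le_sum_hub hn hsg (f := fun b => height P t₀ γ (T.point P b))
      (fun b hb => hG.height_taylor hP (by linarith) (by linarith [hbr b hb])) hR0 hh
    refine le_trans (le_of_eq ?_) (hexact n hrow hn _ h7)
    have := (hP.κ_pos (P.phase (T.point P a))).ne'
    field_simp
    ring
  have hnear : ∀ D t, ‖T.point P a - P.X t‖ ≤ D → 4 * D ≤ r → dist (P.X t) (P.X t₀) < r := by
    intro D t h7 h8
    have h9 := dist_triangle (P.X t) (T.point P a) (P.X t₀)
    rw [dist_comm (P.X t) (T.point P a), dist_eq_norm (T.point P a)] at h9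
    linarith
  by_cases hf : T.FineInterior P a
  · by_cases hreg : T.Regular P a
    · have hrow := exactRow_fine hT hf hreg (he.scheme.fine a hf hreg)
      refine ⟨hrow.sum_zero (by norm_num), ?_⟩
      have h7 := hregular 4 hrow (by norm_num)
      rw [Grid.weight, if_pos hf, if_pos hreg]
      linarith
    · obtain ⟨-, t, ht, hex⟩ := he.scheme.immersed a hf hreg
      obtain ⟨m0, m2, m1⟩ := immersed_moments hP hu hex
      have hnine := stencil_of_fineInterior (P := P) (T := T) hf
      have hat : ‖T.point P a - P.X t‖ ≤ T.fineStep := by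
        rw [← dist_eq_norm, ht]
        exact infDist_le_of_not_regular hP hT hf hreg
      have htr : dist (P.X t) (P.X t₀) < r := hnear _ t hat (by linarith)
      have hCδ : 0 ≤ C * δ := mul_nonneg hC.le hδ.le
      have hab : ∀ b ∈ nine a 1, ‖T.point P b - T.point P a‖ ≤ 2 * T.fineStep := fun b hb =>
        norm_le_of_mem_nine_one hT hb
      have hα : ∀ b ∈ nine a 1, |S.α a b| ≤ |K| / T.fineStep ^ 2 := fun b hb => by
        have h7 := (he.coeff a ha b (by rw [hnine]; exact hb)).1
        rw [Grid.localStep, if_pos hf] at h7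
        exact h7.trans (div_le_div_of_nonneg_right (le_abs_self K) (sq_nonneg _))
      rw [hnine] at hbr hself ⊢
      refine ⟨m0, ?_⟩
      have hLδ : L * (C + 4) * T.h ≤ L * (C + 4) * δ :=
        mul_le_mul_of_nonneg_left hhδ (mul_nonneg hL (by linarith))
      have hLC : 0 ≤ L * C := mul_nonneg hL hC.le
      have hLCh : 0 ≤ L * C * T.h := mul_nonneg hLC hh.le
      have hLk : L * T.fineStep ≤ L * T.h := mul_le_mul_of_nonneg_left hkh hL
      have hLk0 : 0 ≤ L * T.h := mul_nonneg hL hh.le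
      have hsm : 25 * (|K| * (135 * L / κ₀)) * T.fineStep ≤ 25 * (|K| * (135 * L / κ₀)) * δ :=
        mul_le_mul_of_nonneg_left (hkh.trans hhδ) hE0
      have key := immersed_le_sum_interfaceTest hP hG hκ₀ (fun s => (hκ s).1) (hCc t) hk hkh hK0 hα
        m0 m2 m1 (by linarith) (fun b hb => by linarith [hbr b hb]) (fun b hb => by
          have h7 := norm_sub_le_norm_sub_add_norm_sub (T.point P b) (T.point P a) (P.X t)
          linarith [hab b hb]) (R := R) (by rw [hR]; linarith) hab hself
        (ρ := r) (fun b hb => (hbr b hb).le) (by linarith) (B := B) hN0 (by linarith)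
      refine le_trans ?_ key
      rw [Grid.weight, if_pos hf, if_neg hreg]
      have h7 : 25 * (|K| * (4 * r)) / T.fineStep ≤ 1 / 4 * (1 / T.fineStep) := by
        rw [div_le_iff₀ hk]
        have : 1 / 4 * (1 / T.fineStep) * T.fineStep = 1 / 4 := by field_simp
        rw [this]
        nlinarith
      have h8 : M ≤ 1 / 4 * (1 / T.fineStep) := by
        have h9 : M * T.fineStep ≤ M * δ := mul_le_mul_of_nonneg_left (by linarith) hM0
        rw [mul_one_div, le_div_iff₀ hk]
        linarith
      linarith
  · by_cases hv : T.IsVertex a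
    · have hrow := exactRow_coarse hT ha.1 hi hf hv he.resolves
        (he.scheme.coarse a ha.1 hi hf hv)
      refine ⟨hrow.sum_zero (by norm_num), ?_⟩
      have h7 := hregular 6 hrow (by norm_num)
      rw [Grid.weight, if_neg hf, if_pos ⟨hi, hv⟩]
      linarith
    · have hrow := exactRow_hanging he.resolves ⟨ha.1, hi, hf, hv⟩
        (he.scheme.hanging a ⟨ha.1, hi, hf, hv⟩)
      refine ⟨hrow.sum_zero (by norm_num), ?_⟩
      rw [Grid.weight, if_neg hf, if_neg fun h => hv h.2]
      obtain ⟨t, ht⟩ := exists_dist_X_le hP (hI T hT he.lam_eq a ha.1 (Or.inl hv))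
      have hCh : (C + 4) * T.h ≤ (C + 4) * δ := mul_le_mul_of_nonneg_left hhδ (by linarith)
      have htr := hnear _ t ht (by linarith)
      have hLC : L * ((C + 4) * T.h) ≤ 1 := by
        have := mul_le_mul_of_nonneg_left hCh hL
        linarith
      have hζ : ∀ b ∈ T.stencil P a, |height P t₀ γ (T.point P b)| ≤ R * T.h := fun b hb => by
        have h7 := norm_sub_le_norm_sub_add_norm_sub (T.point P b) (T.point P a) (P.X t)
        have h8 := hG.abs_height_le_of_X hP (z := T.point P b) (t := t) (D := (C + 4) * T.h)
          (by linarith) (by linarith [hbr b hb]) (by linarith [hst b hb]) hLC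
        rw [hR]
        linarith
      have h7 := hrow.le_sum_hub_of_le hP (by norm_num) hsg hG hst h4h har hh hζ hself
      have h8 := hexact 4 hrow (by norm_num) _ h7
      refine le_trans ?_ h8
      have hκa := hP.κ_pos (P.phase (T.point P a))
      have e1 : P.κ (P.phase (T.point P a)) * (1 - 4 * L ^ 2 * (4 * T.h) ^ 2
          - 8 * L * |height P t₀ γ (T.point P a)|) / T.h / P.κ (P.phase (T.point P a))
          = (1 - 4 * L ^ 2 * (4 * T.h) ^ 2 - 8 * L * |height P t₀ γ (T.point P a)|)
            * (1 / T.h) := by field_simp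
      rw [e1]
      have h9 := mul_le_mul_of_nonneg_right hhalf h1h
      have h10 : 0 ≤ L * R := mul_nonneg hL hR0
      linarith

/-- A point of the interface is good if the points near it on one side of the interface are. -/
theorem good_of_side (hP : P.Admissible) {u : Phase → Plane → ℝ} (hu : P.IsSolution u)
    (hlam : 0 < lam) {t₀ ϖ r₀ : ℝ} (hϖ : ϖ = 1 ∨ ϖ = -1) (hr₀ : 0 < r₀)
    (hg : ∀ z, dist z (P.X t₀) < r₀ → 0 < ϖ * P.φ z → Good P lam K z) :
    Good P lam K (P.X t₀) := by
  obtain ⟨γ, γ', L, r₁, hG⟩ := exists_isChart hP t₀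
  obtain ⟨κ₀, κ₁, hκ₀, hκ⟩ := hP.exists_κ_bounds
  obtain ⟨C, hC, hI⟩ := exists_infDist_le hP hlam
  have hκ₁ : 0 < κ₁ := hκ₀.trans_le ((hκ Phase.minus).1.trans (hκ Phase.minus).2)
  have hL := hG.L_nonneg
  have hr₁ := hG.r_pos
  have hϖ2 : ϖ ^ 2 = 1 := by rcases hϖ with rfl | rfl <;> norm_num
  have hϖa : |ϖ| = 1 := by rcases hϖ with rfl | rfl <;> simp
  set R := 3 * (C + 4) with hR
  have hR0 : 0 ≤ R := by positivity
  set B := (4 * R + 1) * ϖ with hB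
  set N := 2 * (4 * |B| * L + 16 * L * R + 2 * κ₁ + 1) / κ₀ with hN
  have hN0 : 0 ≤ N := by positivity
  have hNκ : 4 * |B| * L + 16 * L * R + 2 * κ₁ + 1 ≤ κ₀ * (N / 2) := by
    rw [hN]; apply le_of_eq; field_simp
  obtain ⟨r, ⟨hrr₁, hrr₀, hrK, hrN⟩, hr⟩ := (((eventually_mul_lt 4 hr₁).and
    ((eventually_mul_lt 1 hr₀).and ((eventually_mul_lt (400 * (|K| + 1)) one_pos).and
    (eventually_mul_lt (2 * N) (c := 1 / (2 * κ₁)) (by positivity))))).and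
    self_mem_nhdsWithin).exists
  replace hr : 0 < r := hr
  -- points of the ring with height at least `θ` on the good side are good; elsewhere on the ring the
  -- test function is negative
  obtain ⟨θ, ⟨hθ1, hθr, hθs⟩, hθ⟩ := (((eventually_mul_lt 1 one_pos).and
    ((eventually_mul_lt 8 hr).and (eventually_mul_lt ((8 * R + 1) / κ₀ + N) (c := r ^ 2 / 128)
      (by positivity)))).and self_mem_nhdsWithin).exists
  replace hθ : 0 < θ := hθ
  obtain ⟨δ₀, hδ₀, hrow⟩ := exists_row_interfaceTest hP hu K (B := B) hG.toIsGraph hκ₀ hκ hC hI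
    hR hN0 hNκ hr (by linarith) (by linarith)
  set A := Metric.closedBall (P.X t₀) r ∩ (height P t₀ γ) ⁻¹' {y | θ ≤ ϖ * y} with hA
  have hAc : IsCompact A := by
    refine (isCompact_closedBall (P.X t₀) r).of_isClosed_subset ?_ Set.inter_subset_left
    refine ((hG.continuousOn_height hP).mono fun z hz => ?_).preimage_isClosed_of_isClosed
      Metric.isClosed_closedBall (isClosed_le continuous_const (by fun_prop))
    rw [Metric.mem_closedBall] at hz
    rw [Metric.mem_ball]
    linarith
  refine good_of_test hP hlam (c := min (r ^ 2 / 128) (r / (16 * κ₁)))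
    (B := (2 * |B| + 8 * R) / κ₀ + 4 * N * r + r) hr (by positivity) (by positivity) hAc
    (fun z hz => ?_) (fun T a => interfaceTest P t₀ γ B N R T.fineStep T.h (T.point P a)) ?_ ?_
    ⟨1, one_pos, fun ε hε _ => ?_⟩
  · have hz1 : dist z (P.X t₀) ≤ r := hz.1
    have hz2 : θ ≤ ϖ * height P t₀ γ z := hz.2
    exact hg z (by linarith) (hG.sign hP hϖ (by linarith) (by linarith))
  · intro T hT a ha had
    exact abs_interfaceTest_le hP hG.toIsGraph hκ₀ (fun s => (hκ s).1) hN0 hR0 hT.fineStep_pos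
      hT.h_pos (by linarith) had
  · intro T hT a ha h1 h2
    by_cases hy : θ ≤ ϖ * height P t₀ γ (T.point P a)
    · exact Or.inr ⟨h2, hy⟩
    · left
      push Not at hy
      have hζ := hG.abs_height_le hP (z := T.point P a) (by linarith)
      have hya : |ϖ * height P t₀ γ (T.point P a)| = |height P t₀ γ (T.point P a)| := by
        rw [abs_mul, hϖa, one_mul]
      have key := interfaceTest_ring_le (R := R) (κ := P.κ (P.phase (T.point P a)))
        (κ₀ := κ₀) (κ₁ := κ₁) (N := N) (r := r) (θ := θ)
        (ξ := inner ℝ (deriv P.X t₀) (T.point P a - P.X t₀))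
        (y := ϖ * height P t₀ γ (T.point P a))
        (H := hub R T.fineStep (height P t₀ γ (T.point P a)))
        (H' := hub R T.h (height P t₀ γ (T.point P a))) hR0 hκ₀ (hκ _).1 (hκ _).2 hN0 hr hθ
        (by linarith) (by linarith) (by linarith)
        (by rw [hya]; exact hub_le hR0 hT.fineStep_pos _) (by rw [hya]; exact hub_le hR0 hT.h_pos _)
        (by
          rw [hya]
          have : N * |height P t₀ γ (T.point P a)| ≤ N * (2 * r) :=
            mul_le_mul_of_nonneg_left (by linarith) hN0
          linarith) hy (by
          rw [hya]
          exact hG.coord_of_ring hP hr (by linarith) h1 h2)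
      refine le_trans (le_of_eq ?_) key
      rw [mul_pow, hϖ2, one_mul, ← mul_assoc, ← hB]
      rfl
  · refine ⟨min δ₀ (ε / 4), by positivity, fun T S e he a ha had μ hμ hμ1 => ?_⟩
    obtain ⟨h1, h2⟩ := hrow T S e (he.mono (min_le_left _ _)) a ha had
    have hw := Grid.weight_pos he.fits a
    have h3 : min δ₀ (ε / 4) * T.weight P a ≤ ε / 4 * T.weight P a :=
      mul_le_mul_of_nonneg_right (min_le_right _ _) hw.le
    have h4 := mul_le_mul_of_nonneg_left h2 hε.le
    have h5 : 0 < ε * T.weight P a := mul_pos hε hw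
    rw [h1, mul_zero]
    linarith

end TwoGrid

end

noncomputable section

namespace TwoGrid

open Grid InterfaceProblem Scheme

variable {P : InterfaceProblem} {lam K : ℝ}

/-! ### All points are good -/

/-- A bad point off the interface has only bad points near it: otherwise a ball of good points
touches the bad set at some point `p`, and the paraboloid centred along that radius shows that `p`
is good. -/
theorem mem_interior_bad_of_notMem_interface (hP : P.Admissible) (hlam : 0 < lam) {x : Plane}
    (hx : x ∈ P.openRect) (hxΓ : x ∉ P.interface) (hbad : ¬ Good P lam K x) :
    x ∈ interior {x | x ∈ P.rect ∧ ¬ Good P lam K x} := by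
  set Z := {x | x ∈ P.rect ∧ ¬ Good P lam K x} with hZ
  have hZc : IsClosed Z := P.isClosed_rect.inter isOpen_good.isClosed_compl
  have hO : IsOpen (P.openRect ∩ P.interfaceᶜ) :=
    P.isOpen_openRect.inter hP.isCompact_interface.isClosed.isOpen_compl
  obtain ⟨ρ, hρ, hball⟩ := Metric.isOpen_iff.mp hO x ⟨hx, hxΓ⟩
  rw [mem_interior_iff_mem_nhds]
  by_contra hcon
  have hxZ : x ∈ Z := ⟨P.openRect_subset_rect hx, hbad⟩
  -- a good point `y` near `x`, and the bad point `p` nearest to it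
  obtain ⟨y, hyx, hyZ⟩ : ∃ y, dist y x < ρ / 2 ∧ y ∉ Z := by
    by_contra hall
    push Not at hall
    exact hcon (Metric.mem_nhds_iff.mpr ⟨ρ / 2, by linarith, fun y hy => hall y hy⟩)
  have hne : Z.Nonempty := ⟨x, hxZ⟩
  obtain ⟨p, hp, hpd⟩ := hZc.exists_infDist_eq_dist hne y
  have hle : dist y p ≤ dist y x := hpd ▸ Metric.infDist_le_dist_of_mem hxZ
  have hin : ∀ z, dist z y ≤ dist y p → z ∈ P.openRect ∩ P.interfaceᶜ := fun z hz =>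
    hball (by rw [Metric.mem_ball]; linarith [dist_triangle z y x])
  have hpin := hin p (by rw [dist_comm])
  have hyp : y ≠ p := fun h => hyZ (h ▸ hp)
  refine hp.2 (good_of_quadratic hP hlam (w := y - p) hpin.2 (sub_ne_zero.mpr hyp) one_pos
    (fun z hz hzp _ hzw => ?_) fun s hs => absurd hs (P.notMem_side hpin.1 s))
  by_contra hzg
  have h1 : Metric.infDist y Z ≤ dist y z := Metric.infDist_le_dist_of_mem ⟨hz, hzg⟩
  rw [hpd, dist_eq_norm, dist_eq_norm] at h1
  have h2 : ‖y - z‖ ^ 2 = ‖y - p‖ ^ 2 - 2 * inner ℝ (y - p) (z - p) + ‖z - p‖ ^ 2 := by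
    rw [← norm_sub_sq_real, sub_sub_sub_cancel_right]
  have h3 : 0 < ‖z - p‖ := norm_pos_iff.mpr (sub_ne_zero.mpr hzp)
  nlinarith [norm_nonneg (y - p), norm_nonneg (y - z)]

/-- A bad point on the interface has only bad points near it: if a half-box contained a good point,
all of it would be good, and `good_of_side` would apply. -/
theorem mem_interior_bad_of_mem_interface (hP : P.Admissible) {u : Phase → Plane → ℝ}
    (hu : P.IsSolution u) (hlam : 0 < lam) {t : ℝ} (hbad : ¬ Good P lam K (P.X t)) :
    P.X t ∈ interior {x | x ∈ P.rect ∧ ¬ Good P lam K x} := by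
  set Z := {x | x ∈ P.rect ∧ ¬ Good P lam K x} with hZ
  obtain ⟨γ, γ', L, r, hG⟩ := exists_isGraph hP t
  have hr := hG.r_pos
  obtain ⟨V, hVc, hVR, hVp, hVm, hV⟩ := hG.exists_sides hP
  have hφ : ∀ z, dist z (P.X t) < r / 16 → (0 < P.φ z → z ∈ V Phase.plus) ∧
      (P.φ z < 0 → z ∈ V Phase.minus) := by
    intro z hz
    have hne : P.φ z ≠ 0 → height P t γ z ≠ 0 := fun h h0 => h
      ((hP.φ_eq_zero_iff (P.openRect_subset_rect (hG.mem_openRect z (by linarith)))).mpr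
        ((hG.mem_interface_iff z (by linarith)).mpr h0))
    refine ⟨fun h => ?_, fun h => ?_⟩
    · rcases (hne h.ne').lt_or_gt with h1 | h1
      · linarith [hVm z ((hV z hz).2 h1)]
      · exact (hV z hz).1 h1
    · rcases (hne h.ne).lt_or_gt with h1 | h1
      · exact (hV z hz).2 h1
      · linarith [hVp z ((hV z hz).1 h1)]
  have hVΓ : ∀ s, ∀ z ∈ V s, z ∉ P.interface := by
    rintro s z hz ⟨t', rfl⟩
    have h0 := hP.φ_zero t'
    cases s
    · linarith [hVm _ hz]
    · linarith [hVp _ hz]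
  -- a half-box that contains a bad point is bad
  have hsub : ∀ s, ∀ z ∈ V s, ¬ Good P lam K z → V s ⊆ Z := by
    intro s z hz hzb
    refine ((hVc s).subset_left_of_subset_union isOpen_interior 
      (isOpen_good (P := P) (lam := lam) (K := K)) ?_
      (fun y hy => ?_) ⟨z, hz, mem_interior_bad_of_notMem_interface hP hlam (hVR s hz)
        (hVΓ s z hz) hzb⟩).trans interior_subset
    · exact Set.disjoint_left.mpr fun y hy hyg => (interior_subset hy).2 hyg
    · by_cases hyg : Good P lam K y
      · exact Or.inr hyg
      · exact Or.inl (mem_interior_bad_of_notMem_interface hP hlam (hVR s hy) (hVΓ s y hy) hyg)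
  have hplus : V Phase.plus ⊆ Z := by
    by_contra hcon
    refine hbad (good_of_side hP hu hlam (ϖ := 1) (Or.inl rfl) (r₀ := r / 16) (by linarith)
      fun z hz hpos => ?_)
    by_contra hzb
    exact hcon (hsub _ z ((hφ z hz).1 (by linarith)) hzb)
  have hminus : V Phase.minus ⊆ Z := by
    by_contra hcon
    refine hbad (good_of_side hP hu hlam (ϖ := -1) (Or.inr rfl) (r₀ := r / 16) (by linarith)
      fun z hz hpos => ?_)
    by_contra hzb
    exact hcon (hsub _ z ((hφ z hz).2 (by linarith)) hzb)
  rw [mem_interior_iff_mem_nhds, Metric.mem_nhds_iff]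
  refine ⟨r / 16, by linarith, fun z hz => ?_⟩
  have hzr : z ∈ P.rect := P.openRect_subset_rect (hG.mem_openRect z (by
    rw [Metric.mem_ball] at hz; linarith))
  rcases lt_trichotomy (P.φ z) 0 with h | h | h
  · exact hminus ((hφ z hz).2 h)
  · obtain ⟨t', rfl⟩ := (hP.φ_eq_zero_iff hzr).mp h
    refine ⟨hzr, fun hg => ?_⟩
    have hc : Filter.Tendsto (fun ε : ℝ => P.X t' + ε • P.normal t') (𝓝[>] 0) (𝓝 (P.X t')) := by
      have : Continuous fun ε : ℝ => P.X t' + ε • P.normal t' := by fun_prop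
      have := this.tendsto 0
      rw [zero_smul, add_zero] at this
      exact this.mono_left nhdsWithin_le_nhds
    obtain ⟨ε, ⟨h1, h2⟩, h3⟩ := (((hP.φ_sign t').and (hc.eventually
      (isOpen_good.mem_nhds hg))).and (hc.eventually (Metric.isOpen_ball.mem_nhds hz))).exists
    exact (hplus ((hφ _ h3).1 h1.2)).2 h2
  · exact hplus ((hφ z hz).1 h)

/-- Strong maximum principle: if a single point of the closed rectangle is good, all points of the
open rectangle are. -/
theorem good_of_mem_openRect (hP : P.Admissible) {u : Phase → Plane → ℝ} (hu : P.IsSolution u)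
    (hlam : 0 < lam) (hne : ∃ x ∈ P.rect, Good P lam K x) {y : Plane} (hy : y ∈ P.openRect) :
    Good P lam K y := by
  set Z := {x | x ∈ P.rect ∧ ¬ Good P lam K x} with hZ
  have hdich : ∀ z ∈ P.openRect, z ∈ interior Z ∨ Good P lam K z := by
    intro z hz
    by_cases hg : Good P lam K z
    · exact Or.inr hg
    · left
      by_cases hzΓ : z ∈ P.interface
      · obtain ⟨t, rfl⟩ := hzΓ
        exact mem_interior_bad_of_mem_interface hP hu hlam hg
      · exact mem_interior_bad_of_notMem_interface hP hlam hz hzΓ hg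
  have hdisj : Disjoint (interior Z) {x | Good P lam K x} :=
    Set.disjoint_left.mpr fun y hy hyg => (interior_subset hy).2 hyg
  by_contra hyb
  have hsub := P.convex_openRect.isPreconnected.subset_left_of_subset_union isOpen_interior
    isOpen_good hdisj hdich ⟨y, hy, (hdich y hy).resolve_right hyb⟩
  obtain ⟨x, hx, hxg⟩ := hne
  -- the points of the open rectangle near `x` are good
  have hc : Filter.Tendsto (fun ε : ℝ => x + ε • (y - x)) (𝓝[>] 0) (𝓝 x) := by
    have : Continuous fun ε : ℝ => x + ε • (y - x) := by fun_prop
    have := this.tendsto 0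
    rw [zero_smul, add_zero] at this
    exact this.mono_left nhdsWithin_le_nhds
  obtain ⟨ε, h1, h2⟩ := ((hc.eventually (isOpen_good.mem_nhds hxg)).and
    (Ioo_mem_nhdsGT one_pos)).exists
  have hmem : x + ε • (y - x) ∈ P.openRect := by
    intro i
    have h3 := hx i
    have h4 := hy i
    simp only [PiLp.add_apply, PiLp.smul_apply, PiLp.sub_apply, smul_eq_mul]
    constructor <;> nlinarith [h2.1, h2.2]
  exact (interior_subset (hsub hmem)).2 h1

/-- A point of a side that is not a corner lies on no other side. -/
theorem side_unique (hP : P.Admissible) {s s' : Side} {x : Plane} (hx : x ∈ P.side s)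
    (hx' : x ∈ P.side s') (h : ∀ i, i ≠ s.1 → P.lo i < x i ∧ x i < P.hi i) : s' = s := by
  have h1 : s'.1 = s.1 := by
    by_contra hne
    have h2 := h _ hne
    have h3 := hx'.2
    split_ifs at h3 <;> linarith
  refine Prod.ext h1 ?_
  have e1 := hx.2
  have e2 := hx'.2
  rw [h1] at e2
  have := hP.lo_lt_hi s.1
  cases hs : s.2 <;> cases hs' : s'.2 <;> simp_all

/-- A point that is not a corner, and is of Robin type or has only Dirichlet points of its side near
it, is good; the segment on which the condition is not the pure Neumann one contains such a
point. -/
theorem exists_good (hP : P.Admissible) (hlam : 0 < lam) : ∃ x ∈ P.rect, Good P lam K x := by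
  obtain ⟨s, p, hp, q, hq, hpq, hseg⟩ := hP.not_pure_neumann
  -- it suffices to find a point of Robin or Dirichlet type that is not a corner
  have key : ∀ x ∈ P.side s, (∀ i, i ≠ s.1 → P.lo i < x i ∧ x i < P.hi i) →
      (0 < P.σ s x ∨ ∀ᶠ y in 𝓝 x, y ∈ P.side s → y ∈ P.D) → ∃ x ∈ P.rect, Good P lam K x := by
    intro x hx hi hb
    refine ⟨x, hx.1, good_of_quadratic hP hlam (w := s.normal) (fun h => P.notMem_side
      (hP.interface_subset h) s hx) (fun h => ?_) one_pos (fun y hy hyx _ hyw => ?_)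
      fun s' hs' => ?_⟩
    · have := norm_side_normal s
      rw [h, norm_zero] at this
      norm_num at this
    · have h1 := inner_side_normal_nonpos s hx hy
      have h2 : 0 < ‖y - x‖ := norm_pos_iff.mpr (sub_ne_zero.mpr hyx)
      nlinarith
    · rw [side_unique hP hx hs' hi]
      exact Or.inr hb
  set j : Fin 2 := s.1 + 1 with hj
  have hij : ∀ i : Fin 2, i = s.1 ∨ i = j := by
    rw [hj]; generalize s.1 = k; revert k; decide
  have hjs : ∀ i : Fin 2, i ≠ s.1 → i = j := fun i hi => (hij i).resolve_left hi
  have hpqs : p s.1 = q s.1 := by rw [hp.2, hq.2]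
  have hpqj : p j ≠ q j := by
    intro h
    refine hpq ?_
    ext i
    rcases hij i with rfl | rfl
    · exact hpqs
    · exact h
  set f : ℝ → Plane := fun θ => (1 - θ) • p + θ • q with hf
  have hfi : ∀ θ i, f θ i = (1 - θ) * p i + θ * q i := fun θ i => by simp [f]
  have hfseg : ∀ θ, 0 ≤ θ → θ ≤ 1 → f θ ∈ segment ℝ p q := fun θ h0 h1 =>
    ⟨1 - θ, θ, by linarith, h0, by ring, rfl⟩
  have hfside : ∀ θ, 0 ≤ θ → θ ≤ 1 → f θ ∈ P.side s := fun θ h0 h1 => by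
    refine ⟨P.convex_rect.segment_subset hp.1 hq.1 (hfseg θ h0 h1), ?_⟩
    rw [hfi, ← hpqs, ← hp.2]; ring
  have hfin : ∀ θ, 0 < θ → θ < 1 → ∀ i, i ≠ s.1 → P.lo i < f θ i ∧ f θ i < P.hi i := by
    intro θ h0 h1 i hi
    rw [hjs i hi, hfi]
    have h2 := hp.1 j
    have h3 := hq.1 j
    rcases hpqj.lt_or_gt with h | h <;> constructor <;> nlinarith
  by_cases hσ : ∃ θ, 0 ≤ θ ∧ θ ≤ 1 ∧ 0 < P.σ s (f θ)
  · obtain ⟨θ₀, h0, h1, hpos⟩ := hσ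
    have hcont : ContinuousOn (fun θ => P.σ s (f θ)) (Set.Icc 0 1) :=
      (hP.σ_continuous s).comp (by fun_prop) fun θ hθ => hfside θ hθ.1 hθ.2
    have hev : ∀ᶠ θ in 𝓝[Set.Ioo 0 1] θ₀, 0 < P.σ s (f θ) :=
      ((hcont θ₀ ⟨h0, h1⟩).mono Set.Ioo_subset_Icc_self).eventually (lt_mem_nhds hpos)
    have hcl : θ₀ ∈ closure (Set.Ioo (0 : ℝ) 1) := by
      rw [closure_Ioo zero_ne_one]; exact ⟨h0, h1⟩
    have := mem_closure_iff_nhdsWithin_neBot.mp hcl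
    obtain ⟨θ, hθ, hθm⟩ := (hev.and self_mem_nhdsWithin).exists
    exact key _ (hfside θ hθm.1.le hθm.2.le) (hfin θ hθm.1 hθm.2) (Or.inl hθ)
  · push Not at hσ
    have hD : ∀ θ, 0 ≤ θ → θ ≤ 1 → f θ ∈ P.D := fun θ h0 h1 =>
      (hseg _ (hfseg θ h0 h1)).resolve_right (not_lt.mpr (hσ θ h0 h1))
    refine key (f (1 / 2)) (hfside _ (by norm_num) (by norm_num))
      (hfin _ (by norm_num) (by norm_num)) (Or.inr ?_)
    have hd : q j - p j ≠ 0 := sub_ne_zero.mpr hpqj.symm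
    have hc : Continuous fun y : Plane => (y j - p j) / (q j - p j) := by
      have : Continuous fun y : Plane => y j := (EuclideanSpace.proj j : Plane →L[ℝ] ℝ).continuous
      fun_prop
    have hhalf : (f (1 / 2) j - p j) / (q j - p j) = 1 / 2 := by
      rw [hfi]; field_simp; ring
    have hev := (hc.tendsto (f (1 / 2))).eventually
      (Ioo_mem_nhds (a := 0) (b := 1) (by rw [hhalf]; norm_num) (by rw [hhalf]; norm_num))
    filter_upwards [hev] with y hy hys
    have hyf : y = f ((y j - p j) / (q j - p j)) := by
      ext i
      rw [hfi]
      rcases hij i with rfl | rfl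
      · rw [← hpqs, hys.2, hp.2]; ring
      · field_simp; ring
    rw [hyf]
    exact hD _ hy.1.le hy.2.le

/-- All points of the closed rectangle are good: the Hopf lemma on the sides and, after them, at the
corners. -/
theorem good_of_mem_rect (hP : P.Admissible) {u : Phase → Plane → ℝ} (hu : P.IsSolution u)
    (hlam : 0 < lam) : ∀ x ∈ P.rect, Good P lam K x := by
  classical
  set σ : Plane → Finset Side := fun x => Finset.univ.filter fun s => x ∈ P.side s with hσ
  have hmem : ∀ x s, s ∈ σ x ↔ x ∈ P.side s := fun x s => by simp [σ]
  suffices h : ∀ n, ∀ x ∈ P.rect, (σ x).card = n → Good P lam K x from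
    fun x hx => h _ x hx rfl
  intro n
  induction n using Nat.strong_induction_on with
  | _ n ih =>
    intro x hx hn
    by_cases hxo : x ∈ P.openRect
    · exact good_of_mem_openRect hP hu hlam (exists_good hP hlam) hxo
    · obtain ⟨s₀, hs₀⟩ := P.exists_mem_side hx hxo
      -- the direction into the rectangle; points `y ≠ x` near `x` in the half-plane of `w` lie on fewer
      -- sides
      set w : Plane := -∑ s ∈ σ x, s.normal with hw
      have hwν : ∀ s ∈ σ x, inner ℝ w s.normal = (-1 : ℝ) := by
        intro s hs
        rw [hw, inner_neg_left, sum_inner, Finset.sum_eq_single s]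
        · rw [real_inner_self_eq_norm_sq, norm_side_normal, one_pow]
        · intro s' hs' hne
          exact inner_side_normal_of_ne hP hne ((hmem _ _).mp hs') ((hmem _ _).mp hs)
        · exact fun h => absurd hs h
      have hclosed : ∀ᶠ y in 𝓝 x, ∀ s, x ∉ P.side s → y ∉ P.side s := by
        refine Filter.eventually_all.mpr fun s => ?_
        by_cases hs : x ∈ P.side s
        · exact Filter.Eventually.of_forall fun y h => absurd hs h
        · filter_upwards [(P.isClosed_side s).isOpen_compl.mem_nhds hs] with y hy _
          exact hy
      obtain ⟨r, hr, hball⟩ := Metric.eventually_nhds_iff.mp hclosed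
      refine good_of_quadratic hP hlam (w := w) (fun h => hxo (hP.interface_subset h))
        (fun h => ?_) (r₀ := r / 2) (by linarith) (fun y hy hyx hyd hyw => ?_)
        fun s hs => Or.inl ?_
      · have := hwν s₀ ((hmem _ _).mpr hs₀)
        rw [h, inner_zero_left] at this
        norm_num at this
      · refine ih (σ y).card ?_ y hy rfl
        rw [← hn]
        refine Finset.card_lt_card ⟨fun s hs => ?_, fun hsub => ?_⟩
        · by_contra hcon
          rw [hmem] at hs hcon
          exact hball (by linarith) s hcon hs
        · have h1 : inner ℝ w (y - x) = 0 := by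
            rw [hw, inner_neg_left, sum_inner, Finset.sum_eq_zero, neg_zero]
            intro s hs
            exact inner_side_normal_of_mem s ((hmem _ _).mp hs) ((hmem _ _).mp (hsub hs))
          have h2 : 0 < ‖y - x‖ := norm_pos_iff.mpr (sub_ne_zero.mpr hyx)
          rw [h1] at hyw
          nlinarith
      · rw [hwν s ((hmem _ _).mpr hs)]
        norm_num

/-- Stability: the weighted residual of a function that vanishes at the Dirichlet points bounds its
maximum. -/
theorem exists_stability (hP : P.Admissible) {u : Phase → Plane → ℝ} (hu : P.IsSolution u)
    (hlam : 0 < lam) (K : ℝ) : ∃ δ > 0, ∀ T : Grid, T.Fits P → T.lam = lam → T.h ≤ δ →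
      T.Resolves P → ∀ S : Scheme, S.IsTwoGrid P T K → S.SignProperty P T → S.CoeffBound P T K →
      ∀ (e : Node → ℝ) (ρ : ℝ), 0 ≤ ρ → (∀ a, T.IsNode P a → T.point P a ∈ P.D → e a = 0) →
        (∀ a, HasRow P T a → |∑ b ∈ T.stencil P a, S.α a b * e b| ≤ δ * ρ * T.weight P a) →
        ∀ a, T.IsNode P a → |e a| ≤ ρ := by
  obtain ⟨δ, hδ, hgood⟩ := exists_uniform_good P.isCompact_rect
    (good_of_mem_rect (K := K) hP hu hlam)
  refine ⟨δ, hδ, fun T hT hl hh hres S hS hsign hcoeff e ρ hρ hD hrow a₀ ha₀ => ?_⟩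
  by_contra hcon
  push Not at hcon
  have hfin : {a | T.IsNode P a}.Finite := finite_inRange.subset fun a ha => ha.1
  obtain ⟨a, ha, hmax⟩ := Set.exists_max_image _ (fun a => |e a|) hfin ⟨a₀, ha₀⟩
  obtain ⟨M, hM⟩ : ∃ M, M = |e a| := ⟨_, rfl⟩
  have hρM : ρ < M := hM ▸ hcon.trans_le (hmax a₀ ha₀)
  have hM0 : 0 < M := hρ.trans_lt hρM
  have hmax' : ∀ b, T.IsNode P b → |e b| ≤ M := fun b hb => hM ▸ hmax b hb
  -- after normalization by `c = ± 1 / max |e|` the maximal value is `1`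
  obtain ⟨c, hc, hca⟩ : ∃ c, |c| = M⁻¹ ∧ c * e a = 1 := by
    have hne : e a ≠ 0 := fun h => by rw [h, abs_zero] at hM; exact hM0.ne' hM
    exact ⟨(e a)⁻¹, by rw [abs_inv, hM], inv_mul_cancel₀ hne⟩
  have hsub : IsSubsolution P lam K δ T S fun b => c * e b := by
    refine ⟨hT, hl, hh, hres, hS, hsign, hcoeff, fun b hb => ?_, fun b hb hbD => ?_,
      fun b hb => ?_⟩
    · refine (le_abs_self _).trans ?_
      rw [abs_mul, hc, inv_mul_le_iff₀ hM0, mul_one]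
      exact hmax' b hb
    · rw [hD b hb hbD, mul_zero]
    · have h1 : ∑ b' ∈ T.stencil P b, S.α b b' * (c * e b')
          = c * ∑ b' ∈ T.stencil P b, S.α b b' * e b' := by
        rw [Finset.mul_sum]
        exact Finset.sum_congr rfl fun b' _ => by ring
      have hw := Grid.weight_pos hT b
      have h2 : |c * ∑ b' ∈ T.stencil P b, S.α b b' * e b'| ≤ δ * T.weight P b := by
        rw [abs_mul, hc, inv_mul_le_iff₀ hM0]
        refine (hrow b hb).trans ?_
        nlinarith [mul_le_mul_of_nonneg_left hρM.le (mul_pos hδ hw).le]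
      rw [h1]
      linarith [neg_abs_le (c * ∑ b' ∈ T.stencil P b, S.α b b' * e b')]
  have h := hgood T S _ hsub a ha ((hT.point_mem_rect_iff a).mpr ha.1)
  simp only [hca] at h
  linarith

end TwoGrid

end

theorem theorem1 (P : TwoGrid.InterfaceProblem) (hP : P.Admissible)
    (u : TwoGrid.Phase → TwoGrid.Plane → ℝ) (hu : P.IsSolution u)
    (lam : ℝ) (hlam : 0 < lam) (K : ℝ) :
    ∃ C h₀ : ℝ, 0 < h₀ ∧
      ∀ T : TwoGrid.Grid, T.Fits P → T.lam = lam → T.h ≤ h₀ → T.Resolves P →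
      ∀ S : TwoGrid.Scheme, S.IsTwoGrid P T K → S.SignProperty P T → S.CoeffBound P T K →
      ∀ U : TwoGrid.Node → ℝ, S.Solves P T U →
      ∀ a : TwoGrid.Node, T.IsNode P a →
        |u (P.phase (T.point P a)) (T.point P a) - U a| ≤ C * (T.h ^ 3 + (T.h / T.r) ^ 2) := by
  obtain ⟨C, h₁, hC, hh₁, hres⟩ := TwoGrid.Scheme.exists_residual_le hP hu K
  obtain ⟨δ, hδ, hstab⟩ := TwoGrid.exists_stability hP hu hlam K
  refine ⟨C / δ, min h₁ δ, lt_min hh₁ hδ, fun T hT hl hh hR S hS hsign hcoeff U hU => ?_⟩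
  have hk := hT.fineStep_pos
  have hh0 := hT.h_pos
  refine hstab T hT hl (hh.trans (min_le_right _ _)) hR S hS hsign hcoeff
    (fun b => TwoGrid.Scheme.nodal P T u b - U b) (C / δ * (T.h ^ 3 + T.fineStep ^ 2))
    (by positivity) (fun b hb hbD => ?_) fun b hb => ?_
  · exact sub_eq_zero.mpr ((hu.dirichlet _ hbD).trans (hU.dirichlet b hb hbD).symm)
  · refine (hres T hT (hh.trans (min_le_left _ _)) hR S hS hcoeff U hU b hb).trans_eq ?_
    field_simp
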